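/- Let $K$ be an algebraically closed field, $Q$ a finite quiver, $I\subseteq KQ$ an admissible ideal, and $A=KQ/I$, with Jacobson radical $J$, primitive idempotents $e_i$ and simple modules $S_i$ corresponding to the vertices $i$ of $Q$; let $L+1$ be the Loewy length of $A$. Paths are composed from right to left, and modules are left modules. Suppose that $A$ is self-injective and $J^3=0$. Notation. For a finite family $(e(r))_r$ of vertices put $P=\bigoplus_r Az_r$ and $\widehat P=\bigoplus_r KQz_r$, where $z_r$ corresponds to the idempotent $e_{e(r)}$. A skeleton in $\widehat P$ is a set $\sigma$ of paths $pz_r$ ($p$ a path of length at most $L$ starting in $e(r)$) that is closed under initial subpaths. Its radical layering $\mathbb S(\sigma)$ records, for each $l$ and $i$, the number of paths of length $l$ in $\sigma$ ending in $i$, and $\underline{\dim}\,\sigma$ records the number of paths in $\sigma$ ending in $i$. The radical layering $\mathbb S(M)$ of an $A$-module $M$ records the multiplicities of the $S_i$ in $J^lM/J^{l+1}M$. A skeleton $\sigma$ with $\mathbb S(\sigma)=\mathbb S(M)$ is a skeleton of $M$ relative to a $KQ$-homomorphism $f:\widehat P\to M$ if the elements $f(z_r)$ with $z_r\in\sigma$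 induce a $K$-basis of $M/JM$ and $f$ maps $\sigma$ bijectively onto a $K$-basis of $M$; it is a skeleton of $M$ if this holds for some $f$, and a distinguished skeleton of $M=P/C$ if it holds for the canonical map $\widehat P\to P/C$. The tree of $\sigma$ at $r$ is the set of all paths $pz_r$ in $\sigma$. Call $\sigma$ normalized if each of its trees either contains only paths of length at most $1$ or is a skeleton of an indecomposable projective module $Ae_{e(r)}$ of Loewy length $3$. Finally, let $$\mathrm{Gr}_\sigma(P)=\{C\subseteq P \text{ a submodule} : \mathbb S(P/C)=\mathbb S(\sigma)\text{ and }\sigma\text{ is a distinguished skeleton of }P/C\},$$ a subvariety of the Grassmannian of $(\dim P-|\sigma|)$-dimensional subspaces of $P$, which is embedded in $\mathbb P(\Lambda^{\dim P-|\sigma|}P)$ by the Plücker embedding. (1) If $\sigma$ is a normalized skeleton in $\widehat P$ that contains all $z_r$, then $\mathfrak{Grass}(\sigma):=\mathrm{Gr}_\sigma(P)$ is a locally closed subvariety of $\mathbb P(\Lambda^{\dim P-|\sigma|}P)$ and is isomorphic to a full affine space $\mathbb A^m$. (2) Let $\mathbf d=(d_i)_i$ be a dimension vector, let $\mathbf P=\bigoplus_i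 (Ae_i)^{d_i}$ be the projective cover of $\bigoplus_i S_i^{d_i}$ with its distinguished top elements, and let $\mathrm{GRASS}(A,\mathbf d)$ be the set of all submodules $C\subseteq\mathbf P$ such that $\mathbf P/C$ has dimension vector $\mathbf d$. For a skeleton $\sigma$ in $\widehat{\mathbf P}$ with $\underline{\dim}\,\sigma=\mathbf d$ put $\mathrm{GRASS}(\sigma):=\mathrm{Gr}_\sigma(\mathbf P)$. Then $\mathrm{GRASS}(A,\mathbf d)$ is the union of the $\mathrm{GRASS}(\sigma)$ where $\sigma$ runs through the normalized skeleta in $\widehat{\mathbf P}$ with $\underline{\dim}\,\sigma=\mathbf d$, and each of these $\mathrm{GRASS}(\sigma)$ is a locally closed subvariety of $\mathbb P(\Lambda^{\dim\mathbf P-|\sigma|}\mathbf P)$ isomorphic to a full affine space. -/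

import Mathlib

noncomputable section

open scoped LinearAlgebra.Projectivization Topology

/-! ### The path algebra of a quiver -/

/-- A path in the quiver `Q`, together with its starting point and its end point. -/
abbrev QPath (Q : Type*) [Quiver Q] := Σ i : Q, Σ j : Q, Quiver.Path i j

/-- The underlying vector space of the path algebra `KQ`: it has the paths of `Q` as a basis. -/
def PathAlgebra (K : Type*) (Q : Type*) [Field K] [Quiver Q] := QPath Q →₀ K

namespace PathAlgebra

variable {K : Type*} {Q : Type*} [Field K] [Quiver Q]

instance : AddCommGroup (PathAlgebra K Q) := inferInstanceAs (AddCommGroup (QPath Q →₀ K))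

instance : Module K (PathAlgebra K Q) := inferInstanceAs (Module K (QPath Q →₀ K))

/-- The path `p`, viewed as an element of `KQ`. -/
def ofQPath (p : QPath Q) : PathAlgebra K Q := Finsupp.single p 1

variable (K) in
/-- The path `p`, viewed as an element of `KQ`. -/
def ofPath {i j : Q} (p : Quiver.Path i j) : PathAlgebra K Q := ofQPath ⟨i, j, p⟩

open scoped Classical in
/-- The product `p q` of two paths: it is `p` after `q` if `q` ends where `p` starts, and
`0` otherwise. -/
def mulPath (p q : QPath Q) : PathAlgebra K Q :=
  if h : q.2.1 = p.1 then ofQPath ⟨q.1, p.2.1, (h ▸ q.2.2 : Quiver.Path q.1 p.1).comp p.2.2⟩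
  else 0

/-- The bilinear extension of the product of paths. -/
def mulLin : PathAlgebra K Q →ₗ[K] PathAlgebra K Q →ₗ[K] PathAlgebra K Q :=
  Finsupp.linearCombination K fun p => Finsupp.linearCombination K (mulPath p)

instance : Mul (PathAlgebra K Q) := ⟨fun f g => mulLin f g⟩

/-- The unit element of `KQ` is the sum of the paths of length zero. -/
instance [Fintype Q] : One (PathAlgebra K Q) := ⟨∑ i : Q, ofPath K (Quiver.Path.nil : Quiver.Path i i)⟩

theorem mul_eq (f g : PathAlgebra K Q) : f * g = mulLin f g := rfl

theorem one_eq [Fintype Q] :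
    (1 : PathAlgebra K Q) = ∑ i : Q, ofPath K (Quiver.Path.nil : Quiver.Path i i) := rfl

theorem ofQPath_mul_ofQPath (p q : QPath Q) :
    (ofQPath p * ofQPath q : PathAlgebra K Q) = mulPath p q := by
  rw [mul_eq]
  unfold mulLin ofQPath
  erw [Finsupp.linearCombination_single, one_smul, Finsupp.linearCombination_single, one_smul]

theorem ofPath_mul_ofPath {i j k : Q} (p : Quiver.Path j k) (q : Quiver.Path i j) :
    ofPath K p * ofPath K q = ofPath K (q.comp p) := by
  unfold ofPath
  rw [ofQPath_mul_ofQPath]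
  simp [mulPath]

theorem ofPath_mul_ofPath_of_ne {i j j' k : Q} (p : Quiver.Path j k) (q : Quiver.Path i j')
    (h : j' ≠ j) : ofPath K p * ofPath K q = 0 := by
  unfold ofPath
  rw [ofQPath_mul_ofQPath]
  simp [mulPath, h]

theorem induction {C : PathAlgebra K Q → Prop} (f : PathAlgebra K Q) (zero : C 0)
    (add : ∀ f g, C f → C g → C (f + g))
    (smul : ∀ (a : K) (i j : Q) (p : Quiver.Path i j), C (a • ofPath K p)) : C f := by
  refine Finsupp.induction_linear f zero add fun p a => ?_
  have h := smul a p.1 p.2.1 p.2.2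
  unfold ofPath ofQPath at h
  erw [Finsupp.smul_single, smul_eq_mul, mul_one] at h
  exact h

theorem mulLin_assoc (f g h : PathAlgebra K Q) :
    mulLin (mulLin f g) h = mulLin f (mulLin g h) := by
  have key : ∀ {i j i' j' i'' j'' : Q} (p : Quiver.Path i j) (q : Quiver.Path i' j')
      (r : Quiver.Path i'' j''), mulLin (mulLin (ofPath K p) (ofPath K q)) (ofPath K r) =
        mulLin (ofPath K p) (mulLin (ofPath K q) (ofPath K r)) := by
    intro i j i' j' i'' j'' p q r
    simp only [← mul_eq]
    by_cases h1 : j' = i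
    · subst h1
      rw [ofPath_mul_ofPath]
      by_cases h2 : j'' = i'
      · subst h2
        rw [ofPath_mul_ofPath, ofPath_mul_ofPath, ofPath_mul_ofPath, Quiver.Path.comp_assoc]
      · rw [ofPath_mul_ofPath_of_ne _ _ h2, ofPath_mul_ofPath_of_ne _ _ h2, mul_eq, map_zero]
    · rw [ofPath_mul_ofPath_of_ne _ _ h1]
      by_cases h2 : j'' = i'
      · subst h2
        rw [ofPath_mul_ofPath, ofPath_mul_ofPath_of_ne _ _ h1, mul_eq, map_zero,
          LinearMap.zero_apply]
      · rw [ofPath_mul_ofPath_of_ne _ _ h2, mul_eq, mul_eq, map_zero, map_zero,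
          LinearMap.zero_apply]
  induction f using induction with
  | zero => simp only [map_zero, LinearMap.zero_apply]
  | add f f' hf hf' => simp only [map_add, LinearMap.add_apply, hf, hf']
  | smul a i j p =>
    induction g using induction with
    | zero => simp only [map_zero, LinearMap.zero_apply]
    | add g g' hg hg' => simp only [map_add, LinearMap.add_apply, hg, hg']
    | smul b i' j' q =>
      induction h using induction with
      | zero => simp only [map_zero]
      | add h h' hh hh' => simp only [map_add, hh, hh']
      | smul c i'' j'' r => simp only [map_smul, LinearMap.smul_apply, key]

theorem one_mulLin [Fintype Q] (f : PathAlgebra K Q) : mulLin 1 f = f := by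
  induction f using induction with
  | zero => simp only [map_zero]
  | add f f' hf hf' => simp only [map_add, hf, hf']
  | smul a i j p =>
    rw [map_smul, one_eq, map_sum, LinearMap.sum_apply, Finset.sum_eq_single j]
    · rw [← mul_eq, ofPath_mul_ofPath, Quiver.Path.comp_nil]
    · intro k _ hk
      rw [← mul_eq, ofPath_mul_ofPath_of_ne _ _ hk.symm]
    · intro h
      exact absurd (Finset.mem_univ _) h

theorem mulLin_one [Fintype Q] (f : PathAlgebra K Q) : mulLin f 1 = f := by
  induction f using induction with
  | zero => simp only [map_zero, LinearMap.zero_apply]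
  | add f f' hf hf' => simp only [map_add, LinearMap.add_apply, hf, hf']
  | smul a i j p =>
    rw [map_smul, LinearMap.smul_apply, one_eq, map_sum, Finset.sum_eq_single i]
    · rw [← mul_eq, ofPath_mul_ofPath, Quiver.Path.nil_comp]
    · intro k _ hk
      rw [← mul_eq, ofPath_mul_ofPath_of_ne _ _ hk]
    · intro h
      exact absurd (Finset.mem_univ _) h

instance [Fintype Q] : Ring (PathAlgebra K Q) :=
  { (inferInstance : AddCommGroup (PathAlgebra K Q)),
    (inferInstance : Mul (PathAlgebra K Q)),
    (inferInstance : One (PathAlgebra K Q)) with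
    left_distrib := fun f g h => by simp only [mul_eq, map_add]
    right_distrib := fun f g h => by simp only [mul_eq, map_add, LinearMap.add_apply]
    zero_mul := fun f => by simp only [mul_eq, map_zero, LinearMap.zero_apply]
    mul_zero := fun f => by simp only [mul_eq, map_zero]
    mul_assoc := mulLin_assoc
    one_mul := one_mulLin
    mul_one := mulLin_one }

instance [Fintype Q] : Algebra K (PathAlgebra K Q) :=
  Algebra.ofModule
    (fun a f g => by simp only [mul_eq, map_smul, LinearMap.smul_apply])
    (fun a f g => by simp only [mul_eq, map_smul])

/-- An ideal `I` of `KQ` is admissible if every element of `I` is a linear combination of paths of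
length at least `2`, and `I` contains all paths of sufficiently large length. -/
def IsAdmissible [Fintype Q] (I : Ideal (PathAlgebra K Q)) : Prop :=
  (∀ f ∈ I, f ∈ Submodule.span K
    {x : PathAlgebra K Q | ∃ (i j : Q) (p : Quiver.Path i j), 2 ≤ p.length ∧ x = ofPath K p}) ∧
  ∃ N : ℕ, ∀ (i j : Q) (p : Quiver.Path i j), N ≤ p.length → ofPath K p ∈ I

end PathAlgebra

/-! ### Modules over an algebra `A = KQ/I`

Here `A` is a `K`-algebra, presented as a quotient of `KQ` by a homomorphism `π : KQ → A`.
-/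

section Modules

variable {K : Type*} {Q : Type*} {A : Type*} [Field K] [Quiver Q] [Fintype Q] [Ring A] [Algebra K A]
variable (π : PathAlgebra K Q →ₐ[K] A)

/-- The element of `A` given by the path `p`. -/
def pathElt {i j : Q} (p : Quiver.Path i j) : A := π (PathAlgebra.ofPath K p)

/-- The idempotent `e_i` of `A` given by the vertex `i`. -/
def vertexElt (i : Q) : A := pathElt π (Quiver.Path.nil : Quiver.Path i i)

/-- `J^l M`, where `J` is the Jacobson radical of `A`. -/
def radPow (A : Type*) [Ring A] (M : Type*) [AddCommGroup M] [Module A M] (l : ℕ) :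
    Submodule A M := (Ring.jacobson A) ^ l • (⊤ : Submodule A M)

/-- The Loewy length of `M`: the smallest `m` with `J^m M = 0`. -/
def loewyLength (A : Type*) [Ring A] (M : Type*) [AddCommGroup M] [Module A M] : ℕ :=
  sInf {m : ℕ | radPow A M m = ⊥}

variable (M : Type*) [AddCommGroup M] [Module A M] [Module K M] [IsScalarTower K A M]

/-- The subspace `e_i M` of `M`. -/
def vertexPart (i : Q) : Submodule K M :=
  LinearMap.range (Algebra.lsmul K K M (vertexElt π i))

/-- The dimension vector `(dim e_i M)_i` of `M`. -/
def dimVec (i : Q) : ℕ := Module.finrank K (vertexPart π M i)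

/-- The multiplicity of the simple module `S_i` in the radical layer `J^l M / J^(l+1) M`, that is,
`dim e_i (J^l M / J^(l+1) M)`. Here `J^l M / J^(l+1) M` is viewed as a submodule of
`M / J^(l+1) M`. -/
def layerMult (l : ℕ) (i : Q) : ℕ :=
  Module.finrank K
    (((radPow A M l).map (radPow A M (l + 1)).mkQ).restrictScalars K ⊓
      vertexPart π (M ⧸ radPow A M (l + 1)) i : Submodule K (M ⧸ radPow A M (l + 1)))

end Modules

/-! ### Skeleta -/

section Skeleta

variable {K : Type*} {Q : Type*} {A : Type*} [Field K] [Quiver Q] [Fintype Q] [Ring A] [Algebra K A]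
variable {ι : Type*}

/-- The paths `p z_r` in the projective `KQ`-module `⨁_r KQ z_r` in which the top element `z_r` is
normed by the vertex `e r`: such a path is given by the index `r` and a path `p` in `Q` which
starts at `e r`. -/
abbrev PathIn (e : ι → Q) := Σ r : ι, Σ j : Q, Quiver.Path (e r) j

/-- The length of the path `p z_r`. -/
def PathIn.length {e : ι → Q} (b : PathIn e) : ℕ := b.2.2.length

/-- The end point of the path `p z_r`. -/
def PathIn.endpoint {e : ι → Q} (b : PathIn e) : Q := b.2.1

/-- The top element `z_r`, viewed as a path of length zero. -/
def PathIn.top {e : ι → Q} (r : ι) : PathIn e := ⟨r, e r, Quiver.Path.nil⟩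

/-- Abstract skeleta: sets of paths of lengths at most `L`, where `L + 1` is the Loewy length of
`A`, which are closed under initial subpaths. -/
def IsAbstractSkeleton (A : Type*) [Ring A] {e : ι → Q} (σ : Set (PathIn e)) : Prop :=
  (∀ b ∈ σ, b.length < loewyLength A A) ∧
  ∀ (r : ι) (j k : Q) (p₁ : Quiver.Path (e r) j) (p₂ : Quiver.Path j k),
    (⟨r, k, p₁.comp p₂⟩ : PathIn e) ∈ σ → (⟨r, j, p₁⟩ : PathIn e) ∈ σ

/-- The radical layering of a skeleton: the number of paths of length `l` in `σ` ending in `i`. -/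
def skeletonLayer {e : ι → Q} (σ : Set (PathIn e)) (l : ℕ) (i : Q) : ℕ :=
  {b | b ∈ σ ∧ b.length = l ∧ b.endpoint = i}.ncard

/-- The dimension vector of a skeleton. -/
def skeletonDim {e : ι → Q} (σ : Set (PathIn e)) (i : Q) : ℕ :=
  {b | b ∈ σ ∧ b.endpoint = i}.ncard

variable (π : PathAlgebra K Q →ₐ[K] A)

/-- A `KQ`-homomorphism `f` from `⨁_r KQ z_r` to the `A`-module `M` is given by the elements
`y r = f (z_r)`, subject to `e_(e r) y r = y r`, and it sends the path `p z_r` to `p y r`. The set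
`σ` is a skeleton of `M` relative to `f` if `σ` and `M` have the same radical layering, the elements
`f (z_r)`, for `z_r ∈ σ`, form a full sequence of top elements of `M` (that is, they induce a basis
of `M / J M`), and `f` sends `σ` to a `K`-basis of `M` (which makes `f` surjective). -/
structure IsSkeletonRelative {e : ι → Q} (σ : Set (PathIn e)) (M : Type*) [AddCommGroup M]
    [Module A M] [Module K M] [IsScalarTower K A M] (y : ι → M) : Prop where
  isAbstractSkeleton : IsAbstractSkeleton A σ
  layering : ∀ (l : ℕ) (i : Q), layerMult π M l i = skeletonLayer σ l i
  normed : ∀ r, vertexElt π (e r) • y r = y r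
  top_linearIndependent : LinearIndependent K
    fun r : {r : ι // PathIn.top r ∈ σ} => (radPow A M 1).mkQ (y r)
  top_span : Submodule.span K
    (Set.range fun r : {r : ι // PathIn.top r ∈ σ} => (radPow A M 1).mkQ (y r)) = ⊤
  linearIndependent : LinearIndependent K fun b : σ => pathElt π b.1.2.2 • y b.1.1
  span : Submodule.span K (Set.range fun b : σ => pathElt π b.1.2.2 • y b.1.1) = ⊤

/-- `σ` is a skeleton of the `A`-module `M`. -/
def IsSkeletonOf {e : ι → Q} (σ : Set (PathIn e)) (M : Type*) [AddCommGroup M]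
    [Module A M] [Module K M] [IsScalarTower K A M] : Prop :=
  ∃ y : ι → M, IsSkeletonRelative π σ M y

/-- The tree of `σ` with root `z_r`: the set of all paths `p z_r` in `σ`, viewed as a set of paths
in the `KQ`-module with the single top element `z_r`. -/
def tree {e : ι → Q} (σ : Set (PathIn e)) (r : ι) : Set (PathIn fun _ : Unit => e r) :=
  {b | (⟨r, b.2⟩ : PathIn e) ∈ σ}

/-- Normalized skeleta: each tree of `σ` either has edge paths of lengths at most `1` only, or is a
skeleton of the indecomposable projective module `A e_(e r)`, where `A e_(e r)` has Loewy
length `3`. -/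
def IsNormalizedSkeleton {e : ι → Q} (σ : Set (PathIn e)) : Prop :=
  IsAbstractSkeleton A σ ∧
  ∀ r : ι, (∀ b ∈ tree σ r, b.length ≤ 1) ∨
    (loewyLength A (Ideal.span {vertexElt π (e r)}) = 3 ∧
      IsSkeletonOf π (tree σ r) (Ideal.span {vertexElt π (e r)}))

end Skeleta

/-! ### The sets of submodules -/

section Grass

variable {K : Type*} {Q : Type*} {A : Type*} [Field K] [Quiver Q] [Fintype Q] [Ring A] [Algebra K A]
variable {ι : Type*}
variable (π : PathAlgebra K Q →ₐ[K] A)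

/-- The projective `A`-module `P = ⨁_r A e_(e r)`, for a finite index set. -/
abbrev Proj (e : ι → Q) := ∀ r : ι, Ideal.span {vertexElt π (e r)}

open scoped Classical in
/-- The distinguished top element `z_r` of `P`. -/
def topElt (e : ι → Q) (r : ι) : Proj π e :=
  Pi.single r ⟨vertexElt π (e r), Ideal.subset_span rfl⟩

/-- The submodules `C` of `P` such that `P / C` has the radical layering of `σ` and `σ` is a
distinguished skeleton of `P / C`, that is, a skeleton relative to the canonical map
`z_r ↦ z_r + C`. -/
def GrassSkeleton {e : ι → Q} (σ : Set (PathIn e)) : Set (Submodule A (Proj π e)) :=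
  {C | IsSkeletonRelative π σ (Proj π e ⧸ C) fun r => C.mkQ (topElt π e r)}

/-- The vertices norming the distinguished top elements of the projective cover of
`⨁_i S_i^(d i)`. -/
abbrev bigTop (d : Q → ℕ) : (Σ i : Q, Fin (d i)) → Q := Sigma.fst

/-- The submodules `C` of the projective cover of `⨁_i S_i^(d i)` such that the quotient by `C` has
dimension vector `d`. -/
def GRASS (d : Q → ℕ) : Set (Submodule A (Proj π (bigTop d))) :=
  {C | ∀ i, dimVec π (Proj π (bigTop d) ⧸ C) i = d i}

end Grass

/-! ### Subvarieties of projective spaces, and affine spaces -/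

section Varieties

variable (K : Type*) [Field K]

/-- The value at `w` of a polynomial in the linear forms on `W`. -/
def evalForms {K : Type*} [Field K] {W : Type*} [AddCommGroup W] [Module K W]
    (F : MvPolynomial (Module.Dual K W) K) (w : W) : K :=
  MvPolynomial.eval (fun φ => φ w) F

/-- The Zariski topology on the projective space of lines in `W`: a basis is given by the sets
where a homogeneous polynomial does not vanish. -/
abbrev zariskiProj (W : Type*) [AddCommGroup W] [Module K W] : TopologicalSpace (ℙ K W) :=
  TopologicalSpace.generateFrom
    {U | ∃ (n : ℕ) (F : MvPolynomial (Module.Dual K W) K), F.IsHomogeneous n ∧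
      U = {x : ℙ K W | evalForms F x.rep ≠ 0}}

/-- The Zariski topology on the affine space `K^m`. -/
abbrev zariskiAffine (m : ℕ) : TopologicalSpace (Fin m → K) :=
  TopologicalSpace.generateFrom
    {U | ∃ g : MvPolynomial (Fin m) K, U = {x : Fin m → K | MvPolynomial.eval x g ≠ 0}}

variable {K}

/-- The Zariski topology on a subset of a projective space. -/
abbrev zariskiSub {W : Type*} [AddCommGroup W] [Module K W] (X : Set (ℙ K W)) :
    TopologicalSpace X := (zariskiProj K W).induced Subtype.val

/-- The function `f` is regular on the open subset `U` of `X`: locally, it is a quotient of two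
homogeneous polynomials of the same degree. -/
def IsRegularProj {W : Type*} [AddCommGroup W] [Module K W] (X : Set (ℙ K W)) (U : Set X)
    (f : X → K) : Prop :=
  ∀ x ∈ U, ∃ V : Set X, IsOpen[zariskiSub X] V ∧ x ∈ V ∧ V ⊆ U ∧
    ∃ (n : ℕ) (F G : MvPolynomial (Module.Dual K W) K),
      F.IsHomogeneous n ∧ G.IsHomogeneous n ∧
      ∀ y ∈ V, evalForms G y.1.rep ≠ 0 ∧ f y = evalForms F y.1.rep / evalForms G y.1.rep

/-- The function `f` is regular on the open subset `U` of `K^m`: locally, it is a quotient of two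
polynomials. -/
def IsRegularAffine {m : ℕ} (U : Set (Fin m → K)) (f : (Fin m → K) → K) : Prop :=
  ∀ x ∈ U, ∃ V : Set (Fin m → K), IsOpen[zariskiAffine K m] V ∧ x ∈ V ∧ V ⊆ U ∧
    ∃ F G : MvPolynomial (Fin m) K,
      ∀ y ∈ V, MvPolynomial.eval y G ≠ 0 ∧ f y = MvPolynomial.eval y F / MvPolynomial.eval y G

/-- `X` is a (locally closed) subvariety of the projective space which is isomorphic, as a variety,
to an affine space: there is a homeomorphism between `X` and some `K^m` which identifies
the regular functions on corresponding open sets. -/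
def IsFullAffineSpace {W : Type*} [AddCommGroup W] [Module K W] (X : Set (ℙ K W)) : Prop :=
  (∃ U Z : Set (ℙ K W), IsOpen[zariskiProj K W] U ∧
    IsClosed[zariskiProj K W] Z ∧ X = U ∩ Z) ∧
  ∃ (m : ℕ) (φ : X ≃ (Fin m → K)),
    (∀ U : Set (Fin m → K), IsOpen[zariskiAffine K m] U ↔ IsOpen[zariskiSub X] (φ ⁻¹' U)) ∧
    ∀ U : Set (Fin m → K), IsOpen[zariskiAffine K m] U → ∀ f : (Fin m → K) → K,
      IsRegularAffine U f ↔ IsRegularProj X (φ ⁻¹' U) (f ∘ φ)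

/-- The image of a set of `a`-dimensional subspaces of `V` under the Plücker embedding of the
Grassmannian `Gr(a, V)` into the projective space of `⋀^a V`, which sends a subspace with
basis `c_1, …, c_a` to the line spanned by `c_1 ∧ ⋯ ∧ c_a`. -/
def pluecker {V : Type*} [AddCommGroup V] [Module K V] (a : ℕ) (X : Set (Submodule K V)) :
    Set (ℙ K (⋀[K]^a V)) :=
  {x | ∃ C ∈ X, ∃ c : Fin a → V, LinearIndependent K c ∧ Submodule.span K (Set.range c) = C ∧
    x.submodule = Submodule.span K {exteriorPower.ιMulti K a c}}

end Varieties

/-- For a skeleton `σ` in `P̂`, the subset of the projective space of `⋀^(dim P - |σ|) P` formed by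
the submodules `C` of `P` for which `σ` is a distinguished skeleton of `P / C`. -/
def grassVariety {K : Type*} {Q : Type*} {A : Type*} [Field K] [Quiver Q] [Fintype Q] [Ring A]
    [Algebra K A] {ι : Type*} (π : PathAlgebra K Q →ₐ[K] A) {e : ι → Q} (σ : Set (PathIn e)) :
    Set (ℙ K (⋀[K]^(Module.finrank K (Proj π e) - σ.ncard) (Proj π e))) :=
  pluecker (Module.finrank K (Proj π e) - σ.ncard)
    {C | ∃ C' ∈ GrassSkeleton π σ, C = C'.restrictScalars K}

end

/-! Write J for the radical, so that J^l is spanned by the paths of length at least l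
(`mem_jacobson_pow_iff`). Self-injectivity enters only through `exists_forall_mul_eq`:
endpoint-preserving linear maps between parts of the left socle are right multiplications. As J^3 =
0, a right multiplication acts on J^2 e_v by a scalar. Hence J^2 e_v is at most one-dimensional
(`exists_eq_smul_of_mem_pathSpan_two`), different vertices have second layers with different
endpoints (`start_eq_of_pathElt_ne_zero`), and if J^2 e_v ≠ 0, the elements of J e_v annihilated by
J lie in J^2 (`mem_pathSpan_two_of_pathSpan_one_mul_eq_zero`).

So P has a basis formed by all paths of length at most 1 and one nonzero path of length 2 in each
tree whose root has Loewy length 3 (`stdBasis`). A normalized skeleton is part of such a basis, and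
each of its trees that reaches length 2 ("long tree") is full
(`IsNormalizedSkeleton.exists_stdSkeleton`). The decisive lemma is
`eq_zero_of_pathSpan_one_smul_sum`: if the length-2 paths of certain trees stay independent in M,
then the arrows of these trees are independent modulo the elements annihilated by J, in particular
modulo J^2 M. This gives the covering in (2): choose tops forming a basis of M/JM, then length-2
paths forming a basis of J^2 M; the arrows of their trees are independent in JM/J^2 M, and may be
completed to a basis there by further arrows (`exists_isNormalizedSkeleton_isSkeletonRelative`).

For the affine charts, a submodule C with distinguished skeleton s is the kernel of a projection of
P onto the span of s, whose matrix records how the basis paths outside s expand modulo C. Not every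
matrix occurs, since C must be closed under A. If a short tree with root z_r in s has a length-2
path in P, its expansion uses only length-2 paths of long trees with the same root vertex, so
subtracting multiples of the tops of those trees from z_r makes J^2 z_r vanish in P/C. After this
shear, multiplying the expansion of a missing arrow by J shows, by the decisive lemma, that no arrow
of a long tree occurs in it; and then there is no further condition. Thus the coefficients in
`IsFreePosition` can be prescribed arbitrarily: `chartMap` conjugates the unconstrained `arrowMap`
by the shear, after `topMap` has substituted the missing tops. Its kernels are exactly the
submodules sought (`exists_mem_grassSkeleton_chartMap`, `exists_ker_chartMap_eq`), and the
parameters reappear as matrix entries (`repr_chartMap`).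

Finally, a family of projections onto a fixed coordinate subspace, polynomial in parameters that
occur among the matrix entries, has kernels whose Plücker image is an affine space
(`isFullAffineSpace_pluecker_ker`): the parameters are quotients of Plücker coordinates, and all
Plücker coordinates are polynomials in them (`isFullAffineSpace_of_chart`). -/

open scoped LinearAlgebra.Projectivization Topology

/-! ### Polynomial maps and homogenization with respect to linear forms. -/

section PolynomialMaps

variable {K : Type*} [Field K] {τ : Type*}

/-- The algebra of polynomial functions on `K^τ`. -/
noncomputable def polyFun (K τ : Type*) [Field K] : Subalgebra K ((τ → K) → K) :=
  (MvPolynomial.aeval fun (i : τ) (t : τ → K) => t i : MvPolynomial τ K →ₐ[K] (τ → K) → K).range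

theorem mem_polyFun {f : (τ → K) → K} :
    f ∈ polyFun K τ ↔ ∃ g : MvPolynomial τ K, ∀ t, f t = MvPolynomial.eval t g := by
  have h : ∀ (g : MvPolynomial τ K) (t : τ → K),
      MvPolynomial.aeval (fun (i : τ) (t : τ → K) => t i) g t = MvPolynomial.eval t g := by
    intro g t
    induction g using MvPolynomial.induction_on with
    | C a => simp
    | add p q hp hq => simp [hp, hq]
    | mul_X p i hp => simp [hp]
  constructor
  · rintro ⟨g, rfl⟩
    exact ⟨g, fun t => h g t⟩
  · rintro ⟨g, hg⟩
    exact ⟨g, funext fun t => by rw [hg, ← h]; rfl⟩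

theorem coord_mem_polyFun (i : τ) : (fun t : τ → K => t i) ∈ polyFun K τ :=
  mem_polyFun.2 ⟨MvPolynomial.X i, fun t => by simp⟩

theorem const_mem_polyFun (a : K) : (fun _ : τ → K => a) ∈ polyFun K τ :=
  mem_polyFun.2 ⟨MvPolynomial.C a, fun t => by simp⟩

theorem mul_mem_polyFun {f g : (τ → K) → K} (hf : f ∈ polyFun K τ) (hg : g ∈ polyFun K τ) :
    (fun t => f t * g t) ∈ polyFun K τ := mul_mem hf hg

theorem sum_mem_polyFun {ι : Type*} (s : Finset ι) {f : ι → (τ → K) → K}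
    (hf : ∀ i ∈ s, f i ∈ polyFun K τ) : (fun t => ∑ i ∈ s, f i t) ∈ polyFun K τ := by
  have := sum_mem hf
  convert this using 1
  ext t; simp

theorem prod_mem_polyFun {ι : Type*} (s : Finset ι) {f : ι → (τ → K) → K}
    (hf : ∀ i ∈ s, f i ∈ polyFun K τ) : (fun t => ∏ i ∈ s, f i t) ∈ polyFun K τ := by
  have := prod_mem hf
  convert this using 1
  ext t; simp

variable {W : Type*} [AddCommGroup W] [Module K W]

/-- A map into a vector space is polynomial if all its composites with linear forms are. -/
def IsPolyMap (f : (τ → K) → W) : Prop :=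
  ∀ φ : Module.Dual K W, (fun t => φ (f t)) ∈ polyFun K τ

theorem IsPolyMap.eval_mem {f : (τ → K) → W} (hf : IsPolyMap f)
    (F : MvPolynomial (Module.Dual K W) K) : (fun t => evalForms F (f t)) ∈ polyFun K τ := by
  unfold evalForms
  induction F using MvPolynomial.induction_on with
  | C a => simpa using const_mem_polyFun a
  | add p q hp hq => simpa using! (add_mem hp hq)
  | mul_X p i hp => simpa using mul_mem_polyFun hp (hf i)

/-- Needed because `x.rep` is an arbitrary representative of a projective point, to be compared with
a preferred one. -/
theorem evalForms_smul {F : MvPolynomial (Module.Dual K W) K} {n : ℕ} (hF : F.IsHomogeneous n)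
    (c : K) (w : W) : evalForms F (c • w) = c ^ n * evalForms F w := by
  unfold evalForms
  rw [MvPolynomial.eval_eq, MvPolynomial.eval_eq, Finset.mul_sum]
  refine Finset.sum_congr rfl fun d hd => ?_
  have hdeg : ∑ i ∈ d.support, d i = n := (hF.degree_eq_sum_deg_support hd).symm
  simp only [map_smul, smul_eq_mul, mul_pow, Finset.prod_mul_distrib, Finset.prod_pow_eq_pow_sum,
    hdeg]
  ring

variable [Fintype τ]

/-- Homogenization of a polynomial `g` with respect to linear forms `lam` and `mu i`. -/
noncomputable def homogenizeForms (lam : Module.Dual K W) (mu : τ → Module.Dual K W) (N : ℕ)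
    (g : MvPolynomial τ K) : MvPolynomial (Module.Dual K W) K :=
  ∑ d ∈ g.support, MvPolynomial.C (g.coeff d) *
    (MvPolynomial.X lam ^ (N - d.sum fun _ n => n) * ∏ i, MvPolynomial.X (mu i) ^ d i)

theorem homogenizeForms_isHomogeneous (lam : Module.Dual K W) (mu : τ → Module.Dual K W) {N : ℕ}
    {g : MvPolynomial τ K} (hg : g.totalDegree ≤ N) :
    (homogenizeForms lam mu N g).IsHomogeneous N := by
  refine MvPolynomial.IsHomogeneous.sum _ _ _ fun d hd => ?_
  refine MvPolynomial.IsHomogeneous.C_mul ?_ _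
  have hd' : (d.sum fun _ n => n) ≤ N := (MvPolynomial.le_totalDegree hd).trans hg
  have h1 := MvPolynomial.isHomogeneous_X_pow (R := K) lam (N - d.sum fun _ n => n)
  have h2 := MvPolynomial.IsHomogeneous.prod (R := K) Finset.univ
    (fun i => MvPolynomial.X (mu i) ^ d i) (fun i => d i)
    (fun i _ => MvPolynomial.isHomogeneous_X_pow (mu i) (d i))
  have h3 := h1.mul h2
  have h4 : ∑ i, d i = d.sum fun _ n => n := by
    rw [Finsupp.sum_fintype]; simp
  rw [h4, Nat.sub_add_cancel hd'] at h3
  exact h3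

/-- Each monomial is padded with powers of `lam` up to degree `N`; factoring out `lam w ^ N` leaves
the ratios. -/
theorem evalForms_homogenizeForms {lam : Module.Dual K W} {mu : τ → Module.Dual K W} {N : ℕ}
    {g : MvPolynomial τ K} (hg : g.totalDegree ≤ N) {w : W} (hw : lam w ≠ 0) :
    evalForms (homogenizeForms lam mu N g) w =
      lam w ^ N * MvPolynomial.eval (fun i => mu i w / lam w) g := by
  unfold evalForms homogenizeForms
  rw [MvPolynomial.eval_eq' (fun i => mu i w / lam w), Finset.mul_sum, map_sum]
  refine Finset.sum_congr rfl fun d hd => ?_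
  have hd' : (d.sum fun _ n => n) ≤ N := (MvPolynomial.le_totalDegree hd).trans hg
  have h4 : ∑ i, d i = d.sum fun _ n => n := by
    rw [Finsupp.sum_fintype]; simp
  simp only [map_mul, map_pow, MvPolynomial.eval_C, MvPolynomial.eval_X, map_prod, div_pow,
    Finset.prod_div_distrib, Finset.prod_pow_eq_pow_sum, h4]
  have h5 : lam w ^ N = lam w ^ (N - d.sum fun _ n => n) * lam w ^ (d.sum fun _ n => n) := by
    rw [← pow_add, Nat.sub_add_cancel hd']
  rw [h5]
  field_simp

end PolynomialMaps

/-! ### A criterion for a subset of projective space to be an affine space. -/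

section Chart

variable {K : Type*} [Field K] {W : Type*} [AddCommGroup W] [Module K W]

theorem isOpen_zariskiProj_ne {F : MvPolynomial (Module.Dual K W) K} {n : ℕ}
    (hF : F.IsHomogeneous n) :
    IsOpen[zariskiProj K W] {x : ℙ K W | evalForms F x.rep ≠ 0} :=
  TopologicalSpace.isOpen_generateFrom_of_mem ⟨n, F, hF, rfl⟩

/-- All of `X` lies where `lam ≠ 0`, and there the ratios `mu i / lam` invert the chart. Closed
conditions in that open set say that a point is the chart point of its own ratios. Open sets and
regular functions are transferred by homogenizing with `lam` and `mu` in one direction and by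
substituting `ψ` in the other. -/
theorem isFullAffineSpace_of_chart {m : ℕ} {X : Set (ℙ K W)} {ψ : (Fin m → K) → W}
    (hψ : IsPolyMap ψ) (lam : Module.Dual K W) (mu : Fin m → Module.Dual K W)
    (hlam : ∀ t, lam (ψ t) = 1) (hmu : ∀ t i, mu i (ψ t) = t i)
    (hX : ∀ x, x ∈ X ↔ ∃ t, x.submodule = Submodule.span K {ψ t}) : IsFullAffineSpace X := by
  have hne : ∀ t, ψ t ≠ 0 := fun t h => by simpa [h] using hlam t
  set pt : (Fin m → K) → ℙ K W := fun t => Projectivization.mk K (ψ t) (hne t) with hpt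
  -- The candidate inverse of the chart, defined on the whole projective space with the junk value 0
  -- where `lam` vanishes.
  set co : ℙ K W → Fin m → K := fun x i => mu i x.rep / lam x.rep with hco
  have hsub : ∀ t, (pt t).submodule = Submodule.span K {ψ t} := fun t =>
    Projectivization.submodule_mk _ _
  have hptX : ∀ t, pt t ∈ X := fun t => (hX _).2 ⟨t, hsub t⟩
  have hpts : ∀ x ∈ X, ∃ t, x = pt t := fun x hx => by
    obtain ⟨t, ht⟩ := (hX x).1 hx
    exact ⟨t, Projectivization.submodule_injective (ht.trans (hsub t).symm)⟩
  have hrep : ∀ t, lam (pt t).rep ≠ 0 ∧ (pt t).rep = lam (pt t).rep • ψ t := by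
    intro t
    have h1 : (pt t).rep ∈ (pt t).submodule := by
      rw [Projectivization.submodule_eq]; exact Submodule.mem_span_singleton_self _
    rw [hsub, Submodule.mem_span_singleton] at h1
    obtain ⟨c, hc⟩ := h1
    have hl : lam (pt t).rep = c := by rw [← hc]; simp [hlam]
    rw [hl]
    refine ⟨fun h => (pt t).rep_nonzero ?_, hc.symm⟩
    rw [← hc, h, zero_smul]
  have hcopt : ∀ t, co (pt t) = t := by
    intro t
    obtain ⟨h1, h2⟩ := hrep t
    funext i
    rw [hco]
    simp only
    rw [div_eq_iff h1]
    conv_lhs => rw [h2]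
    rw [map_smul, hmu, smul_eq_mul, mul_comm]
  have hev : ∀ {n : ℕ} {F : MvPolynomial (Module.Dual K W) K}, F.IsHomogeneous n → ∀ t,
      evalForms F (pt t).rep = lam (pt t).rep ^ n * evalForms F (ψ t) := by
    intro n F hF t
    conv_lhs => rw [(hrep t).2]
    exact evalForms_smul hF _ _
  have hevh : ∀ {N : ℕ} {g : MvPolynomial (Fin m) K}, g.totalDegree ≤ N → ∀ t,
      evalForms (homogenizeForms lam mu N g) (pt t).rep =
        lam (pt t).rep ^ N * MvPolynomial.eval t g := by
    intro N g hg t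
    rw [evalForms_homogenizeForms hg (hrep t).1]
    exact congrArg (fun s => lam (pt t).rep ^ N * MvPolynomial.eval s g) (hcopt t)
  constructor
  · have hg : ∀ φ : Module.Dual K W, ∃ g : MvPolynomial (Fin m) K,
        ∀ t, φ (ψ t) = MvPolynomial.eval t g := fun φ => mem_polyFun.1 (hψ φ)
    choose g hg using hg
    let N : Module.Dual K W → ℕ := fun φ => (g φ).totalDegree
    -- The homogenized equation `φ w = lam w * φ (ψ (co w))`; both terms are brought to degree `N φ
    -- + 1`.
    let F : Module.Dual K W → MvPolynomial (Module.Dual K W) K := fun φ =>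
      MvPolynomial.X lam ^ N φ * MvPolynomial.X φ -
        MvPolynomial.X lam * homogenizeForms lam mu (N φ) (g φ)
    have hF : ∀ φ, (F φ).IsHomogeneous (N φ + 1) := fun φ =>
      ((MvPolynomial.isHomogeneous_X_pow lam (N φ)).mul (MvPolynomial.isHomogeneous_X K φ)).sub
        (add_comm (N φ) 1 ▸ (MvPolynomial.isHomogeneous_X K lam).mul
          (homogenizeForms_isHomogeneous lam mu le_rfl))
    refine ⟨{x | evalForms (MvPolynomial.X lam) x.rep ≠ 0},
      ⋂ φ, {x | evalForms (F φ) x.rep ≠ 0}ᶜ,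
      isOpen_zariskiProj_ne (MvPolynomial.isHomogeneous_X K lam), ?_, ?_⟩
    · refine @isClosed_iInter _ _ (zariskiProj K W) _ fun φ => ?_
      exact (@isClosed_compl_iff _ (zariskiProj K W) _).2 (isOpen_zariskiProj_ne (hF φ))
    · ext x
      simp only [Set.mem_inter_iff, Set.mem_ofPred_eq, Set.mem_iInter, Set.mem_compl_iff, not_not]
      have hXl : evalForms (MvPolynomial.X lam) x.rep = lam x.rep := by simp [evalForms]
      have hFx : lam x.rep ≠ 0 → ∀ φ, evalForms (F φ) x.rep =
          lam x.rep ^ N φ * (φ x.rep - lam x.rep * φ (ψ (co x))) := by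
        intro h0 φ
        have h1 := evalForms_homogenizeForms (lam := lam) (mu := mu) (le_refl (N φ)) h0
        have h2 : evalForms (F φ) x.rep = lam x.rep ^ N φ * φ x.rep - lam x.rep *
            evalForms (homogenizeForms lam mu (N φ) (g φ)) x.rep := by
          simp [F, evalForms]
        rw [h2, h1, hg]
        ring
      rw [hXl]
      constructor
      · intro hx
        obtain ⟨t, rfl⟩ := hpts x hx
        refine ⟨(hrep t).1, fun φ => ?_⟩
        rw [hFx (hrep t).1, hcopt]
        conv_lhs => rw [(hrep t).2]
        simp [hlam]
      · rintro ⟨h0, hx⟩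
        -- Linear forms separate vectors, so the equations for all `φ` together place the point on
        -- the line of `ψ (co x)`.
        have h1 : x.rep = lam x.rep • ψ (co x) := by
          rw [← sub_eq_zero, ← Module.forall_dual_apply_eq_zero_iff K]
          intro φ
          have := hx φ
          rw [hFx h0] at this
          simpa [h0] using this
        refine (hX x).2 ⟨co x, ?_⟩
        rw [Projectivization.submodule_eq]
        conv_lhs => rw [h1]
        exact Submodule.span_singleton_smul_eq (IsUnit.mk0 _ h0) _
  · let φ : X ≃ (Fin m → K) :=
      { toFun := fun x => co x.1
        invFun := fun t => ⟨pt t, hptX t⟩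
        left_inv := fun x => by
          obtain ⟨t, ht⟩ := hpts x.1 x.2
          apply Subtype.ext
          simp only [ht, hcopt]
        right_inv := hcopt }
    have hφ : ∀ y : X, pt (φ y) = y.1 := fun y => congrArg Subtype.val (φ.left_inv y)
    have hcont : ∀ U : Set (Fin m → K), IsOpen[zariskiAffine K m] U →
        IsOpen[zariskiSub X] (φ ⁻¹' U) := by
      have : @Continuous _ _ (zariskiSub X) (zariskiAffine K m) φ := by
        refine (@continuous_generateFrom_iff _ _ _ (zariskiSub X) _).2 ?_
        rintro _ ⟨g, rfl⟩
        refine (@isOpen_induced_iff _ _ (zariskiProj K W) _ _).2 ⟨_, isOpen_zariskiProj_ne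
          (homogenizeForms_isHomogeneous lam mu (le_refl g.totalDegree)), ?_⟩
        ext y
        simp only [Set.mem_preimage, Set.mem_ofPred_eq]
        rw [← hφ y, hevh le_rfl]
        simp [(hrep _).1]
      intro U hU
      exact @Continuous.isOpen_preimage _ _ (zariskiSub X) (zariskiAffine K m) _ this U hU
    have hcont' : ∀ V : Set X, IsOpen[zariskiSub X] V →
        IsOpen[zariskiAffine K m] (φ.symm ⁻¹' V) := by
      have : @Continuous _ _ (zariskiAffine K m) (zariskiProj K W) pt := by
        refine (@continuous_generateFrom_iff _ _ _ (zariskiAffine K m) _).2 ?_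
        rintro _ ⟨n, F, hF, rfl⟩
        obtain ⟨g, hg⟩ := mem_polyFun.1 (hψ.eval_mem F)
        refine TopologicalSpace.isOpen_generateFrom_of_mem ⟨g, ?_⟩
        ext t
        simp only [Set.mem_preimage, Set.mem_ofPred_eq]
        rw [hev hF, ← hg]
        simp [(hrep _).1]
      intro V hV
      obtain ⟨O, hO, rfl⟩ := (@isOpen_induced_iff _ _ (zariskiProj K W) _ _).1 hV
      exact @Continuous.isOpen_preimage _ _ (zariskiAffine K m) (zariskiProj K W) _ this O hO
    refine ⟨m, φ, fun U => ⟨hcont U, fun h => ?_⟩, fun U _ f => ⟨fun h x hx => ?_, fun h t ht => ?_⟩⟩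
    · have := hcont' _ h
      rwa [← Set.preimage_comp, Equiv.self_comp_symm, Set.preimage_id] at this
    · obtain ⟨V, hV, hxV, hVU, F, G, hFG⟩ := h (φ x) hx
      -- Numerator and denominator are homogenized to a common degree, so that the powers of `lam`
      -- cancel in the quotient.
      refine ⟨φ ⁻¹' V, hcont V hV, hxV, Set.preimage_mono hVU, max F.totalDegree G.totalDegree,
        _, _, homogenizeForms_isHomogeneous lam mu (le_max_left _ _),
        homogenizeForms_isHomogeneous lam mu (le_max_right _ _), fun y hy => ?_⟩
      obtain ⟨h1, h2⟩ := hFG (φ y) hy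
      have hl := pow_ne_zero (max F.totalDegree G.totalDegree) (hrep (φ y)).1
      rw [← hφ y, hevh (le_max_left _ _), hevh (le_max_right _ _)]
      refine ⟨mul_ne_zero hl h1, ?_⟩
      rw [mul_div_mul_left _ _ hl, ← h2]
      rfl
    · obtain ⟨V, hV, hxV, hVU, n, F, G, hF, hG, hFG⟩ := h (φ.symm t) (by simpa using ht)
      obtain ⟨f', hf'⟩ := mem_polyFun.1 (hψ.eval_mem F)
      obtain ⟨g', hg'⟩ := mem_polyFun.1 (hψ.eval_mem G)
      refine ⟨φ.symm ⁻¹' V, hcont' V hV, hxV, fun s hs => by simpa using hVU hs, f', g',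
        fun s hs => ?_⟩
      obtain ⟨h1, h2⟩ := hFG (φ.symm s) hs
      have h3 : (φ.symm s).1 = pt s := rfl
      have hl := pow_ne_zero n (hrep s).1
      rw [h3, hev hG] at h1
      rw [h3, hev hG, hev hF, mul_div_mul_left _ _ hl] at h2
      rw [← hf', ← hg']
      exact ⟨right_ne_zero_of_mul h1, by simpa using h2⟩

end Chart

/-! ### Plücker coordinates of kernels of projections onto a coordinate subspace. -/

section Graphs

variable {K : Type*} [Field K] {V : Type*} [AddCommGroup V] [Module K V]

/-- After multilinear expansion, repeated indices contribute zero and the other index maps are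
permutations. Used in both directions, it shows that the Plücker line does not depend on the basis
of the subspace. -/
theorem AlternatingMap.map_mem_span_of_span_le {W : Type*} [AddCommGroup W] [Module K W] {a : ℕ}
    (f : V [⋀^Fin a]→ₗ[K] W) {c c' : Fin a → V}
    (h : Submodule.span K (Set.range c') ≤ Submodule.span K (Set.range c)) :
    f c' ∈ Submodule.span K {f c} := by
  have h1 : ∀ i, ∃ A : Fin a → K, ∑ j, A j • c j = c' i := fun i =>
    (Submodule.mem_span_range_iff_exists_fun K).1 (h (Submodule.subset_span ⟨i, rfl⟩))
  choose A hA using h1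
  have h2 : c' = fun i => ∑ j, A i j • c j := funext fun i => (hA i).symm
  rw [h2, ← AlternatingMap.coe_multilinearMap, MultilinearMap.map_sum]
  refine Submodule.sum_mem _ fun r _ => ?_
  rw [MultilinearMap.map_smul_univ]
  refine Submodule.smul_mem _ _ ?_
  rw [AlternatingMap.coe_multilinearMap]
  by_cases hr : Function.Injective r
  · have hb : Function.Bijective r := (Finite.injective_iff_bijective).1 hr
    have := f.map_perm c (Equiv.ofBijective r hb)
    have h3 : (fun i => c (r i)) = c ∘ (Equiv.ofBijective r hb) := rfl
    rw [h3, this]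
    exact Submodule.smul_of_tower_mem _ _ (Submodule.mem_span_singleton_self _)
  · rw [Function.Injective] at hr
    push Not at hr
    obtain ⟨i, j, hij, hne⟩ := hr
    rw [f.map_eq_zero_of_eq (fun i => c (r i)) (congrArg c hij) hne]
    exact Submodule.zero_mem _

theorem IsPolyMap.multilinear {τ β : Type*} [Fintype β] (B : Module.Basis β K V) {a : ℕ}
    (f : MultilinearMap K (fun _ : Fin a => V) K) {c : (τ → K) → Fin a → V}
    (hc : ∀ i, IsPolyMap fun t => c t i) : (fun t => f (c t)) ∈ polyFun K τ := by
  have h : ∀ t, f (c t) = ∑ r : Fin a → β, (∏ i, B.coord (r i) (c t i)) * f fun i => B (r i) := by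
    intro t
    have h2 : c t = fun i => ∑ j, B.coord j (c t i) • B j := by
      funext i
      exact (B.sum_repr (c t i)).symm
    conv_lhs => rw [h2, MultilinearMap.map_sum]
    refine Finset.sum_congr rfl fun r _ => ?_
    rw [MultilinearMap.map_smul_univ, smul_eq_mul]
  simp only [h]
  exact sum_mem_polyFun _ fun r _ => mul_mem_polyFun (prod_mem_polyFun _ fun i _ => hc i _)
    (const_mem_polyFun _)

/-- A family of subspaces which are the kernels of projections onto a fixed coordinate subspace,
where the projections depend polynomially on parameters that occur among their matrix entries. -/
theorem isFullAffineSpace_pluecker_ker {β : Type*} [Fintype β] (B : Module.Basis β K V)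
    (S : Set β) {a : ℕ} (ha : Sᶜ.ncard = a) {m : ℕ} (Φ : (Fin m → K) → V →ₗ[K] V)
    (hS : ∀ t, ∀ b ∈ S, Φ t (B b) = B b) (hr : ∀ t v, Φ t v ∈ Submodule.span K (B '' S))
    (hpoly : ∀ v, IsPolyMap fun t => Φ t v) (pos : Fin m → β × β) (hp1 : ∀ i, (pos i).1 ∉ S)
    (hp2 : ∀ i, (pos i).2 ∈ S) (hpos : ∀ t i, B.repr (Φ t (B (pos i).1)) (pos i).2 = t i) :
    IsFullAffineSpace (pluecker a {C : Submodule K V | ∃ t, C = LinearMap.ker (Φ t)}) := by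
  classical
  subst ha
  set a := Sᶜ.ncard
  let k : Fin a ≃ ↥(Sᶜ) := (Finite.equivFinOfCardEq (Nat.card_coe_set_eq _)).symm
  -- This is a basis of the kernel whose coordinates outside `S` form the identity matrix.
  let c : (Fin m → K) → Fin a → V := fun t j => B (k j).1 - Φ t (B (k j).1)
  have hcoord : ∀ t v, ∀ b ∉ S, B.coord b (Φ t v) = 0 := by
    intro t v b hb
    have := hr t v
    generalize Φ t v = w at this
    induction this using Submodule.span_induction with
    | mem x hx =>
      obtain ⟨b', hb', rfl⟩ := hx
      have : b' ≠ b := fun h => hb (h ▸ hb')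
      simp [Finsupp.single_eq_of_ne this.symm]
    | zero => simp
    | add x y _ _ hx hy => rw [map_add, hx, hy, add_zero]
    | smul a x _ hx => rw [map_smul, hx, smul_zero]
  have hid : ∀ t, ∀ v ∈ Submodule.span K (B '' S), Φ t v = v := by
    intro t v hv
    induction hv using Submodule.span_induction with
    | mem x hx =>
      obtain ⟨b', hb', rfl⟩ := hx
      exact hS t b' hb'
    | zero => simp
    | add x y _ _ hx hy => rw [map_add, hx, hy]
    | smul a x _ hx => rw [map_smul, hx]
  have hck : ∀ t i j, B.coord (k i).1 (c t j) = if i = j then 1 else 0 := by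
    intro t i j
    simp only [c, map_sub, hcoord t _ _ (k i).2, sub_zero, Module.Basis.coord_apply,
      Module.Basis.repr_self, Finsupp.single_apply]
    have : (k j).1 = (k i).1 ↔ i = j := by
      rw [Subtype.val_inj, k.apply_eq_iff_eq, eq_comm]
    simp [this]
  have hspan : ∀ t, Submodule.span K (Set.range (c t)) = LinearMap.ker (Φ t) := by
    intro t
    apply le_antisymm
    · rw [Submodule.span_le]
      rintro _ ⟨j, rfl⟩
      simp only [c, SetLike.mem_coe, LinearMap.mem_ker, map_sub]
      rw [hid t (Φ t _) (hr _ _), sub_self]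
    · intro x hx
      have h1 : x = ∑ b, B.repr x b • (B b - Φ t (B b)) := by
        have h2 : ∑ b, B.repr x b • (B b - Φ t (B b)) = x - Φ t x := by
          conv_rhs => rw [← B.sum_repr x]
          simp only [map_sum, map_smul, smul_sub, Finset.sum_sub_distrib]
        rw [h2, LinearMap.mem_ker.1 hx, sub_zero]
      rw [h1]
      refine Submodule.sum_mem _ fun b _ => Submodule.smul_mem _ _ ?_
      by_cases hb : b ∈ S
      · rw [hS t b hb, sub_self]; exact Submodule.zero_mem _
      · refine Submodule.subset_span ⟨k.symm ⟨b, hb⟩, ?_⟩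
        simp [c]
  have hli : ∀ t, LinearIndependent K (c t) := by
    intro t
    let L0 : V →ₗ[K] Fin a → K := LinearMap.pi fun i => B.coord (k i).1
    refine LinearIndependent.of_comp L0 ?_
    have : L0 ∘ c t = fun j => Pi.single j 1 := by
      funext j i
      simp only [Function.comp, L0, LinearMap.pi_apply, hck, Pi.single_apply]
    rw [this]
    exact Pi.linearIndependent_single_one _ _
  have hcpoly : ∀ i, IsPolyMap fun t => c t i := by
    intro i φ
    simp only [c, map_sub]
    exact sub_mem (const_mem_polyFun _) (hpoly _ φ)
  let D : (V →ₗ[K] Fin a → K) → Module.Dual K (⋀[K]^a V) := fun L =>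
    exteriorPower.alternatingMapLinearEquiv (Matrix.detRowAlternating.compLinearMap L)
  have hD : ∀ L t, D L (exteriorPower.ιMulti K a (c t)) = Matrix.det fun i => L (c t i) :=
    fun L t => by
      simp only [D, exteriorPower.alternatingMapLinearEquiv_apply_ιMulti]
      rfl
  let ip : Fin m → Fin a := fun i => k.symm ⟨(pos i).1, hp1 i⟩
  have hip : ∀ i, (k (ip i)).1 = (pos i).1 := fun i => by simp [ip]
  refine isFullAffineSpace_of_chart (ψ := fun t => exteriorPower.ιMulti K a (c t)) ?_
    (D (LinearMap.pi fun i => B.coord (k i).1))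
    -- The Plücker coordinate in which the basis vector `(pos i).1` outside `S` is exchanged for
    -- `(pos i).2` in `S`. The sign compensates for that of `Φ t` in `c`.
    (fun i => D (LinearMap.pi (Function.update (fun i => B.coord (k i).1) (ip i)
      (-B.coord (pos i).2)))) ?_ ?_ ?_
  · intro φ
    exact IsPolyMap.multilinear B
      ((φ.compAlternatingMap (exteriorPower.ιMulti K a)).toMultilinearMap) hcpoly
  · intro t
    rw [hD]
    have : (fun i => (LinearMap.pi fun i => B.coord (k i).1) (c t i)) =
        (1 : Matrix (Fin a) (Fin a) K) := by
      ext i j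
      simp only [LinearMap.pi_apply, hck, Matrix.one_apply, eq_comm]
    rw [this, Matrix.det_one]
  · intro t i
    rw [hD]
    have : (fun j => (LinearMap.pi (Function.update (fun i => B.coord (k i).1) (ip i)
        (-B.coord (pos i).2))) (c t j)) = (1 : Matrix (Fin a) (Fin a) K).updateCol (ip i)
          (fun j => -B.coord (pos i).2 (c t j)) := by
      ext j l
      by_cases hl : l = ip i
      · subst hl; simp
      · simp only [LinearMap.pi_apply, Function.update_of_ne hl, Matrix.updateCol_ne hl,
          hck, Matrix.one_apply, eq_comm]
    -- Replacing one column of the identity matrix gives as determinant the diagonal entry of the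
    -- new column.
    rw [this, ← Matrix.cramer_apply, Matrix.cramer_one]
    have h1 : (pos i).1 ≠ (pos i).2 := fun h => hp1 i (h ▸ hp2 i)
    simp only [Module.End.one_apply, c, map_sub, hip, Module.Basis.coord_apply, hpos,
      Module.Basis.repr_self, Finsupp.single_eq_of_ne h1.symm, zero_sub, neg_neg]
  · intro x
    constructor
    · rintro ⟨_, ⟨t, rfl⟩, c', hc', hs, hx⟩
      refine ⟨t, hx.trans ?_⟩
      rw [← hspan t] at hs
      apply le_antisymm
      · rw [Submodule.span_singleton_le_iff_mem]
        exact AlternatingMap.map_mem_span_of_span_le _ hs.le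
      · rw [Submodule.span_singleton_le_iff_mem]
        exact AlternatingMap.map_mem_span_of_span_le _ hs.ge
    · rintro ⟨t, ht⟩
      exact ⟨_, ⟨t, rfl⟩, c t, hli t, hspan t, ht⟩

end Graphs

/-! ### Paths, and the radical filtration of a bound quiver algebra. -/

section BoundQuiverAlgebras

variable {K : Type*} {Q : Type*} {A : Type*} [Field K] [Quiver Q] [Fintype Q] [Ring A] [Algebra K A]
variable (π : PathAlgebra K Q →ₐ[K] A)

theorem pathElt_mul_pathElt {i j k : Q} (p : Quiver.Path j k) (q : Quiver.Path i j) :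
    pathElt π p * pathElt π q = pathElt π (q.comp p) := by
  rw [pathElt, pathElt, ← map_mul, PathAlgebra.ofPath_mul_ofPath, pathElt]

theorem pathElt_mul_pathElt_of_ne {i j j' k : Q} (p : Quiver.Path j k) (q : Quiver.Path i j')
    (h : j' ≠ j) : pathElt π p * pathElt π q = 0 := by
  rw [pathElt, pathElt, ← map_mul, PathAlgebra.ofPath_mul_ofPath_of_ne _ _ h, map_zero]

theorem vertexElt_mul_pathElt {i j : Q} (p : Quiver.Path i j) :
    vertexElt π j * pathElt π p = pathElt π p := by
  rw [vertexElt, pathElt_mul_pathElt, Quiver.Path.comp_nil]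

theorem pathElt_mul_vertexElt {i j : Q} (p : Quiver.Path i j) :
    pathElt π p * vertexElt π i = pathElt π p := by
  rw [vertexElt, pathElt_mul_pathElt, Quiver.Path.nil_comp]

theorem vertexElt_mul_self (i : Q) : vertexElt π i * vertexElt π i = vertexElt π i :=
  vertexElt_mul_pathElt π _

theorem sum_vertexElt : ∑ i, vertexElt π i = 1 := by
  simp only [vertexElt, pathElt, ← map_sum, ← PathAlgebra.one_eq, map_one]

/-- The subspace of `A` spanned by the paths of length at least `l`. -/
def pathSpan (l : ℕ) : Submodule K A :=
  Submodule.span K {x | ∃ (i j : Q) (p : Quiver.Path i j), l ≤ p.length ∧ x = pathElt π p}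

variable {π}

theorem pathElt_mem_pathSpan {i j : Q} {p : Quiver.Path i j} {l : ℕ} (h : l ≤ p.length) :
    pathElt π p ∈ pathSpan π l := Submodule.subset_span ⟨i, j, p, h, rfl⟩

theorem pathSpan_antitone {l m : ℕ} (h : l ≤ m) : pathSpan π m ≤ pathSpan π l :=
  Submodule.span_mono fun _ ⟨i, j, p, hp, hx⟩ => ⟨i, j, p, h.trans hp, hx⟩

theorem mul_mem_pathSpan {l m : ℕ} {x y : A} (hx : x ∈ pathSpan π l) (hy : y ∈ pathSpan π m) :
    x * y ∈ pathSpan π (l + m) := by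
  induction hx using Submodule.span_induction with
  | zero => rw [zero_mul]; exact Submodule.zero_mem _
  | add x x' _ _ hx hx' => rw [add_mul]; exact Submodule.add_mem _ hx hx'
  | smul a x _ hx => rw [smul_mul_assoc]; exact Submodule.smul_mem _ _ hx
  | mem x hx =>
    obtain ⟨i, j, p, hp, rfl⟩ := hx
    induction hy using Submodule.span_induction with
    | zero => rw [mul_zero]; exact Submodule.zero_mem _
    | add x x' _ _ hx hx' => rw [mul_add]; exact Submodule.add_mem _ hx hx'
    | smul a x _ hx => rw [mul_smul_comm]; exact Submodule.smul_mem _ _ hx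
    | mem y hy =>
      obtain ⟨i', j', q, hq, rfl⟩ := hy
      by_cases h : j' = i
      · subst h
        rw [pathElt_mul_pathElt]
        exact pathElt_mem_pathSpan (by rw [Quiver.Path.length_comp]; omega)
      · rw [pathElt_mul_pathElt_of_ne _ _ _ h]
        exact Submodule.zero_mem _

theorem pathSpan_zero (hπ : Function.Surjective π) (x : A) : x ∈ pathSpan π 0 := by
  obtain ⟨f, rfl⟩ := hπ x
  induction f using PathAlgebra.induction with
  | zero => rw [map_zero]; exact Submodule.zero_mem _
  | add f g hf hg => rw [map_add]; exact Submodule.add_mem _ hf hg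
  | smul a i j p => rw [map_smul]; exact Submodule.smul_mem _ _ (pathElt_mem_pathSpan (Nat.zero_le _))

theorem mul_mem_pathSpan_right (hπ : Function.Surjective π) {l : ℕ} (x : A) {y : A}
    (hy : y ∈ pathSpan π l) : x * y ∈ pathSpan π l := by
  simpa using mul_mem_pathSpan (pathSpan_zero hπ x) hy

theorem mul_mem_pathSpan_left (hπ : Function.Surjective π) {l : ℕ} {x : A} (y : A)
    (hx : x ∈ pathSpan π l) : x * y ∈ pathSpan π l := by
  simpa using mul_mem_pathSpan hx (pathSpan_zero hπ y)

/-- Modulo paths of positive length, only the multiples of `e_v` survive left multiplication by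
`e_v`. -/
theorem exists_vertexElt_mul_sub (hπ : Function.Surjective π) (v : Q) (y : A) :
    ∃ c : K, vertexElt π v * y - c • vertexElt π v ∈ pathSpan π 1 := by
  have hy := pathSpan_zero hπ y
  induction hy using Submodule.span_induction with
  | zero => exact ⟨0, by simp⟩
  | add x y _ _ hx hy =>
    obtain ⟨c, hc⟩ := hx
    obtain ⟨d, hd⟩ := hy
    refine ⟨c + d, ?_⟩
    convert Submodule.add_mem _ hc hd using 1
    rw [mul_add, add_smul]; abel
  | smul a x _ hx =>
    obtain ⟨c, hc⟩ := hx
    refine ⟨a * c, ?_⟩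
    convert Submodule.smul_mem _ a hc using 1
    rw [mul_smul_comm, mul_smul, smul_sub]
  | mem x hx =>
    obtain ⟨i, j, p, _, rfl⟩ := hx
    cases p with
    | nil =>
      by_cases h : i = v
      · subst h
        exact ⟨1, by rw [one_smul, vertexElt, pathElt_mul_pathElt]; simp⟩
      · refine ⟨0, ?_⟩
        rw [vertexElt, pathElt_mul_pathElt_of_ne _ _ _ h]; simp
    | cons p α =>
      refine ⟨0, ?_⟩
      rw [zero_smul, sub_zero]
      exact mul_mem_pathSpan_right hπ _ (pathElt_mem_pathSpan (by simp))

theorem exists_mul_vertexElt_sub (hπ : Function.Surjective π) (v : Q) (y : A) :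
    ∃ c : K, y * vertexElt π v - c • vertexElt π v ∈ pathSpan π 1 := by
  have hy := pathSpan_zero hπ y
  induction hy using Submodule.span_induction with
  | zero => exact ⟨0, by simp⟩
  | add x y _ _ hx hy =>
    obtain ⟨c, hc⟩ := hx
    obtain ⟨d, hd⟩ := hy
    refine ⟨c + d, ?_⟩
    convert Submodule.add_mem _ hc hd using 1
    rw [add_mul, add_smul]; abel
  | smul a x _ hx =>
    obtain ⟨c, hc⟩ := hx
    refine ⟨a * c, ?_⟩
    convert Submodule.smul_mem _ a hc using 1
    rw [smul_mul_assoc, mul_smul, smul_sub]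
  | mem x hx =>
    obtain ⟨i, j, p, _, rfl⟩ := hx
    cases p with
    | nil =>
      by_cases h : v = i
      · subst h
        exact ⟨1, by rw [one_smul, vertexElt, pathElt_mul_pathElt]; simp⟩
      · refine ⟨0, ?_⟩
        rw [vertexElt, pathElt_mul_pathElt_of_ne _ _ _ h]; simp
    | cons p α =>
      refine ⟨0, ?_⟩
      rw [zero_smul, sub_zero]
      exact mul_mem_pathSpan_left hπ _ (pathElt_mem_pathSpan (by simp))

/-- Paths of length less than `2` are linearly independent modulo the paths of greater length. -/
theorem linearIndependent_pathElt_mod (hadm : PathAlgebra.IsAdmissible (RingHom.ker π)) :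
    LinearIndependent K fun p : {p : QPath Q // p.2.2.length < 2} =>
      (pathSpan π 2).mkQ (pathElt π p.1.2.2) := by
  rw [linearIndependent_iff]
  classical
  intro l hl
  let ev : QPath Q → PathAlgebra K Q →ₗ[K] K := fun p => Finsupp.lapply p
  have hev : ∀ p q : QPath Q, ev p (PathAlgebra.ofQPath q) = if q = p then 1 else 0 := by
    intro p q
    exact Finsupp.single_apply
  set T := {x : PathAlgebra K Q | ∃ (i j : Q) (p : Quiver.Path i j), 2 ≤ p.length ∧
    x = PathAlgebra.ofPath K p} with hT
  have hev2 : ∀ p : QPath Q, p.2.2.length < 2 → ∀ f ∈ Submodule.span K T, ev p f = 0 := by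
    intro p hp f hf
    induction hf using Submodule.span_induction with
    | zero => exact map_zero _
    | add x y _ _ hx hy => rw [map_add, hx, hy, add_zero]
    | smul a x _ hx => rw [map_smul, hx, smul_zero]
    | mem x hx =>
      obtain ⟨i, j, q, hq, rfl⟩ := hx
      rw [PathAlgebra.ofPath, hev, if_neg]
      rintro rfl
      simp at hp; omega
  let f : PathAlgebra K Q := l.sum fun p c => c • PathAlgebra.ofQPath p.1
  have hf : π f ∈ pathSpan π 2 := by
    rw [← Submodule.Quotient.mk_eq_zero, ← Submodule.mkQ_apply]
    rw [Finsupp.linearCombination_apply] at hl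
    rw [← hl]
    simp only [f, Finsupp.sum, map_sum, map_smul]
    rfl
  have hmap : pathSpan π 2 = (Submodule.span K T).map π.toLinearMap := by
    rw [Submodule.map_span, pathSpan]
    congr 1
    ext x
    constructor
    · rintro ⟨i, j, p, hp, rfl⟩
      exact ⟨_, ⟨i, j, p, hp, rfl⟩, rfl⟩
    · rintro ⟨_, ⟨i, j, p, hp, rfl⟩, rfl⟩
      exact ⟨i, j, p, hp, rfl⟩
  rw [hmap] at hf
  obtain ⟨g, hg, hgf⟩ := hf
  -- Admissibility is used here: the difference of two lifts lies in the ideal, hence involves only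
  -- paths of length at least 2. So the coefficients of `f` at shorter paths vanish.
  have hfg : f - g ∈ Submodule.span K T := hadm.1 _ (by
    rw [RingHom.mem_ker, map_sub, sub_eq_zero]; exact hgf.symm)
  have hfT : f ∈ Submodule.span K T := by
    have := Submodule.add_mem _ hfg hg
    rwa [sub_add_cancel] at this
  ext p
  have h1 := hev2 p.1 p.2 f hfT
  simp only [f, Finsupp.sum, map_sum, map_smul, hev, smul_eq_mul, mul_ite, mul_one, mul_zero,
    Subtype.val_inj] at h1
  rw [Finset.sum_ite_eq'] at h1
  by_cases h : p ∈ l.support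
  · rw [if_pos h] at h1; exact h1
  · exact Finsupp.notMem_support_iff.1 h

theorem pathElt_notMem_pathSpan_two (hadm : PathAlgebra.IsAdmissible (RingHom.ker π)) {i j : Q}
    {p : Quiver.Path i j} (hp : p.length < 2) : pathElt π p ∉ pathSpan π 2 := by
  intro h
  refine (linearIndependent_pathElt_mod hadm).ne_zero ⟨⟨i, j, p⟩, hp⟩ ?_
  exact (Submodule.Quotient.mk_eq_zero _).2 h

theorem vertexElt_ne_zero (hadm : PathAlgebra.IsAdmissible (RingHom.ker π)) (i : Q) :
    vertexElt π i ≠ 0 := fun h =>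
  pathElt_notMem_pathSpan_two hadm (p := (Quiver.Path.nil : Quiver.Path i i)) (by simp)
    (by rw [← vertexElt, h]; exact Submodule.zero_mem _)

theorem pathSpan_le_jacobson (hπ : Function.Surjective π)
    (hadm : PathAlgebra.IsAdmissible (RingHom.ker π)) {x : A} (hx : x ∈ pathSpan π 1) :
    x ∈ Ring.jacobson A := by
  rw [← Ideal.jacobson_bot, Ideal.mem_jacobson_iff]
  intro y
  -- Powers of `y * x` lie in the spans of longer and longer paths, which are eventually zero; then
  -- `1 + y * x` is a unit.
  have hnil : IsNilpotent (y * x) := by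
    obtain ⟨N, hN⟩ := hadm.2
    have hyx := mul_mem_pathSpan_right hπ y hx
    have hpow : ∀ n, (y * x) ^ n ∈ pathSpan π n := by
      intro n
      induction n with
      | zero => exact pathSpan_zero hπ _
      | succ n ih => rw [pow_succ]; exact mul_mem_pathSpan ih hyx
    refine ⟨N, ?_⟩
    have hbot : pathSpan π N = ⊥ := by
      rw [eq_bot_iff, pathSpan, Submodule.span_le]
      rintro _ ⟨i, j, p, hp, rfl⟩
      exact hN i j p hp
    simpa [hbot] using hpow N
  obtain ⟨z, hz⟩ := hnil.isUnit_one_add.exists_left_inv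
  refine ⟨z, ?_⟩
  rw [Ideal.mem_bot, ← hz]
  noncomm_ring

theorem jacobson_le_pathSpan (hπ : Function.Surjective π)
    (hadm : PathAlgebra.IsAdmissible (RingHom.ker π)) {x : A} (hx : x ∈ Ring.jacobson A) :
    x ∈ pathSpan π 1 := by
  have hv : ∀ v, vertexElt π v * x ∈ pathSpan π 1 := by
    intro v
    obtain ⟨c, hc⟩ := exists_vertexElt_mul_sub hπ v x
    suffices c = 0 by simpa [this] using hc
    by_contra hc0
    have h1 := Ideal.sub_mem _ (Ideal.mul_mem_left _ (vertexElt π v) hx)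
      (pathSpan_le_jacobson hπ hadm hc)
    rw [sub_sub_cancel] at h1
    have h2 : vertexElt π v ∈ Ring.jacobson A := by
      have := Ideal.mul_mem_left _ (algebraMap K A c⁻¹) h1
      rwa [← Algebra.smul_def, smul_smul, inv_mul_cancel₀ hc0, one_smul] at this
    rw [← Ideal.jacobson_bot, Ideal.mem_jacobson_iff] at h2
    -- With the multiplier `-1` this says `z (1 - e_v) = 1`, and multiplying by the idempotent `e_v`
    -- on the right gives `e_v = 0`.
    obtain ⟨z, hz⟩ := h2 (-1)
    rw [Ideal.mem_bot] at hz
    have h3 : (z * -1 * vertexElt π v + z - 1) * vertexElt π v = -vertexElt π v := by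
      have := vertexElt_mul_self π v
      rw [sub_mul, add_mul, mul_assoc _ (vertexElt π v), this]
      noncomm_ring
    rw [hz, zero_mul] at h3
    exact vertexElt_ne_zero hadm v (neg_eq_zero.1 h3.symm)
  have : x = ∑ v, vertexElt π v * x := by rw [← Finset.sum_mul, sum_vertexElt, one_mul]
  rw [this]
  exact Submodule.sum_mem _ fun v _ => hv v

/-- Both inclusions reduce to the case `l = 1`: paths of positive length generate a nil ideal, and
no combination of paths with a nonzero vertex coefficient is in the radical. It turns all later
statements on radical powers into statements about paths. -/
theorem mem_jacobson_pow_iff (hπ : Function.Surjective π)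
    (hadm : PathAlgebra.IsAdmissible (RingHom.ker π)) {l : ℕ} {x : A} :
    x ∈ Ring.jacobson A ^ l ↔ x ∈ pathSpan π l := by
  constructor
  · intro hx
    induction l generalizing x with
    | zero => exact pathSpan_zero hπ x
    | succ l ih =>
      rw [Submodule.pow_succ] at hx
      refine Submodule.smul_induction_on hx (fun a ha b hb => ?_) fun a b ha hb =>
        Submodule.add_mem _ ha hb
      exact mul_mem_pathSpan (ih ha) (jacobson_le_pathSpan hπ hadm hb)
  · intro hx
    have hle : ∀ (n : ℕ) (y : A), y ∈ Ring.jacobson A ^ (n + 1) → y ∈ Ring.jacobson A ^ n := by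
      intro n y hy
      rw [Ideal.IsTwoSided.pow_succ] at hy
      exact Submodule.smul_induction_on (p := fun z => z ∈ Ring.jacobson A ^ n) hy
        (fun a _ b hb => Ideal.mul_mem_left _ a hb) fun a b ha hb => Submodule.add_mem _ ha hb
    have hle' : ∀ (n k : ℕ) (y : A), y ∈ Ring.jacobson A ^ (n + k) → y ∈ Ring.jacobson A ^ n := by
      intro n k
      induction k with
      | zero => exact fun y hy => hy
      | succ k ih => exact fun y hy => ih y (hle _ y hy)
    have hpath : ∀ {i j : Q} (p : Quiver.Path i j), pathElt π p ∈ Ring.jacobson A ^ p.length := by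
      intro i j p
      induction p with
      | nil => rw [Quiver.Path.length_nil, Submodule.pow_zero, Ideal.one_eq_top]; trivial
      | @cons j k p α ih =>
        rw [Quiver.Path.length_cons, Ideal.IsTwoSided.pow_succ, ← Quiver.Path.comp_toPath_eq_cons,
          ← pathElt_mul_pathElt]
        exact Ideal.mul_mem_mul (pathSpan_le_jacobson hπ hadm (pathElt_mem_pathSpan le_rfl)) ih
    induction hx using Submodule.span_induction with
    | zero => exact Submodule.zero_mem _
    | add x y _ _ hx hy => exact Submodule.add_mem _ hx hy
    | smul a x _ hx => rw [Algebra.smul_def]; exact Ideal.mul_mem_left _ _ hx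
    | mem x hx =>
      obtain ⟨i, j, p, hp, rfl⟩ := hx
      obtain ⟨k, hk⟩ := Nat.exists_eq_add_of_le hp
      exact hle' l k _ (hk ▸ hpath p)

section RadicalPowers

variable {M : Type*} [AddCommGroup M] [Module A M]

theorem smul_mem_radPow (hπ : Function.Surjective π)
    (hadm : PathAlgebra.IsAdmissible (RingHom.ker π)) {l : ℕ} {x : A} (hx : x ∈ pathSpan π l)
    (m : M) : x • m ∈ radPow A M l :=
  Submodule.smul_mem_smul ((mem_jacobson_pow_iff hπ hadm).2 hx) Submodule.mem_top

theorem radPow_zero (M : Type*) [AddCommGroup M] [Module A M] : radPow A M 0 = ⊤ := by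
  rw [radPow, Submodule.pow_zero, Ideal.one_eq_top, Submodule.top_smul]

theorem sum_vertexElt_smul (m : M) : ∑ i, vertexElt π i • m = m := by
  rw [← Finset.sum_smul, sum_vertexElt, one_smul]

variable [Module K M]

theorem radPow_induction (hπ : Function.Surjective π)
    (hadm : PathAlgebra.IsAdmissible (RingHom.ker π)) {l : ℕ} (N : Submodule K M)
    (h : ∀ x ∈ pathSpan π l, ∀ m : M, x • m ∈ N) {y : M} (hy : y ∈ radPow A M l) : y ∈ N := by
  refine Submodule.smul_induction_on hy (fun a ha b _ => ?_) fun a b ha hb => N.add_mem ha hb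
  exact h a ((mem_jacobson_pow_iff hπ hadm).1 ha) b

variable [IsScalarTower K A M]

theorem smul_mem_of_pathSpan {l : ℕ} {N : Submodule K M} {m : M}
    (h : ∀ (i j : Q) (p : Quiver.Path i j), l ≤ p.length → pathElt π p • m ∈ N) {x : A}
    (hx : x ∈ pathSpan π l) : x • m ∈ N := by
  induction hx using Submodule.span_induction with
  | zero => rw [zero_smul]; exact N.zero_mem
  | add x y _ _ hx hy => rw [add_smul]; exact N.add_mem hx hy
  | smul a x _ hx => rw [smul_assoc]; exact N.smul_mem _ hx
  | mem x hx =>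
    obtain ⟨i, j, p, hp, rfl⟩ := hx
    exact h i j p hp

end RadicalPowers

theorem pathSpan_three (hπ : Function.Surjective π)
    (hadm : PathAlgebra.IsAdmissible (RingHom.ker π)) (hJ : Ring.jacobson A ^ 3 = ⊥) {l : ℕ}
    (hl : 3 ≤ l) {x : A} (hx : x ∈ pathSpan π l) : x = 0 := by
  have := (mem_jacobson_pow_iff hπ hadm).2 (pathSpan_antitone hl hx)
  rw [hJ] at this
  exact this

theorem pathElt_eq_zero_of_three_le (hπ : Function.Surjective π)
    (hadm : PathAlgebra.IsAdmissible (RingHom.ker π)) (hJ : Ring.jacobson A ^ 3 = ⊥) {i j : Q}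
    {p : Quiver.Path i j} (hp : 3 ≤ p.length) : pathElt π p = 0 :=
  pathSpan_three hπ hadm hJ le_rfl (pathElt_mem_pathSpan hp)

end BoundQuiverAlgebras

/-! ### Consequences of self-injectivity and J^3 = 0 for the projectives `A e_v`. -/

section SelfInjective

variable {K : Type*} {Q : Type*} {A : Type*} [Field K] [Quiver Q] [Fintype Q] [Ring A] [Algebra K A]
variable {π : PathAlgebra K Q →ₐ[K] A}

/-- A acts on socle elements through A/J, and on those ending in `j` through a single scalar. Hence
endpoint-preserving linear maps between socle parts are automatically A-linear. -/
theorem exists_smul_eq_of_pathSpan_one_mul_eq_zero (hπ : Function.Surjective π) (a : A) (j : Q) :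
    ∃ c : K, ∀ x : A, vertexElt π j * x = x → (∀ r ∈ pathSpan π 1, r * x = 0) → a * x = c • x := by
  obtain ⟨c, hc⟩ := exists_mul_vertexElt_sub hπ j a
  refine ⟨c, fun x hx hr => ?_⟩
  have := hr _ hc
  rw [sub_mul, mul_assoc, hx, smul_mul_assoc, hx, sub_eq_zero] at this
  exact this

/-- Over a self-injective algebra, endpoint-preserving linear maps between parts of the left socle
are given by right multiplications. -/
theorem exists_forall_mul_eq (hπ : Function.Surjective π) (hinj : Module.Injective A A)
    {κ : Type*} {x y : κ → A} (hli : LinearIndependent K x) (j : κ → Q)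
    (hx : ∀ k, vertexElt π (j k) * x k = x k) (hy : ∀ k, vertexElt π (j k) * y k = y k)
    (hrx : ∀ k, ∀ r ∈ pathSpan π 1, r * x k = 0) (hry : ∀ k, ∀ r ∈ pathSpan π 1, r * y k = 0) :
    ∃ z : A, ∀ k, x k * z = y k := by
  obtain ⟨f, hf⟩ := LinearMap.exists_extend ((Module.Basis.span hli).constr K y)
  have hfx : ∀ k, f (x k) = y k := by
    intro k
    have h1 := LinearMap.congr_fun hf (Module.Basis.span hli k)
    rw [Module.Basis.constr_basis, LinearMap.comp_apply, Submodule.subtype_apply,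
      Module.Basis.span_apply] at h1
    exact h1
  have hmul : ∀ (a : A), ∀ w ∈ Submodule.span K (Set.range x),
      a * w ∈ Submodule.span K (Set.range x) ∧ f (a * w) = a * f w := by
    intro a w hw
    induction hw using Submodule.span_induction with
    | zero => simp
    | add u v _ _ hu hv =>
      rw [mul_add, map_add, map_add, mul_add, hu.2, hv.2]
      exact ⟨Submodule.add_mem _ hu.1 hv.1, rfl⟩
    | smul c u _ hu =>
      rw [mul_smul_comm, map_smul, map_smul, mul_smul_comm, hu.2]
      exact ⟨Submodule.smul_mem _ _ hu.1, rfl⟩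
    | mem w hw =>
      obtain ⟨k, rfl⟩ := hw
      obtain ⟨c, hc⟩ := exists_smul_eq_of_pathSpan_one_mul_eq_zero hπ a (j k)
      rw [hc _ (hx k) (hrx k), map_smul, hfx, hc _ (hy k) (hry k)]
      exact ⟨Submodule.smul_mem _ _ (Submodule.subset_span ⟨k, rfl⟩), rfl⟩
  let N : Submodule A A :=
    { carrier := Submodule.span K (Set.range x)
      zero_mem' := Submodule.zero_mem _
      add_mem' := Submodule.add_mem _
      smul_mem' := fun a w hw => (hmul a w hw).1 }
  let g : N →ₗ[A] A :=
    { toFun := fun w => f w.1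
      map_add' := fun u v => by simp
      map_smul' := fun a w => (hmul a w.1 w.2).2 }
  -- By injectivity the map extends to a left module endomorphism of A, which is right
  -- multiplication by its value at 1.
  obtain ⟨h, hh⟩ := hinj.out N.subtype N.injective_subtype g
  refine ⟨h 1, fun k => ?_⟩
  have h1 := hh ⟨x k, Submodule.subset_span ⟨k, rfl⟩⟩
  have h2 : h (x k) = y k := h1.trans (hfx k)
  rw [← h2, ← smul_eq_mul, ← map_smul, smul_eq_mul, mul_one]

variable (hπ : Function.Surjective π) (hadm : PathAlgebra.IsAdmissible (RingHom.ker π))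
variable (hJ : Ring.jacobson A ^ 3 = ⊥)
include hπ hadm hJ

theorem pathSpan_mul_eq_zero {l m : ℕ} (h : 3 ≤ l + m) {x y : A} (hx : x ∈ pathSpan π l)
    (hy : y ∈ pathSpan π m) : x * y = 0 :=
  pathSpan_three hπ hadm hJ h (mul_mem_pathSpan hx hy)

/-- For `x` in J^2 e_v only the class of `e_v z` modulo J matters, because J^3 = 0, and this class
is a multiple of `e_v`. -/
theorem exists_forall_pathSpan_two_mul_eq_smul (v : Q) (z : A) :
    ∃ c : K, ∀ x ∈ pathSpan π 2, x * vertexElt π v = x → x * z = c • x := by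
  obtain ⟨c, hc⟩ := exists_vertexElt_mul_sub hπ v z
  refine ⟨c, fun x hx hxv => ?_⟩
  have h1 := pathSpan_mul_eq_zero hπ hadm hJ (l := 2) (m := 1) (by norm_num) hx hc
  rw [mul_sub, ← mul_assoc, hxv, mul_smul_comm, hxv, sub_eq_zero] at h1
  exact h1

theorem vertexElt_mul_eq_smul_of_mem_pathSpan_two (hinj : Module.Injective A A) {v j j' : Q}
    {x y : A} (hx : x ∈ pathSpan π 2) (hxv : x * vertexElt π v = x) (hxj : vertexElt π j * x = x)
    (hx0 : x ≠ 0) (hy : y ∈ pathSpan π 2) (hyv : y * vertexElt π v = y)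
    (hyj : vertexElt π j' * y = y) : ∃ c : K, y = c • x := by
  by_contra! hc
  have hli : LinearIndependent K ![x, y] := by
    rw [LinearIndependent.pair_iff' hx0]
    exact fun a h => hc a h.symm
  -- If `x` and `y` were independent, some right multiplication would fix `x` and annihilate `y`,
  -- yet on J^2 e_v it is a scalar.
  obtain ⟨z, hz⟩ := exists_forall_mul_eq hπ hinj hli (y := ![x, 0]) ![j, j']
    (by intro k; fin_cases k <;> simp [hxj, hyj]) (by intro k; fin_cases k <;> simp [hxj])
    (by
      intro k r hr
      fin_cases k
      · exact pathSpan_mul_eq_zero hπ hadm hJ (l := 1) (m := 2) (by norm_num) hr hx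
      · exact pathSpan_mul_eq_zero hπ hadm hJ (l := 1) (m := 2) (by norm_num) hr hy)
    (by
      intro k r hr
      fin_cases k
      · exact pathSpan_mul_eq_zero hπ hadm hJ (l := 1) (m := 2) (by norm_num) hr hx
      · simp)
  obtain ⟨c, hc'⟩ := exists_forall_pathSpan_two_mul_eq_smul hπ hadm hJ v z
  have h0 := hz 0
  have h1 := hz 1
  simp only [Matrix.cons_val_zero, Matrix.cons_val_one, hc' x hx hxv, hc' y hy hyv] at h0 h1
  rcases smul_eq_zero.1 h1 with h | h
  · rw [h, zero_smul] at h0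
    exact hx0 h0.symm
  · exact hc 0 (by rw [h, zero_smul])

/-- The second radical layer of `A e_v` is at most one-dimensional. -/
theorem exists_eq_smul_of_mem_pathSpan_two (hinj : Module.Injective A A) {v j : Q} {x y : A}
    (hx : x ∈ pathSpan π 2) (hxv : x * vertexElt π v = x) (hxj : vertexElt π j * x = x)
    (hx0 : x ≠ 0) (hy : y ∈ pathSpan π 2) (hyv : y * vertexElt π v = y) : ∃ c : K, y = c • x := by
  have h : ∀ i, ∃ c : K, vertexElt π i * y = c • x := fun i =>
    vertexElt_mul_eq_smul_of_mem_pathSpan_two hπ hadm hJ hinj hx hxv hxj hx0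
      (mul_mem_pathSpan_right hπ _ hy) (by rw [mul_assoc, hyv])
      (j' := i) (by rw [← mul_assoc, vertexElt_mul_self])
  choose c hc using h
  refine ⟨∑ i, c i, ?_⟩
  rw [Finset.sum_smul, ← Finset.sum_congr rfl fun i _ => hc i, ← Finset.sum_mul, sum_vertexElt,
    one_mul]

/-- The socles of nonisomorphic indecomposable projectives of Loewy length `3` are nonisomorphic. -/
theorem start_eq_of_pathElt_ne_zero (hinj : Module.Injective A A) {v v' j : Q}
    {p : Quiver.Path v j} {p' : Quiver.Path v' j} (hp : 2 ≤ p.length) (hp' : 2 ≤ p'.length)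
    (hp0 : pathElt π p ≠ 0) (hp0' : pathElt π p' ≠ 0) : v = v' := by
  obtain ⟨z, hz⟩ := exists_forall_mul_eq hπ hinj (κ := Unit) (x := fun _ => pathElt π p)
    (y := fun _ => pathElt π p') (LinearIndependent.of_subsingleton () hp0) (fun _ => j)
    (fun _ => vertexElt_mul_pathElt π p) (fun _ => vertexElt_mul_pathElt π p')
    (fun _ r hr => pathSpan_mul_eq_zero hπ hadm hJ (by norm_num) hr (pathElt_mem_pathSpan hp))
    (fun _ r hr => pathSpan_mul_eq_zero hπ hadm hJ (by norm_num) hr (pathElt_mem_pathSpan hp'))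
  obtain ⟨c, hc⟩ := exists_forall_pathSpan_two_mul_eq_smul hπ hadm hJ v z
  have h1 := hz ()
  rw [hc _ (pathElt_mem_pathSpan hp) (pathElt_mul_vertexElt π p)] at h1
  by_contra hne
  apply hp0'
  rw [← pathElt_mul_vertexElt π p', ← h1, smul_mul_assoc, vertexElt,
    pathElt_mul_pathElt_of_ne _ _ _ (Ne.symm hne), smul_zero]

/-- The left socle of `A e_v` is contained in the second power of the radical, when `A e_v` has
Loewy length `3`. -/
theorem mem_pathSpan_two_of_pathSpan_one_mul_eq_zero (hinj : Module.Injective A A) {v k : Q}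
    {u : Quiver.Path v k} (hu : 2 ≤ u.length) (hu0 : pathElt π u ≠ 0) {x : A}
    (hx : x ∈ pathSpan π 1) (hxv : x * vertexElt π v = x)
    (hx0 : ∀ r ∈ pathSpan π 1, r * x = 0) : x ∈ pathSpan π 2 := by
  have key : ∀ i, vertexElt π i * x ∈ pathSpan π 2 := by
    intro i
    by_contra hi
    have hu2 : pathElt π u ∈ pathSpan π 2 := pathElt_mem_pathSpan hu
    have hli : LinearIndependent K ![pathElt π u, vertexElt π i * x] := by
      rw [LinearIndependent.pair_iff' hu0]
      intro a h
      exact hi (h ▸ Submodule.smul_mem _ _ hu2)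
    -- Fixing `u` forces `e_v z` to be `e_v` modulo J. Then right multiplication by `z` fixes `e_i
    -- x` modulo J^2, while it was chosen to annihilate it.
    obtain ⟨z, hz⟩ := exists_forall_mul_eq hπ hinj hli (y := ![pathElt π u, 0]) ![k, i]
      (by
        intro k
        fin_cases k
        · simp [vertexElt_mul_pathElt]
        · simp [← mul_assoc, vertexElt_mul_self])
      (by intro k; fin_cases k <;> simp [vertexElt_mul_pathElt])
      (by
        intro k r hr
        fin_cases k
        · exact pathSpan_mul_eq_zero hπ hadm hJ (l := 1) (m := 2) (by norm_num) hr hu2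
        · simpa [← mul_assoc] using hx0 _ (mul_mem_pathSpan_left hπ (vertexElt π i) hr))
      (by
        intro k r hr
        fin_cases k
        · exact pathSpan_mul_eq_zero hπ hadm hJ (l := 1) (m := 2) (by norm_num) hr hu2
        · simp)
    obtain ⟨c, hc⟩ := exists_vertexElt_mul_sub hπ v z
    have h0 := hz 0
    have h1 := hz 1
    simp only [Matrix.cons_val_zero, Matrix.cons_val_one] at h0 h1
    have h2 := pathSpan_mul_eq_zero hπ hadm hJ (l := 2) (m := 1) (by norm_num) hu2 hc
    rw [mul_sub, ← mul_assoc, pathElt_mul_vertexElt, h0, mul_smul_comm, pathElt_mul_vertexElt,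
      sub_eq_zero] at h2
    have hc1 : c = 1 := by
      by_contra h
      have h3 : (1 - c) • pathElt π u = 0 := by rw [sub_smul, one_smul, ← h2, sub_self]
      exact (smul_ne_zero (sub_ne_zero.2 (Ne.symm h)) hu0) h3
    have hx' : vertexElt π i * x ∈ pathSpan π 1 := mul_mem_pathSpan_right hπ _ hx
    have h4 := mul_mem_pathSpan hx' hc
    rw [mul_sub, ← mul_assoc, mul_assoc _ x, hxv, h1, hc1, one_smul, mul_assoc, hxv, zero_sub] at h4
    exact hi ((Submodule.neg_mem_iff _).1 h4)
  have : x = ∑ v, vertexElt π v * x := by rw [← Finset.sum_mul, sum_vertexElt, one_mul]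
  rw [this]
  exact Submodule.sum_mem _ fun i _ => key i

end SelfInjective

/-! ### Linear independence under quotient maps. -/

section LinearAlgebra

variable {K V ι : Type*} [Field K] [AddCommGroup V] [Module K V]

/-- The kernel lies in the span of `t`, which meets the span of the disjoint set `s` trivially. -/
theorem LinearIndepOn.map_of_le_span {W : Type*} [AddCommGroup W] [Module K W] {v : ι → V}
    {σ s t : Set ι} (h : LinearIndepOn K v σ) (hs : s ⊆ σ) (ht : t ⊆ σ) (hst : Disjoint s t)
    {f : V →ₗ[K] W} (hf : LinearMap.ker f ≤ Submodule.span K (v '' t)) :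
    LinearIndepOn K (f ∘ v) s := by
  have h1 : LinearIndependent K fun b : s => v b := h.mono hs
  refine h1.map (f := f) ?_
  have h2 := h.disjoint_span_image (s := Subtype.val ⁻¹' s) (t := Subtype.val ⁻¹' t)
    (hst.preimage _)
  have h3 : (fun x : σ => v x) '' (Subtype.val ⁻¹' t) = v '' t := by
    rw [show (fun x : σ => v x) = v ∘ Subtype.val from rfl, Set.image_comp,
      Subtype.image_preimage_coe, Set.inter_eq_right.2 ht]
  have h4 : (fun x : σ => v x) '' (Subtype.val ⁻¹' s) = v '' s := by
    rw [show (fun x : σ => v x) = v ∘ Subtype.val from rfl, Set.image_comp,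
      Subtype.image_preimage_coe, Set.inter_eq_right.2 hs]
  rw [h3, h4] at h2
  have h5 : Set.range (fun b : s => v b) = v '' s := Set.image_eq_range v s |>.symm
  rw [h5]
  exact h2.mono_right hf

theorem LinearIndepOn.finrank_span_image {v : ι → V} {s : Set ι} (h : LinearIndepOn K v s)
    (hs : s.Finite) : Module.finrank K (Submodule.span K (v '' s)) = s.ncard := by
  have := hs.fintype
  rw [Set.image_eq_range, ← Nat.card_coe_set_eq, Nat.card_eq_fintype_card]
  exact finrank_span_eq_card h

end LinearAlgebra

/-! ### Paths of length zero in the free module. -/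

section Paths

variable {Q : Type*} [Quiver Q] {ι : Type*} {e : ι → Q}

theorem PathIn.eq_top_of_length_eq_zero {b : PathIn e} (h : b.length = 0) : b = PathIn.top b.1 := by
  obtain ⟨r, j, p⟩ := b
  cases p with
  | nil => rfl
  | cons p α => simp [PathIn.length] at h

theorem PathIn.length_top (r : ι) : (PathIn.top r : PathIn e).length = 0 := rfl

end Paths

/-! ### Skeleta and the radical filtration of a module. -/

section SkeletonCriteria

variable {K : Type*} {Q : Type*} {A : Type*} [Field K] [Quiver Q] [Fintype Q] [Ring A] [Algebra K A]
variable (π : PathAlgebra K Q →ₐ[K] A)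
variable {ι : Type*} {e : ι → Q}
variable {M : Type*} [AddCommGroup M] [Module A M]

/-- The image of the path `p z_r` under the homomorphism which sends `z_r` to `y r`. -/
noncomputable def pathVec (y : ι → M) (b : PathIn e) : M := pathElt π b.2.2 • y b.1

variable {π}

theorem pathVec_top {y : ι → M} (hy : ∀ r, vertexElt π (e r) • y r = y r) (r : ι) :
    pathVec π y (PathIn.top r : PathIn e) = y r := hy r

theorem vertexElt_smul_pathVec (y : ι → M) (b : PathIn e) :
    vertexElt π b.endpoint • pathVec π y b = pathVec π y b := by
  rw [pathVec, ← mul_smul]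
  exact congrArg (· • y b.1) (vertexElt_mul_pathElt π b.2.2)

theorem vertexElt_smul_pathVec_of_ne (y : ι → M) {b : PathIn e} {i : Q} (h : b.endpoint ≠ i) :
    vertexElt π i • pathVec π y b = 0 := by
  have h1 : vertexElt π i * pathElt π b.2.2 = 0 := pathElt_mul_pathElt_of_ne π _ _ h
  rw [pathVec, ← mul_smul, h1, zero_smul]

theorem pathVec_mem_radPow (hπ : Function.Surjective π)
    (hadm : PathAlgebra.IsAdmissible (RingHom.ker π)) (y : ι → M) {b : PathIn e} {l : ℕ}
    (h : l ≤ b.length) : pathVec π y b ∈ radPow A M l :=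
  smul_mem_radPow hπ hadm (pathElt_mem_pathSpan h) _

variable [Module K M]

theorem radPow_eq_bot (hπ : Function.Surjective π)
    (hadm : PathAlgebra.IsAdmissible (RingHom.ker π)) (hJ : Ring.jacobson A ^ 3 = ⊥) {l : ℕ}
    (hl : 3 ≤ l) {x : M} (hx : x ∈ radPow A M l) : x = 0 := by
  have := radPow_induction hπ hadm (⊥ : Submodule K M) (fun a ha m => by
    rw [pathSpan_three hπ hadm hJ hl ha, zero_smul]; exact Submodule.zero_mem _) hx
  exact this

variable [IsScalarTower K A M]

theorem mem_vertexPart_iff {i : Q} {m : M} : m ∈ vertexPart π M i ↔ vertexElt π i • m = m := by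
  constructor
  · rintro ⟨x, rfl⟩
    change vertexElt π i • vertexElt π i • x = vertexElt π i • x
    rw [← mul_smul, vertexElt_mul_self]
  · intro h
    exact ⟨m, h⟩

theorem smul_comm_algebra (a : A) (c : K) (m : M) : a • c • m = c • a • m := by
  rw [← algebraMap_smul A c m, ← mul_smul, ← Algebra.commutes, mul_smul, algebraMap_smul]

theorem vertexElt_smul_mem_span {y : ι → M} {s : Set (PathIn e)} {x : M}
    (hx : x ∈ Submodule.span K (pathVec π y '' s)) (i : Q) :
    vertexElt π i • x ∈ Submodule.span K (pathVec π y '' {b | b ∈ s ∧ b.endpoint = i}) := by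
  induction hx using Submodule.span_induction with
  | zero => rw [smul_zero]; exact Submodule.zero_mem _
  | add u v _ _ hu hv => rw [smul_add]; exact Submodule.add_mem _ hu hv
  | smul c u _ hu => rw [smul_comm_algebra]; exact Submodule.smul_mem _ _ hu
  | mem x hx =>
    obtain ⟨b, hb, rfl⟩ := hx
    by_cases h : b.endpoint = i
    · subst h
      rw [vertexElt_smul_pathVec]
      exact Submodule.subset_span ⟨b, ⟨hb, rfl⟩, rfl⟩
    · rw [vertexElt_smul_pathVec_of_ne _ h]
      exact Submodule.zero_mem _

theorem span_inf_vertexPart (y : ι → M) (s : Set (PathIn e)) (i : Q) :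
    Submodule.span K (pathVec π y '' s) ⊓ vertexPart π M i =
      Submodule.span K (pathVec π y '' {b | b ∈ s ∧ b.endpoint = i}) := by
  apply le_antisymm
  · rintro x ⟨hx, hxi⟩
    rw [← mem_vertexPart_iff.1 hxi]
    exact vertexElt_smul_mem_span hx i
  · refine le_inf (Submodule.span_mono (Set.image_mono fun b hb => hb.1)) ?_
    rw [Submodule.span_le]
    rintro _ ⟨b, ⟨_, rfl⟩, rfl⟩
    exact mem_vertexPart_iff.2 (vertexElt_smul_pathVec y b)

theorem dimVec_eq_ncard {y : ι → M} {s : Set (PathIn e)} (hs : s.Finite)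
    (hli : LinearIndepOn K (pathVec π y) s) (hspan : Submodule.span K (pathVec π y '' s) = ⊤)
    (i : Q) : dimVec π M i = skeletonDim s i := by
  have h := span_inf_vertexPart (π := π) y s i
  rw [hspan, top_inf_eq] at h
  rw [dimVec, h]
  exact (hli.mono fun b hb => hb.1).finrank_span_image (hs.subset fun b hb => hb.1)

/-- Modulo J^(l+1) M the longer paths die, while those of length `l` stay independent, as the kernel
of the quotient map is spanned by longer paths of `σ`. -/
theorem layerMult_eq_skeletonLayer (hπ : Function.Surjective π)
    (hadm : PathAlgebra.IsAdmissible (RingHom.ker π)) {y : ι → M} {σ : Set (PathIn e)}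
    (hs : σ.Finite) (hli : LinearIndepOn K (pathVec π y) σ)
    (hrad : ∀ l, ∀ x ∈ radPow A M l,
      x ∈ Submodule.span K (pathVec π y '' {b | b ∈ σ ∧ l ≤ b.length})) (l : ℕ) (i : Q) :
    layerMult π M l i = skeletonLayer σ l i := by
  set N := radPow A M (l + 1)
  have hv : pathVec π (fun r => N.mkQ (y r)) = (N.mkQ.restrictScalars K) ∘ (pathVec π y : PathIn e → M) := by
    funext b
    simp [pathVec]
  have hmap : ((radPow A M l).map N.mkQ).restrictScalars K =
      Submodule.span K (pathVec π (fun r => N.mkQ (y r)) '' {b | b ∈ σ ∧ b.length = l}) := by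
    apply le_antisymm
    · rintro _ ⟨x, hx, rfl⟩
      have h1 := hrad l x hx
      have h2 : N.mkQ x ∈ (Submodule.span K (pathVec π y '' {b | b ∈ σ ∧ l ≤ b.length})).map
        (N.mkQ.restrictScalars K) := ⟨x, h1, rfl⟩
      rw [Submodule.map_span, ← Set.image_comp, ← hv] at h2
      refine (Submodule.span_le.2 ?_) h2
      rintro _ ⟨b, ⟨hb, hbl⟩, rfl⟩
      rcases hbl.eq_or_lt with h | h
      · exact Submodule.subset_span ⟨b, ⟨hb, h.symm⟩, rfl⟩
      · have h3 : pathVec π (fun r => N.mkQ (y r)) b = 0 := by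
          rw [hv]
          exact (Submodule.Quotient.mk_eq_zero _).2 (pathVec_mem_radPow hπ hadm y h)
        rw [h3]; exact Submodule.zero_mem _
    · rw [Submodule.span_le]
      rintro _ ⟨b, ⟨hb, rfl⟩, rfl⟩
      rw [hv]
      exact ⟨_, pathVec_mem_radPow hπ hadm y le_rfl, rfl⟩
  rw [layerMult, hmap, span_inf_vertexPart]
  have hset : {b | b ∈ {b | b ∈ σ ∧ b.length = l} ∧ b.endpoint = i} =
      {b | b ∈ σ ∧ b.length = l ∧ b.endpoint = i} := by
    ext b; simp [and_assoc]
  rw [hset, hv, skeletonLayer]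
  refine LinearIndepOn.finrank_span_image ?_ (hs.subset fun b hb => hb.1)
  refine hli.map_of_le_span (t := {b | b ∈ σ ∧ l + 1 ≤ b.length}) (fun b hb => hb.1)
    (fun b hb => hb.1) ?_ ?_
  · rw [Set.disjoint_left]
    rintro b ⟨_, h, _⟩ ⟨_, h'⟩
    omega
  · intro x hx
    refine hrad _ x ?_
    exact (Submodule.Quotient.mk_eq_zero _).1 hx

/-- A criterion for skeleta: the paths in `σ` of length at least `l` span `J^l M`. -/
theorem isSkeletonRelative_of_radPow_le (hπ : Function.Surjective π)
    (hadm : PathAlgebra.IsAdmissible (RingHom.ker π)) {y : ι → M} {σ : Set (PathIn e)}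
    (hs : σ.Finite) (hσ : IsAbstractSkeleton A σ) (hy : ∀ r, vertexElt π (e r) • y r = y r)
    (hli : LinearIndepOn K (pathVec π y) σ)
    (hrad : ∀ l, ∀ x ∈ radPow A M l,
      x ∈ Submodule.span K (pathVec π y '' {b | b ∈ σ ∧ l ≤ b.length})) :
    IsSkeletonRelative π σ M y where
  isAbstractSkeleton := hσ
  layering := layerMult_eq_skeletonLayer hπ hadm hs hli hrad
  normed := hy
  top_linearIndependent := by
    have h := hli.map_of_le_span (s := {b | b ∈ σ ∧ b.length = 0})
      (t := {b | b ∈ σ ∧ 1 ≤ b.length}) (f := (radPow A M 1).mkQ.restrictScalars K)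
      (fun b hb => hb.1) (fun b hb => hb.1) (by
        rw [Set.disjoint_left]
        rintro b ⟨_, h⟩ ⟨_, h'⟩
        omega) (fun x hx => hrad _ x ((Submodule.Quotient.mk_eq_zero _).1 hx))
    have h2 := LinearIndependent.comp h
      (fun r : {r : ι // PathIn.top r ∈ σ} => ⟨PathIn.top r.1, r.2, rfl⟩) (by
        intro r r' hrr
        exact Subtype.ext (congrArg (fun b => b.1.1) hrr))
    have h3 : (fun r : {r : ι // PathIn.top r ∈ σ} => (radPow A M 1).mkQ (pathVec π y (PathIn.top r.1))) =
        fun r : {r : ι // PathIn.top r ∈ σ} => (radPow A M 1).mkQ (y r.1) :=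
      funext fun r => congrArg (radPow A M 1).mkQ (pathVec_top hy r.1)
    rw [← h3]
    exact h2
  top_span := by
    rw [eq_top_iff]
    rintro x -
    obtain ⟨x, rfl⟩ := (radPow A M 1).mkQ_surjective x
    have h1 := hrad 0 x (by rw [radPow_zero]; trivial)
    induction h1 using Submodule.span_induction with
    | zero => rw [map_zero]; exact Submodule.zero_mem _
    | add u v _ _ hu hv => rw [map_add]; exact Submodule.add_mem _ hu hv
    | smul c u _ hu =>
      rw [LinearMap.map_smul_of_tower]; exact Submodule.smul_mem _ _ hu
    | mem x hx =>
      obtain ⟨b, ⟨hb, _⟩, rfl⟩ := hx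
      rcases Nat.eq_zero_or_pos b.length with h | h
      · have hb' := PathIn.eq_top_of_length_eq_zero h
        rw [hb'] at hb
        rw [hb', pathVec_top hy]
        exact Submodule.subset_span ⟨⟨b.1, hb⟩, rfl⟩
      · have h3 : (radPow A M 1).mkQ (pathVec π y b) = 0 :=
          (Submodule.Quotient.mk_eq_zero _).2 (pathVec_mem_radPow hπ hadm y h)
        rw [h3]; exact Submodule.zero_mem _
  linearIndependent := hli
  span := by
    rw [eq_top_iff]
    rintro x -
    have h1 := hrad 0 x (by rw [radPow_zero]; trivial)
    refine Submodule.span_mono ?_ h1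
    rintro _ ⟨b, ⟨hb, _⟩, rfl⟩
    exact ⟨⟨b, hb⟩, rfl⟩

theorem IsSkeletonRelative.linearIndepOn {σ : Set (PathIn e)} {y : ι → M}
    (h : IsSkeletonRelative π σ M y) : LinearIndepOn K (pathVec π y) σ := h.linearIndependent

theorem IsSkeletonRelative.span_eq_top {σ : Set (PathIn e)} {y : ι → M}
    (h : IsSkeletonRelative π σ M y) : Submodule.span K (pathVec π y '' σ) = ⊤ := by
  rw [Set.image_eq_range]; exact h.span

/-- In the expansion of an element of JM the top elements have coefficient zero, because they are
independent modulo JM. -/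
theorem IsSkeletonRelative.radPow_one_le (hπ : Function.Surjective π)
    (hadm : PathAlgebra.IsAdmissible (RingHom.ker π)) {σ : Set (PathIn e)} {y : ι → M}
    (h : IsSkeletonRelative π σ M y) {x : M} (hx : x ∈ radPow A M 1) :
    x ∈ Submodule.span K (pathVec π y '' {b | b ∈ σ ∧ 1 ≤ b.length}) := by
  have h1 : x ∈ Submodule.span K (Set.range fun r : {r : ι // PathIn.top r ∈ σ} => y r) ⊔
      Submodule.span K (pathVec π y '' {b | b ∈ σ ∧ 1 ≤ b.length}) := by
    have h2 : x ∈ Submodule.span K (pathVec π y '' σ) := by rw [h.span_eq_top]; trivial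
    refine (Submodule.span_le.2 ?_) h2
    rintro _ ⟨b, hb, rfl⟩
    rcases Nat.eq_zero_or_pos b.length with h' | h'
    · have hb' := PathIn.eq_top_of_length_eq_zero h'
      rw [hb'] at hb
      rw [hb', pathVec_top h.normed]
      exact Submodule.mem_sup_left (Submodule.subset_span ⟨⟨b.1, hb⟩, rfl⟩)
    · exact Submodule.mem_sup_right (Submodule.subset_span ⟨b, ⟨hb, h'⟩, rfl⟩)
  obtain ⟨u, hu, w, hw, rfl⟩ := Submodule.mem_sup.1 h1
  have hw' : w ∈ radPow A M 1 := by
    have : Submodule.span K (pathVec π y '' {b | b ∈ σ ∧ 1 ≤ b.length}) ≤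
        (radPow A M 1).restrictScalars K := by
      rw [Submodule.span_le]
      rintro _ ⟨b, ⟨_, hb⟩, rfl⟩
      exact pathVec_mem_radPow hπ hadm y hb
    exact this hw
  have hu' : u ∈ radPow A M 1 := by
    have := Submodule.sub_mem _ hx hw'
    rwa [add_sub_cancel_right] at this
  have hu0 : u = 0 := by
    obtain ⟨c, rfl⟩ := (Finsupp.mem_span_range_iff_exists_finsupp).1 hu
    have h3 := (Submodule.Quotient.mk_eq_zero _).2 hu'
    have h4 := (linearIndependent_iff.1 h.top_linearIndependent) c (by
      rw [Finsupp.linearCombination_apply]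
      rw [← Submodule.mkQ_apply] at h3
      rw [← h3]
      simp only [Finsupp.sum, map_sum, LinearMap.map_smul_of_tower])
    rw [h4, Finsupp.sum_zero_index]
  rwa [hu0, zero_add]

theorem radPow_three (hJ : Ring.jacobson A ^ 3 = ⊥) (M : Type*) [AddCommGroup M] [Module A M] :
    radPow A M 3 = ⊥ := by
  rw [radPow, hJ, Submodule.bot_smul]

/-- A dimension count: the layering prescribes the dimension of each e_i J^2 M, and the length-2
paths of `σ` ending in `i` are that many independent elements of it. -/
theorem IsSkeletonRelative.radPow_two_le (hπ : Function.Surjective π)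
    (hadm : PathAlgebra.IsAdmissible (RingHom.ker π)) (hJ : Ring.jacobson A ^ 3 = ⊥)
    {σ : Set (PathIn e)} (hs : σ.Finite) {y : ι → M}
    (h : IsSkeletonRelative π σ M y) {x : M} (hx : x ∈ radPow A M 2) :
    x ∈ Submodule.span K (pathVec π y '' {b | b ∈ σ ∧ 2 ≤ b.length}) := by
  have : Module.Finite K M := ⟨h.span_eq_top ▸ Submodule.fg_span (hs.image _)⟩
  suffices key : ∀ i, vertexElt π i • x ∈
      Submodule.span K (pathVec π y '' {b | b ∈ σ ∧ b.length = 2 ∧ b.endpoint = i}) by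
    rw [← sum_vertexElt_smul (π := π) x]
    refine Submodule.sum_mem _ fun i _ => ?_
    refine Submodule.span_mono (Set.image_mono ?_) (key i)
    rintro b ⟨hb, hb', _⟩
    exact ⟨hb, hb'.ge⟩
  intro i
  set N := Submodule.span K (pathVec π y '' {b | b ∈ σ ∧ b.length = 2 ∧ b.endpoint = i}) with hN
  -- As J^3 M = 0, the layer J^2 M / J^3 M in the definition of `layerMult` is J^2 M itself.
  have hb3 : radPow A M (2 + 1) = ⊥ := radPow_three hJ M
  let f : M →ₗ[K] M ⧸ radPow A M (2 + 1) := (radPow A M (2 + 1)).mkQ.restrictScalars K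
  have hf : Function.Injective f := by
    rw [← LinearMap.ker_eq_bot, eq_bot_iff]
    intro z hz
    have : z ∈ radPow A M (2 + 1) := (Submodule.Quotient.mk_eq_zero _).1 hz
    rwa [hb3] at this
  set W := ((radPow A M 2).map (radPow A M (2 + 1)).mkQ).restrictScalars K ⊓
      vertexPart π (M ⧸ radPow A M (2 + 1)) i with hW
  have hle : N.map f ≤ W := by
    rw [hN, Submodule.map_span, Submodule.span_le]
    rintro _ ⟨_, ⟨b, ⟨_, hb2, rfl⟩, rfl⟩, rfl⟩
    refine ⟨⟨_, pathVec_mem_radPow hπ hadm y hb2.ge, rfl⟩, mem_vertexPart_iff.2 ?_⟩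
    change vertexElt π b.endpoint • (radPow A M (2 + 1)).mkQ (pathVec π y b) =
      (radPow A M (2 + 1)).mkQ (pathVec π y b)
    rw [← map_smul, vertexElt_smul_pathVec]
  have hcard : Module.finrank K (N.map f) = Module.finrank K W := by
    have h1 : Module.finrank K W = skeletonLayer σ 2 i := h.layering 2 i
    rw [h1, LinearEquiv.finrank_eq (Submodule.equivMapOfInjective f hf N).symm]
    exact (h.linearIndepOn.mono fun b hb => hb.1).finrank_span_image (hs.subset fun b hb => hb.1)
  have heq := Submodule.eq_of_le_of_finrank_eq hle hcard
  have hmem : f (vertexElt π i • x) ∈ W := by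
    refine ⟨⟨_, Submodule.smul_mem _ _ hx, rfl⟩, mem_vertexPart_iff.2 ?_⟩
    change vertexElt π i • (radPow A M (2 + 1)).mkQ (vertexElt π i • x) =
      (radPow A M (2 + 1)).mkQ (vertexElt π i • x)
    rw [← map_smul, ← mul_smul, vertexElt_mul_self]
  rw [← heq] at hmem
  obtain ⟨z, hz, hzx⟩ := hmem
  rwa [← hf hzx]

theorem IsSkeletonRelative.radPow_le (hπ : Function.Surjective π)
    (hadm : PathAlgebra.IsAdmissible (RingHom.ker π)) (hJ : Ring.jacobson A ^ 3 = ⊥)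
    {σ : Set (PathIn e)} (hs : σ.Finite) {y : ι → M}
    (h : IsSkeletonRelative π σ M y) (l : ℕ) {x : M} (hx : x ∈ radPow A M l) :
    x ∈ Submodule.span K (pathVec π y '' {b | b ∈ σ ∧ l ≤ b.length}) := by
  match l, hx with
  | 0, _ => simp only [zero_le, and_true, Set.ofPred_mem_eq, h.span_eq_top]; trivial
  | 1, hx => exact h.radPow_one_le hπ hadm hx
  | 2, hx => exact h.radPow_two_le hπ hadm hJ hs hx
  | l + 3, hx =>
    rw [radPow_eq_bot hπ hadm hJ (by omega) hx]
    exact Submodule.zero_mem _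

end SkeletonCriteria

/-! ### Finiteness of the set of paths of bounded length. -/

section FinitenessOfPaths

variable {Q : Type*} [Quiver Q] [Finite Q] [∀ i j : Q, Finite (i ⟶ j)]

theorem finite_paths_of_length_le (v : Q) (n : ℕ) :
    {p : Σ j, Quiver.Path v j | p.2.length ≤ n}.Finite := by
  induction n with
  | zero =>
    refine (Set.finite_singleton (⟨v, Quiver.Path.nil⟩ : Σ j, Quiver.Path v j)).subset ?_
    rintro ⟨j, p⟩ hp
    cases p with
    | nil => rfl
    | cons p α => simp at hp
  | succ n ih =>
    have := ih.to_subtype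
    let f : (Σ p : {p : Σ j, Quiver.Path v j | p.2.length ≤ n}, Σ k, (p.1.1 ⟶ k)) →
        Σ j, Quiver.Path v j := fun x => ⟨x.2.1, x.1.1.2.cons x.2.2⟩
    refine ((Set.finite_range f).union ih).subset ?_
    rintro ⟨j, p⟩ hp
    cases p with
    | nil => exact Or.inr (by simp)
    | @cons b _ p α => exact Or.inl ⟨⟨⟨⟨b, p⟩, by simpa using hp⟩, ⟨j, α⟩⟩, rfl⟩

theorem finite_pathIn_of_length_le {ι : Type*} [Finite ι] {e : ι → Q} {s : Set (PathIn e)} {n : ℕ}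
    (hs : ∀ b ∈ s, b.length ≤ n) : s.Finite := by
  have h : (⋃ r : ι, (fun p => (⟨r, p⟩ : PathIn e)) '' {p | p.2.length ≤ n}).Finite :=
    Set.finite_iUnion fun r => (finite_paths_of_length_le (e r) n).image _
  refine h.subset fun b hb => Set.mem_iUnion.2 ⟨b.1, b.2, hs b hb, rfl⟩

end FinitenessOfPaths

/-! ### Loewy length and nonzero paths. -/

section LoewyLength

variable {K : Type*} {Q : Type*} {A : Type*} [Field K] [Quiver Q] [Fintype Q] [Ring A] [Algebra K A]
variable {π : PathAlgebra K Q →ₐ[K] A}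

theorem loewyLength_le_three (hJ : Ring.jacobson A ^ 3 = ⊥) (M : Type*) [AddCommGroup M]
    [Module A M] : loewyLength A M ≤ 3 := Nat.sInf_le (radPow_three hJ M)

theorem lt_loewyLength (hπ : Function.Surjective π)
    (hadm : PathAlgebra.IsAdmissible (RingHom.ker π)) (hJ : Ring.jacobson A ^ 3 = ⊥)
    {M : Type*} [AddCommGroup M] [Module A M] {l : ℕ} {x : A} (hx : x ∈ pathSpan π l) {m : M}
    (hm : x • m ≠ 0) : l < loewyLength A M := by
  by_contra! h
  have h1 : radPow A M (loewyLength A M) = ⊥ :=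
    Nat.sInf_mem (s := {m : ℕ | radPow A M m = ⊥}) ⟨3, radPow_three hJ M⟩
  have h2 := smul_mem_radPow hπ hadm (pathSpan_antitone h hx) m
  rw [h1] at h2
  exact hm h2

theorem length_lt_loewyLength (hπ : Function.Surjective π)
    (hadm : PathAlgebra.IsAdmissible (RingHom.ker π)) (hJ : Ring.jacobson A ^ 3 = ⊥) {i j : Q}
    {p : Quiver.Path i j} (hp : pathElt π p ≠ 0) : p.length < loewyLength A A :=
  lt_loewyLength hπ hadm hJ (pathElt_mem_pathSpan le_rfl) (m := (1 : A)) (by simpa using hp)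

theorem pathElt_ne_zero_of_length_lt_two (hadm : PathAlgebra.IsAdmissible (RingHom.ker π)) {i j : Q}
    {p : Quiver.Path i j} (hp : p.length < 2) : pathElt π p ≠ 0 := fun h =>
  pathElt_notMem_pathSpan_two hadm hp (h ▸ Submodule.zero_mem _)

end LoewyLength

/-! ### Standard skeleta, and the trees of normalized skeleta. -/

section StandardSkeleta

variable {K : Type*} {Q : Type*} {A : Type*} [Field K] [Quiver Q] [Fintype Q] [Ring A] [Algebra K A]
variable (π : PathAlgebra K Q →ₐ[K] A)

/-- The vertices `v` for which `A e_v` has Loewy length at least `3`. -/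
def IsLongVertex (v : Q) : Prop :=
  ∃ (j : Q) (p : Quiver.Path v j), p.length = 2 ∧ pathElt π p ≠ 0

/-- The nonzero paths of length `2`. -/
def IsSoclePath {v : Q} (p : Σ j, Quiver.Path v j) : Prop :=
  p.2.length = 2 ∧ pathElt π p.2 ≠ 0

variable {ι : Type*} {e : ι → Q}

/-- The paths of length at most `1`, together with one nonzero path of length `2` in each tree
whose root has Loewy length `3`. -/
def stdSkeleton (q : ∀ r : ι, Σ j, Quiver.Path (e r) j) : Set (PathIn e) :=
  {b | b.length < 2 ∨ b.2 = q b.1 ∧ IsSoclePath π b.2}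

variable {π}

theorem IsSoclePath.isLongVertex {v : Q} {p : Σ j, Quiver.Path v j} (h : IsSoclePath π p) :
    IsLongVertex π v := ⟨p.1, p.2, h⟩

theorem exists_isSoclePath (v : Q) :
    ∃ p : Σ j, Quiver.Path v j, IsLongVertex π v → IsSoclePath π p := by
  by_cases h : IsLongVertex π v
  · obtain ⟨j, p, hp⟩ := h
    exact ⟨⟨j, p⟩, fun _ => hp⟩
  · exact ⟨⟨v, Quiver.Path.nil⟩, fun h' => absurd h' h⟩

/-- The only possible path of length 2 is nonzero and lies in J^2, modulo which the shorter paths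
are independent. -/
theorem linearIndepOn_pathElt (hadm : PathAlgebra.IsAdmissible (RingHom.ker π)) {v : Q}
    (q : Σ j, Quiver.Path v j) :
    LinearIndepOn K (fun p : Σ j, Quiver.Path v j => pathElt π p.2)
      {p | p.2.length < 2 ∨ p = q ∧ IsSoclePath π p} := by
  set T : Set (Σ j, Quiver.Path v j) := {p | p = q ∧ IsSoclePath π p}
  have hset : {p : Σ j, Quiver.Path v j | p.2.length < 2 ∨ p = q ∧ IsSoclePath π p} =
      T ∪ {p | p.2.length < 2} := by
    ext p; exact or_comm
  rw [hset]
  refine LinearIndepOn.union_of_quotient ?_ ?_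
  · by_cases hq : IsSoclePath π q
    · have : T = {q} := by
        ext p
        constructor
        · exact fun h => h.1
        · rintro rfl; exact ⟨rfl, hq⟩
      rw [this]
      exact (linearIndepOn_singleton_iff K).2 hq.2
    · have : T = ∅ := by
        ext p
        constructor
        · rintro ⟨rfl, h⟩; exact hq h
        · exact fun h => h.elim
      rw [this]
      exact linearIndepOn_empty _ _
  · have hle : Submodule.span K ((fun p : Σ j, Quiver.Path v j => pathElt π p.2) '' T) ≤
        pathSpan π 2 := by
      rw [Submodule.span_le]
      rintro _ ⟨p, ⟨_, hp⟩, rfl⟩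
      exact pathElt_mem_pathSpan hp.1.ge
    refine LinearIndependent.of_comp (Submodule.factor hle) ?_
    have h := (linearIndependent_pathElt_mod hadm).comp
      (fun p : {p : Σ j, Quiver.Path v j | p.2.length < 2} => ⟨⟨v, p.1⟩, p.2⟩) (by
        intro p p' h
        simpa [Subtype.ext_iff] using h)
    exact h

/-- Every path of length 2 from `e r` is a multiple of `q r`, longer paths vanish, and paths
starting elsewhere annihilate `y r`. The span keeps the tree and the length bound, which the later
filtration arguments require. -/
theorem smul_mem_span_stdSkeleton (hπ : Function.Surjective π)
    (hadm : PathAlgebra.IsAdmissible (RingHom.ker π)) (hJ : Ring.jacobson A ^ 3 = ⊥)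
    (hinj : Module.Injective A A) {M : Type*} [AddCommGroup M] [Module A M] [Module K M]
    [IsScalarTower K A M] {y : ι → M} (hy : ∀ r, vertexElt π (e r) • y r = y r)
    {q : ∀ r : ι, Σ j, Quiver.Path (e r) j}
    (hq : ∀ r, IsLongVertex π (e r) → IsSoclePath π (q r)) {l : ℕ} {a : A}
    (ha : a ∈ pathSpan π l) (r : ι) :
    a • y r ∈ Submodule.span K
      (pathVec π y '' {b | b ∈ stdSkeleton π q ∧ b.1 = r ∧ l ≤ b.length}) := by
  refine smul_mem_of_pathSpan (fun i j p hp => ?_) ha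
  by_cases hi : e r = i
  · subst hi
    rcases lt_trichotomy p.length 2 with h | h | h
    · exact Submodule.subset_span ⟨⟨r, j, p⟩, ⟨Or.inl h, rfl, hp⟩, rfl⟩
    · by_cases h0 : pathElt π p = 0
      · rw [h0, zero_smul]; exact Submodule.zero_mem _
      have hq' := hq r ⟨j, p, h, h0⟩
      obtain ⟨c, hc⟩ := exists_eq_smul_of_mem_pathSpan_two hπ hadm hJ hinj
        (pathElt_mem_pathSpan hq'.1.ge) (pathElt_mul_vertexElt π _) (vertexElt_mul_pathElt π _)
        hq'.2 (pathElt_mem_pathSpan h.ge) (pathElt_mul_vertexElt π p)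
      rw [hc, smul_assoc]
      refine Submodule.smul_mem _ _ (Submodule.subset_span
        ⟨⟨r, q r⟩, ⟨Or.inr ⟨rfl, hq'⟩, rfl, ?_⟩, rfl⟩)
      exact (hp.trans_eq h).trans_eq hq'.1.symm
    · rw [pathElt_eq_zero_of_three_le hπ hadm hJ h, zero_smul]
      exact Submodule.zero_mem _
  · rw [← hy r, ← mul_smul, vertexElt, pathElt_mul_pathElt_of_ne _ _ _ hi, zero_smul]
    exact Submodule.zero_mem _

theorem mem_span_vertexElt_iff {v : Q} {x : A} :
    x ∈ Ideal.span {vertexElt π v} ↔ x * vertexElt π v = x := by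
  rw [Ideal.mem_span_singleton']
  constructor
  · rintro ⟨a, rfl⟩
    rw [mul_assoc, vertexElt_mul_self]
  · exact fun h => ⟨x, h⟩

/-- The generator of `A e_v`. -/
noncomputable def projTop (π : PathAlgebra K Q →ₐ[K] A) (v : Q) : Ideal.span {vertexElt π v} :=
  ⟨vertexElt π v, Ideal.subset_span rfl⟩

theorem vertexElt_smul_projTop (v : Q) : vertexElt π v • projTop π v = projTop π v :=
  Subtype.ext (vertexElt_mul_self π v)

theorem coe_smul_projTop {v : Q} (x : Ideal.span {vertexElt π v}) : (x : A) • projTop π v = x :=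
  Subtype.ext (mem_span_vertexElt_iff.1 x.2)

theorem isAbstractSkeleton_stdSkeleton (hπ : Function.Surjective π)
    (hadm : PathAlgebra.IsAdmissible (RingHom.ker π)) (hJ : Ring.jacobson A ^ 3 = ⊥)
    (q : ∀ r : ι, Σ j, Quiver.Path (e r) j) : IsAbstractSkeleton A (stdSkeleton π q) := by
  constructor
  · rintro b (hb | ⟨_, hb⟩)
    · exact length_lt_loewyLength hπ hadm hJ (pathElt_ne_zero_of_length_lt_two hadm hb)
    · exact length_lt_loewyLength hπ hadm hJ hb.2
  · intro r j k p₁ p₂ h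
    have hlen : (p₁.comp p₂).length ≤ 2 := by
      rcases h with h | ⟨_, h⟩
      · exact Nat.le_of_lt h
      · exact h.1.le
    rw [Quiver.Path.length_comp] at hlen
    cases p₂ with
    | nil => exact h
    | cons p α =>
      left
      change p₁.length < 2
      rw [Quiver.Path.length_cons] at hlen
      omega

theorem isSkeletonRelative_projTop [∀ i j : Q, Finite (i ⟶ j)] (hπ : Function.Surjective π)
    (hadm : PathAlgebra.IsAdmissible (RingHom.ker π)) (hJ : Ring.jacobson A ^ 3 = ⊥)
    (hinj : Module.Injective A A) {v : Q} {q : Unit → Σ j, Quiver.Path v j}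
    (hq : IsLongVertex π v → IsSoclePath π (q ())) :
    IsSkeletonRelative π (stdSkeleton π (e := fun _ : Unit => v) q) (Ideal.span {vertexElt π v})
      fun _ => projTop π v := by
  have hy : ∀ r : Unit, vertexElt π ((fun _ : Unit => v) r) • projTop π v = projTop π v :=
    fun _ => vertexElt_smul_projTop v
  refine isSkeletonRelative_of_radPow_le hπ hadm
    (finite_pathIn_of_length_le (n := 2) ?_) (isAbstractSkeleton_stdSkeleton hπ hadm hJ q) hy ?_ ?_
  · rintro b (hb | ⟨_, hb⟩)
    · exact Nat.le_of_lt hb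
    · exact hb.1.le
  · refine LinearIndependent.of_comp ((Ideal.span {vertexElt π v}).subtype.restrictScalars K) ?_
    have h := (linearIndepOn_pathElt hadm (q ())).comp
      (fun b : stdSkeleton π (e := fun _ : Unit => v) q => ⟨b.1.2, b.2⟩) (by
        rintro ⟨⟨⟨⟩, b⟩, hb⟩ ⟨⟨⟨⟩, b'⟩, hb'⟩ h
        simpa [Subtype.ext_iff] using h)
    have h1 : (fun x => pathElt π x.1.2.2 :
        stdSkeleton π (e := fun _ : Unit => v) q → A) =
        (Ideal.span {vertexElt π v}).subtype.restrictScalars K ∘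
          fun x => pathVec π (fun _ => projTop π v) x.1 :=
      funext fun b => (pathElt_mul_vertexElt π b.1.2.2).symm
    rw [← h1]
    exact h
  · intro l x hx
    refine radPow_induction hπ hadm _ (fun a ha m => ?_) hx
    rw [← coe_smul_projTop m, ← mul_smul]
    refine Submodule.span_mono (Set.image_mono ?_) (smul_mem_span_stdSkeleton hπ hadm hJ hinj hy
      (fun _ => hq) (mul_mem_pathSpan_left hπ (m : A) ha) ())
    exact fun b hb => ⟨hb.1, hb.2.2⟩

theorem loewyLength_projective (hπ : Function.Surjective π)
    (hadm : PathAlgebra.IsAdmissible (RingHom.ker π)) (hJ : Ring.jacobson A ^ 3 = ⊥) {v : Q} :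
    loewyLength A (Ideal.span {vertexElt π v}) = 3 ↔ IsLongVertex π v := by
  constructor
  · intro h
    by_contra hv
    have h2 : radPow A (Ideal.span {vertexElt π v}) 2 = ⊥ := by
      rw [eq_bot_iff]
      intro x hx
      refine radPow_induction hπ hadm (⊥ : Submodule K (Ideal.span {vertexElt π v}))
        (fun a ha m => ?_) hx
      rw [← coe_smul_projTop m, ← mul_smul]
      refine smul_mem_of_pathSpan (fun i j p hp => ?_) (mul_mem_pathSpan_left hπ (m : A) ha)
      have : pathElt π p * vertexElt π v = 0 := by
        by_cases hi : v = i
        · subst hi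
          rw [pathElt_mul_vertexElt]
          by_contra h0
          have hlt := hp.lt_or_eq
          rcases hlt with h' | h'
          · exact h0 (pathElt_eq_zero_of_three_le hπ hadm hJ h')
          · exact hv ⟨j, p, h'.symm, h0⟩
        · rw [vertexElt, pathElt_mul_pathElt_of_ne _ _ _ hi]
      exact (Submodule.mem_bot K).2 (Subtype.ext this)
    have := Nat.sInf_le (s := {m : ℕ | radPow A (Ideal.span {vertexElt π v}) m = ⊥}) h2
    rw [loewyLength] at h
    omega
  · rintro ⟨j, p, hp, hp0⟩
    refine le_antisymm (loewyLength_le_three hJ _) ?_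
    refine lt_loewyLength hπ hadm hJ (pathElt_mem_pathSpan hp.ge) (m := projTop π v) ?_
    intro h
    apply hp0
    rw [← pathElt_mul_vertexElt π p]
    exact congrArg Subtype.val h

/-- The trees of a normalized skeleton. -/
theorem IsNormalizedSkeleton.exists_stdSkeleton [∀ i j : Q, Finite (i ⟶ j)]
    (hπ : Function.Surjective π) (hadm : PathAlgebra.IsAdmissible (RingHom.ker π))
    (hJ : Ring.jacobson A ^ 3 = ⊥) (hinj : Module.Injective A A) {σ : Set (PathIn e)}
    (hσ : IsNormalizedSkeleton π σ) :
    ∃ q : ∀ r : ι, Σ j, Quiver.Path (e r) j,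
      (∀ r, IsLongVertex π (e r) → IsSoclePath π (q r)) ∧ σ ⊆ stdSkeleton π q ∧
      ∀ b ∈ σ, b.length = 2 → ∀ b' : PathIn e, b'.1 = b.1 → b'.length < 2 → b' ∈ σ := by
  have key : ∀ r, ∃ q : Σ j, Quiver.Path (e r) j, (IsLongVertex π (e r) → IsSoclePath π q) ∧
      (∀ p, (⟨r, p⟩ : PathIn e) ∈ σ → p.2.length < 2 ∨ p = q ∧ IsSoclePath π p) ∧
      ∀ p, (⟨r, p⟩ : PathIn e) ∈ σ → p.2.length = 2 →
        ∀ p', p'.2.length < 2 → (⟨r, p'⟩ : PathIn e) ∈ σ := by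
    intro r
    obtain ⟨q₀, hq₀⟩ := exists_isSoclePath (π := π) (e r)
    rcases hσ.2 r with h | ⟨hl, y, hy⟩
    · refine ⟨q₀, hq₀, fun p hp => Or.inl ?_, fun p hp hp2 => ?_⟩
      · exact Nat.lt_succ_of_le (h ⟨(), p⟩ hp)
      · have h1 : p.2.length ≤ 1 := h ⟨(), p⟩ hp
        omega
    · have hlong := (loewyLength_projective hπ hadm hJ).1 hl
      have hq := hq₀ hlong
      have hstd := isSkeletonRelative_projTop hπ hadm hJ hinj (q := fun _ => q₀) (v := e r)
        (fun _ => hq)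
      set S := stdSkeleton π (e := fun _ : Unit => e r) (fun _ => q₀) with hS
      -- Both sets are skeleta of the same projective, so they have equally many paths of each
      -- length and endpoint. Hence the tree has all short paths and exactly one path of length 2,
      -- possibly different from `q₀`.
      have hlay : ∀ l i, skeletonLayer (tree σ r) l i = skeletonLayer S l i := fun l i =>
        (hy.layering l i).symm.trans (hstd.layering l i)
      have hSfin : S.Finite := finite_pathIn_of_length_le (n := 2) (by
        rintro b (hb | ⟨_, hb⟩)
        · exact Nat.le_of_lt hb
        · exact hb.1.le)
      have hshort : ∀ p : Σ j, Quiver.Path (e r) j, p.2.length < 2 → (⟨r, p⟩ : PathIn e) ∈ σ := by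
        intro p hp
        have hsub : {b : PathIn fun _ : Unit => e r | b ∈ tree σ r ∧ b.length = p.2.length ∧
            b.endpoint = p.1} ⊆ {b | b ∈ S ∧ b.length = p.2.length ∧ b.endpoint = p.1} := by
          rintro b ⟨_, h1, h2⟩
          exact ⟨Or.inl (h1 ▸ hp), h1, h2⟩
        have heq := Set.eq_of_subset_of_ncard_le hsub (hlay p.2.length p.1).ge
          (hSfin.subset fun b hb => hb.1)
        have hmem : (⟨(), p⟩ : PathIn fun _ : Unit => e r) ∈
            {b : PathIn fun _ : Unit => e r | b ∈ S ∧ b.length = p.2.length ∧ b.endpoint = p.1} :=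
          ⟨Or.inl hp, rfl, rfl⟩
        rw [← heq] at hmem
        exact hmem.1
      have htwo : ∀ i, {b | b ∈ S ∧ b.length = 2 ∧ b.endpoint = i} ⊆
          {(⟨(), q₀⟩ : PathIn fun _ : Unit => e r)} := by
        rintro i ⟨⟨⟩, p⟩ ⟨hp | ⟨hp, _⟩, h2, _⟩
        · omega
        · exact Set.mem_singleton_iff.2 (congrArg _ hp)
      have h1 : skeletonLayer S 2 q₀.1 = 1 := by
        rw [skeletonLayer, Set.ncard_eq_one]
        refine ⟨_, (htwo q₀.1).antisymm ?_⟩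
        rintro _ rfl
        exact ⟨Or.inr ⟨rfl, hq⟩, hq.1, rfl⟩
      obtain ⟨b, hb⟩ := Set.ncard_eq_one.1 ((hlay 2 q₀.1).trans h1)
      have hbmem : b ∈ tree σ r ∧ b.length = 2 ∧ b.endpoint = q₀.1 := by
        have : b ∈ ({b} : Set (PathIn fun _ : Unit => e r)) := rfl
        rwa [← hb] at this
      have hunique : ∀ p, (⟨r, p⟩ : PathIn e) ∈ σ → p.2.length = 2 → p = b.2 := by
        intro p hp hp2
        have hp' : (⟨(), p⟩ : PathIn fun _ : Unit => e r) ∈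
            {b | b ∈ tree σ r ∧ b.length = 2 ∧ b.endpoint = p.1} := ⟨hp, hp2, rfl⟩
        have hfin : {b | b ∈ tree σ r ∧ b.length = 2 ∧ b.endpoint = p.1}.Finite :=
          finite_pathIn_of_length_le (n := 2) fun b hb => hb.2.1.le
        by_cases hpq : p.1 = q₀.1
        · rw [hpq, hb] at hp'
          obtain ⟨⟨⟩, b'⟩ := b
          have := Set.mem_singleton_iff.1 hp'
          simpa using this
        · exfalso
          have h2 : skeletonLayer (tree σ r) 2 p.1 = 0 := by
            rw [hlay, skeletonLayer, Set.ncard_eq_zero (hSfin.subset fun b hb => hb.1),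
              Set.eq_empty_iff_forall_notMem]
            intro b' hb'
            have h3 := htwo p.1 hb'
            rw [Set.mem_singleton_iff] at h3
            subst h3
            exact hpq hb'.2.2.symm
          rw [skeletonLayer, Set.ncard_eq_zero hfin] at h2
          rw [h2] at hp'
          exact hp'
      have hb0 : pathElt π b.2.2 ≠ 0 := by
        intro h0
        refine hy.linearIndependent.ne_zero ⟨b, hbmem.1⟩ ?_
        simp only [h0, zero_smul]
      have hbs : IsSoclePath π b.2 := ⟨hbmem.2.1, hb0⟩
      -- The chosen path of length 2 is the one occurring in the tree itself, so that `σ` becomes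
      -- part of the standard skeleton.
      refine ⟨b.2, fun _ => hbs, fun p hp => ?_, fun p _ _ p' hp' => hshort p' hp'⟩
      have hlt : p.2.length < 3 := (hσ.1.1 _ hp).trans_le (loewyLength_le_three hJ A)
      rcases Nat.lt_or_ge p.2.length 2 with h | h
      · exact Or.inl h
      · have := hunique p hp (by omega)
        subst this
        exact Or.inr ⟨rfl, hbs⟩
  choose q hq using key
  refine ⟨q, fun r => (hq r).1, fun b hb => (hq b.1).2.1 b.2 hb, ?_⟩
  rintro ⟨r, p⟩ hb h2 ⟨r', p'⟩ h h'
  obtain rfl : r' = r := h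
  exact (hq r').2.2 p hb h2 p' h'

end StandardSkeleta

/-! ### Independence of a union, tested along a linear map. -/

section LinearAlgebra

variable {K V ι : Type*} [Field K] [AddCommGroup V] [Module K V]

theorem LinearIndepOn.union_of_comp {W : Type*} [AddCommGroup W] [Module K W] {f : ι → V}
    {g : V →ₗ[K] W} {s t : Set ι} (hs : LinearIndepOn K f s) (hg : ∀ b ∈ s, g (f b) = 0)
    (ht : LinearIndepOn K (g ∘ f) t) : LinearIndepOn K f (s ∪ t) := by
  refine hs.union_of_quotient ?_
  have hle : Submodule.span K (f '' s) ≤ LinearMap.ker g := by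
    rw [Submodule.span_le]
    rintro _ ⟨b, hb, rfl⟩
    exact hg b hb
  exact LinearIndependent.of_comp ((Submodule.span K (f '' s)).liftQ g hle) ht

end LinearAlgebra

/-! ### Independence of arrows in long trees. -/

section LongTrees

variable {K : Type*} {Q : Type*} {A : Type*} [Field K] [Quiver Q] [Fintype Q] [Ring A] [Algebra K A]
variable {π : PathAlgebra K Q →ₐ[K] A} {ι : Type*} {e : ι → Q}
variable {M : Type*} [AddCommGroup M] [Module A M] [Module K M] [IsScalarTower K A M]

theorem exists_mem_span_sub_mem {κ : Type*} {v : κ → M} {s : Set κ} (N : Submodule A M) {x : M}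
    (hx : N.mkQ x ∈ Submodule.span K ((N.mkQ.restrictScalars K ∘ v) '' s)) :
    ∃ u ∈ Submodule.span K (v '' s), x - u ∈ N := by
  rw [Set.image_comp, ← Submodule.map_span] at hx
  obtain ⟨u, hu, hux⟩ := hx
  refine ⟨u, hu, ?_⟩
  rw [← Submodule.Quotient.mk_eq_zero, ← Submodule.mkQ_apply, map_sub, ← hux]
  exact sub_self _

variable (hπ : Function.Surjective π) (hadm : PathAlgebra.IsAdmissible (RingHom.ker π))
variable (hJ : Ring.jacobson A ^ 3 = ⊥) (hinj : Module.Injective A A)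
include hπ hadm hJ hinj

/-- For `a` in J, each `a x_r` is a multiple of `q r`. Independence of the elements `q_r y_r` makes
these multiples zero, so `x_r` lies in the socle of a projective of Loewy length 3, hence in J^2. -/
theorem mem_pathSpan_two_of_sum_smul [Fintype ι] {y : ι → M} {q : ∀ r : ι, Σ j, Quiver.Path (e r) j}
    {Λ : Set ι} (hΛ : ∀ r ∈ Λ, IsSoclePath π (q r))
    (hli : LinearIndepOn K (fun r => pathElt π (q r).2 • y r) Λ) {x : ι → A}
    (hx0 : ∀ r ∉ Λ, x r = 0) (hx : ∀ r, x r ∈ pathSpan π 1) (hxe : ∀ r, x r * vertexElt π (e r) = x r)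
    (hsum : ∀ a ∈ pathSpan π 1, a • ∑ r, x r • y r = 0) (r : ι) : x r ∈ pathSpan π 2 := by
  classical
  by_cases hr : r ∈ Λ
  swap
  · rw [hx0 r hr]; exact Submodule.zero_mem _
  refine mem_pathSpan_two_of_pathSpan_one_mul_eq_zero hπ hadm hJ hinj (hΛ r hr).1.ge (hΛ r hr).2
    (hx r) (hxe r) fun a ha => ?_
  have h1 : ∀ s, ∃ c : K, s ∈ Λ → a * x s = c • pathElt π (q s).2 := by
    intro s
    by_cases hs : s ∈ Λ
    · have h0 : a * x s ∈ pathSpan π (1 + 1) := mul_mem_pathSpan ha (hx s)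
      obtain ⟨c, hc⟩ := exists_eq_smul_of_mem_pathSpan_two hπ hadm hJ hinj
        (pathElt_mem_pathSpan (hΛ s hs).1.ge) (pathElt_mul_vertexElt π _)
        (vertexElt_mul_pathElt π _) (hΛ s hs).2 (y := a * x s) h0
        (by rw [mul_assoc, hxe])
      exact ⟨c, fun _ => hc⟩
    · exact ⟨0, fun h => absurd h hs⟩
  choose c hc using h1
  have h2 : ∑ s with s ∈ Λ, c s • pathElt π (q s).2 • y s = 0 := by
    rw [← hsum a ha, Finset.smul_sum, Finset.sum_filter]
    refine Finset.sum_congr rfl fun s _ => ?_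
    by_cases hs : s ∈ Λ
    · rw [if_pos hs, ← mul_smul, hc s hs, smul_assoc]
    · rw [if_neg hs, hx0 s hs, zero_smul, smul_zero]
  have h3 : c r = 0 := linearIndepOn_iff'.1 hli (Finset.univ.filter (· ∈ Λ)) c
    (fun s hs => (Finset.mem_filter.1 hs).2) h2 r (Finset.mem_filter.2 ⟨Finset.mem_univ _, hr⟩)
  rw [hc r hr, h3, zero_smul]

/-- Arrows in long trees are linearly independent modulo the elements annihilated by the radical. -/
theorem eq_zero_of_pathSpan_one_smul_sum [Fintype ι] {y : ι → M}
    {q : ∀ r : ι, Σ j, Quiver.Path (e r) j}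
    {Λ : Set ι} (hΛ : ∀ r ∈ Λ, IsSoclePath π (q r))
    (hli : LinearIndepOn K (fun r => pathElt π (q r).2 • y r) Λ) {s : Finset (PathIn e)}
    (hs : ∀ b ∈ s, b.length = 1 ∧ b.1 ∈ Λ) {c : PathIn e → K}
    (hsum : ∀ a ∈ pathSpan π 1, a • ∑ b ∈ s, c b • pathVec π y b = 0) {b : PathIn e} (hb : b ∈ s) :
    c b = 0 := by
  classical
  -- The combination of arrows is collected tree by tree. Each collected element turns out to lie in
  -- J^2, where arrows are independent modulo J^2.
  let x : ι → A := fun r => ∑ b ∈ s with b.1 = r, c b • pathElt π b.2.2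
  have hx : ∀ r, x r ∈ pathSpan π 2 := by
    refine mem_pathSpan_two_of_sum_smul hπ hadm hJ hinj hΛ hli ?_ ?_ ?_ ?_
    · intro r hr
      refine Finset.sum_eq_zero fun b hb => ?_
      rw [Finset.mem_filter] at hb
      exact absurd (hb.2 ▸ (hs b hb.1).2) hr
    · intro r
      refine Submodule.sum_mem _ fun b hb => Submodule.smul_mem _ _ ?_
      exact pathElt_mem_pathSpan (hs b (Finset.mem_filter.1 hb).1).1.ge
    · intro r
      rw [Finset.sum_mul]
      refine Finset.sum_congr rfl fun b hb => ?_
      obtain rfl := (Finset.mem_filter.1 hb).2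
      rw [smul_mul_assoc, pathElt_mul_vertexElt]
    · intro a ha
      rw [← hsum a ha]
      congr 1
      rw [← Finset.sum_fiberwise (s := s) (g := fun b => b.1)]
      refine Finset.sum_congr rfl fun r _ => ?_
      rw [Finset.sum_smul]
      refine Finset.sum_congr rfl fun b hb => ?_
      obtain rfl := (Finset.mem_filter.1 hb).2
      rw [smul_assoc, pathVec]
  have h1 : LinearIndepOn K (fun b : PathIn e => (pathSpan π 2).mkQ (pathElt π b.2.2))
      {b' | b'.1 = b.1 ∧ b'.length < 2} := by
    refine (linearIndependent_pathElt_mod hadm).comp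
      (fun b' : {b' : PathIn e | b'.1 = b.1 ∧ b'.length < 2} => ⟨⟨_, b'.1.2⟩, b'.2.2⟩) ?_
    rintro ⟨⟨r, p⟩, h, _⟩ ⟨⟨r', p'⟩, h', _⟩ heq
    obtain rfl : r = b.1 := h
    obtain rfl : r' = b.1 := h'
    simpa [Subtype.ext_iff] using heq
  refine linearIndepOn_iff'.1 h1 (s.filter (fun b' => b'.1 = b.1)) c ?_ ?_ b (by simpa using hb)
  · intro b' hb'
    rw [Finset.mem_coe, Finset.mem_filter] at hb'
    exact ⟨hb'.2, by rw [(hs b' hb'.1).1]; norm_num⟩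
  · have := hx b.1
    rw [← Submodule.Quotient.mk_eq_zero, ← Submodule.mkQ_apply, map_sum] at this
    simpa only [map_smul] using this

end LongTrees

/-! ### Existence of normalized skeleta. -/

section ExistenceOfSkeleta

variable {K : Type*} {Q : Type*} {A : Type*} [Field K] [Quiver Q] [Fintype Q] [Ring A] [Algebra K A]
variable {π : PathAlgebra K Q →ₐ[K] A} {ι : Type*} [Fintype ι] {e : ι → Q}
variable {M : Type*} [AddCommGroup M] [Module A M] [Module K M] [IsScalarTower K A M]

/-- Nakayama's argument in filtered form: modulo J^(l+1) M the generators may be replaced by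
combinations of those in `T`, and the error terms disappear at J^3. -/
theorem radPow_le_span_of_generators (hπ : Function.Surjective π)
    (hadm : PathAlgebra.IsAdmissible (RingHom.ker π)) (hJ : Ring.jacobson A ^ 3 = ⊥)
    {y : ι → M} (hgen : ∀ m : M, ∃ a : ι → A, m = ∑ r, a r • y r) {T : Set ι}
    (hT : ∀ r, ∃ u ∈ Submodule.span K (y '' T), y r - u ∈ radPow A M 1) (l : ℕ) {x : M}
    (hx : x ∈ radPow A M l) :
    x ∈ Submodule.span K {m | ∃ a ∈ pathSpan π l, ∃ r ∈ T, m = a • y r} := by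
  set G : ℕ → Submodule K M := fun l =>
    Submodule.span K {m | ∃ a ∈ pathSpan π l, ∃ r ∈ T, m = a • y r} with hG
  have hstep : ∀ l, ∀ x ∈ radPow A M l, ∃ u ∈ G l, x - u ∈ radPow A M (l + 1) := by
    intro l x hx
    suffices x ∈ G l ⊔ (radPow A M (l + 1)).restrictScalars K by
      obtain ⟨u, hu, w, hw, rfl⟩ := Submodule.mem_sup.1 this
      exact ⟨u, hu, by rwa [add_sub_cancel_left]⟩
    refine radPow_induction hπ hadm _ (fun a ha m => ?_) hx
    obtain ⟨b, rfl⟩ := hgen m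
    rw [Finset.smul_sum]
    refine Submodule.sum_mem _ fun r _ => ?_
    rw [← mul_smul]
    have hab := mul_mem_pathSpan_left hπ (b r) ha
    obtain ⟨u, hu, hru⟩ := hT r
    rw [← add_sub_cancel u (y r), smul_add]
    refine Submodule.add_mem_sup ?_ ?_
    · have h1 : Submodule.span K (y '' T) ≤ (G l).comap (Algebra.lsmul K K M (a * b r)) := by
        rw [Submodule.span_le]
        rintro _ ⟨s, hs, rfl⟩
        exact Submodule.subset_span ⟨_, hab, s, hs, rfl⟩
      exact h1 hu
    · have h2 := radPow_induction hπ hadm (l := 1)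
        (((radPow A M (l + 1)).restrictScalars K).comap (Algebra.lsmul K K M (a * b r)))
        (fun a' ha' m' => by
          change (a * b r) • a' • m' ∈ radPow A M (l + 1)
          rw [← mul_smul]
          exact smul_mem_radPow hπ hadm (mul_mem_pathSpan hab ha') _) hru
      exact h2
  have hanti : ∀ l m, l ≤ m → G m ≤ G l := fun l m h => Submodule.span_mono
    fun _ ⟨a, ha, hx⟩ => ⟨a, pathSpan_antitone h ha, hx⟩
  have hdesc : ∀ k l, 3 ≤ l + k → ∀ x ∈ radPow A M l, x ∈ G l := by
    intro k
    induction k with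
    | zero =>
      intro l hl x hx
      rw [radPow_eq_bot hπ hadm hJ hl hx]
      exact Submodule.zero_mem _
    | succ k ih =>
      intro l hl x hx
      obtain ⟨u, hu, hxu⟩ := hstep l x hx
      have := Submodule.add_mem _ hu (hanti l (l + 1) (Nat.le_succ l) (ih (l + 1) (by omega) _ hxu))
      rwa [add_sub_cancel] at this
  exact hdesc 3 l (by omega) x hx

variable [∀ i j : Q, Finite (i ⟶ j)]

/-- Every module with a finite sequence of normed generators has a normalized skeleton with respect
to these generators. -/
theorem exists_isNormalizedSkeleton_isSkeletonRelative (hπ : Function.Surjective π)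
    (hadm : PathAlgebra.IsAdmissible (RingHom.ker π)) (hJ : Ring.jacobson A ^ 3 = ⊥)
    (hinj : Module.Injective A A) {y : ι → M} (hy : ∀ r, vertexElt π (e r) • y r = y r)
    (hgen : ∀ m : M, ∃ a : ι → A, m = ∑ r, a r • y r) :
    ∃ σ : Set (PathIn e), IsNormalizedSkeleton π σ ∧ IsSkeletonRelative π σ M y := by
  classical
  choose q hq using fun r => exists_isSoclePath (π := π) (e r)
  -- `T` indexes top elements forming a basis of M/JM.
  obtain ⟨T, -, -, hTspan, hTli⟩ := exists_linearIndepOn_extension (K := K)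
    (v := (radPow A M 1).mkQ.restrictScalars K ∘ y)
    (linearIndepOn_empty K ((radPow A M 1).mkQ.restrictScalars K ∘ y)) (Set.empty_subset Set.univ)
  have hT : ∀ r, ∃ u ∈ Submodule.span K (y '' T), y r - u ∈ radPow A M 1 := fun r =>
    exists_mem_span_sub_mem _ (hTspan ⟨r, trivial, rfl⟩)
  have hG := fun l x => radPow_le_span_of_generators hπ hadm hJ hgen hT l (x := x)
  -- `Λ` selects trees whose paths of length 2 form a basis of J^2 M; these will be the long trees.
  obtain ⟨Λ, hΛT, -, hΛspan, hΛli⟩ := exists_linearIndepOn_extension (K := K)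
    (v := fun r => pathElt π (q r).2 • y r) (linearIndepOn_empty K _)
    (Set.empty_subset {r | r ∈ T ∧ IsLongVertex π (e r)})
  have hΛs : ∀ r ∈ Λ, IsSoclePath π (q r) := fun r hr => hq r (hΛT hr).2
  have hstd := fun l a (ha : a ∈ pathSpan π l) r =>
    smul_mem_span_stdSkeleton hπ hadm hJ hinj hy hq ha r
  set U : Set (PathIn e) := {b | b.1 ∈ Λ ∧ b.2 = q b.1} with hU
  have hrad2 : ∀ x ∈ radPow A M 2, x ∈ Submodule.span K (pathVec π y '' U) := by
    intro x hx
    refine Submodule.span_le.2 ?_ (hG 2 x hx)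
    rintro _ ⟨a, ha, r, hr, rfl⟩
    refine Submodule.span_le.2 ?_ (hstd 2 a ha r)
    rintro _ ⟨b, ⟨hb | ⟨hb, hbs⟩, rfl, hb2⟩, rfl⟩
    · omega
    · have h1 := hΛspan ⟨b.1, ⟨hr, hbs.isLongVertex⟩, rfl⟩
      have h2 : pathVec π y b = pathElt π (q b.1).2 • y b.1 := by rw [pathVec, hb]
      rw [h2]
      refine Submodule.span_le.2 ?_ h1
      rintro _ ⟨s, hs, rfl⟩
      exact Submodule.subset_span ⟨⟨s, q s⟩, ⟨hs, rfl⟩, rfl⟩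
  have hsli : LinearIndepOn K ((radPow A M 2).mkQ.restrictScalars K ∘ pathVec π y)
      {b : PathIn e | b.length = 1 ∧ b.1 ∈ Λ} := by
    rw [linearIndepOn_iff']
    intro s c hs hc b hb
    refine eq_zero_of_pathSpan_one_smul_sum hπ hadm hJ hinj hΛs hΛli (fun b hb => hs hb) ?_ hb
    intro a ha
    have h1 : ∑ b ∈ s, c b • pathVec π y b ∈ radPow A M 2 := by
      rw [← Submodule.Quotient.mk_eq_zero, ← Submodule.mkQ_apply, ← hc, map_sum]
      exact Finset.sum_congr rfl fun b _ => LinearMap.map_smul_of_tower _ _ _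
    refine radPow_induction hπ hadm (LinearMap.ker (Algebra.lsmul K K M a)) (fun a' ha' m => ?_) h1
    change a • a' • m = 0
    rw [← mul_smul, pathSpan_mul_eq_zero hπ hadm hJ (by norm_num) ha ha', zero_smul]
  -- All arrows of the trees in `Λ` are independent modulo J^2 M, so a basis of JM/J^2 M can be
  -- chosen to contain them. This makes the long trees full.
  obtain ⟨E, hET, hEs, hEspan, hEli⟩ := exists_linearIndepOn_extension hsli
    (t := {b : PathIn e | b.length = 1 ∧ b.1 ∈ T}) fun b hb => ⟨hb.1, (hΛT hb.2).1⟩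
  set Z : Set (PathIn e) := {b | b.length = 0 ∧ b.1 ∈ T} with hZ
  set σ : Set (PathIn e) := (U ∪ E) ∪ Z with hσ
  have hUlen : ∀ b ∈ U, b.length = 2 := fun b hb => by
    rw [PathIn.length, hb.2]; exact (hΛs _ hb.1).1
  have hlen : ∀ b ∈ σ, b.length ≤ 2 := by
    rintro b ((hb | hb) | hb)
    · exact (hUlen b hb).le
    · exact (hET hb).1.le.trans one_le_two
    · exact hb.1.le.trans zero_le_two
  have habs : IsAbstractSkeleton A σ := by
    constructor
    · rintro b ((hb | hb) | hb)
      · refine length_lt_loewyLength hπ hadm hJ (p := b.2.2) ?_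
        rw [hb.2]; exact (hΛs _ hb.1).2
      · exact length_lt_loewyLength hπ hadm hJ (p := b.2.2)
          (pathElt_ne_zero_of_length_lt_two hadm ((hET hb).1.trans_lt one_lt_two))
      · exact length_lt_loewyLength hπ hadm hJ (p := b.2.2)
          (pathElt_ne_zero_of_length_lt_two hadm (hb.1.trans_lt two_pos))
    · intro r j k p₁ p₂ h
      cases p₂ with
      | nil => exact h
      | cons p α =>
        have hrT : r ∈ T := by
          rcases h with (h | h) | h
          · exact (hΛT h.1).1
          · exact (hET h).2
          · exact h.2
        rcases Nat.eq_zero_or_pos p₁.length with h0 | h0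
        · exact Or.inr ⟨h0, hrT⟩
        · have h2 := hlen _ h
          have h3 : (p₁.comp (p.cons α)).length = p₁.length + p.length + 1 := by
            rw [Quiver.Path.length_comp, Quiver.Path.length_cons, add_assoc]
          have h4 : p₁.length + p.length + 1 ≤ 2 := h3 ▸ h2
          refine Or.inl (Or.inr (hEs ⟨?_, ?_⟩))
          · change p₁.length = 1
            omega
          · rcases h with (h | h) | h
            · exact h.1
            · have : (p₁.comp (p.cons α)).length = 1 := (hET h).1
              omega
            · have : (p₁.comp (p.cons α)).length = 0 := h.1
              omega
  refine ⟨σ, ⟨habs, fun r => ?_⟩, ?_⟩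
  · by_cases hr : r ∈ Λ
    · right
      refine ⟨(loewyLength_projective hπ hadm hJ).2 (hΛT hr).2, fun _ => projTop π (e r), ?_⟩
      have htree : tree σ r = stdSkeleton π (e := fun _ : Unit => e r) (fun _ => q r) := by
        ext ⟨⟨⟩, p⟩
        constructor
        · rintro ((h | h) | h)
          · exact Or.inr ⟨h.2, by
              have : p = q r := h.2
              rw [this]; exact hΛs r hr⟩
          · exact Or.inl ((hET h).1.trans_lt one_lt_two)
          · exact Or.inl (h.1.trans_lt two_pos)
        · rintro (h | ⟨h, _⟩)
          · have h' : p.2.length < 2 := h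
            rcases Nat.eq_zero_or_pos p.2.length with h0 | h0
            · exact Or.inr ⟨h0, (hΛT hr).1⟩
            · exact Or.inl (Or.inr (hEs ⟨by change p.2.length = 1; omega, hr⟩))
          · exact Or.inl (Or.inl ⟨hr, h⟩)
      rw [htree]
      exact isSkeletonRelative_projTop hπ hadm hJ hinj fun _ => hΛs r hr
    · left
      rintro ⟨⟨⟩, p⟩ ((h | h) | h)
      · exact absurd h.1 hr
      · exact (hET h).1.le
      · exact h.1.le.trans zero_le_one
  · have hrad : ∀ l, ∀ x ∈ radPow A M l,
        x ∈ Submodule.span K (pathVec π y '' {b | b ∈ σ ∧ l ≤ b.length}) := by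
      have h2 : ∀ l, l ≤ 2 → ∀ x ∈ radPow A M 2,
          x ∈ Submodule.span K (pathVec π y '' {b | b ∈ σ ∧ l ≤ b.length}) := fun l hl x hx =>
        Submodule.span_mono (Set.image_mono (show U ⊆ {b | b ∈ σ ∧ l ≤ b.length} from fun b hb =>
          ⟨Or.inl (Or.inl hb), hl.trans_eq (hUlen b hb).symm⟩)) (hrad2 x hx)
      have h1 : ∀ l, l ≤ 1 → ∀ x ∈ radPow A M 1,
          x ∈ Submodule.span K (pathVec π y '' {b | b ∈ σ ∧ l ≤ b.length}) := by
        intro l hl x hx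
        refine Submodule.span_le.2 ?_ (hG 1 x hx)
        rintro _ ⟨a, ha, r, hr, rfl⟩
        refine Submodule.span_le.2 ?_ (hstd 1 a ha r)
        rintro _ ⟨b, ⟨-, rfl, hb⟩, rfl⟩
        rcases hb.eq_or_lt with hb1 | hb2
        · obtain ⟨u, hu, hbu⟩ := exists_mem_span_sub_mem _ (hEspan ⟨b, ⟨hb1.symm, hr⟩, rfl⟩)
          have hEσ : E ⊆ {b | b ∈ σ ∧ l ≤ b.length} := fun b hb =>
            ⟨Or.inl (Or.inr hb), hl.trans_eq (hET hb).1.symm⟩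
          have h3 := Submodule.add_mem _ (Submodule.span_mono (Set.image_mono hEσ) hu)
            (h2 l (by omega) _ hbu)
          rwa [add_sub_cancel] at h3
        · exact h2 l (by omega) _ (pathVec_mem_radPow hπ hadm y hb2)
      intro l x hx
      match l, hx with
      | 0, hx =>
        refine Submodule.span_le.2 ?_ (hG 0 x hx)
        rintro _ ⟨a, ha, r, hr, rfl⟩
        refine Submodule.span_le.2 ?_ (hstd 0 a ha r)
        rintro _ ⟨b, ⟨-, rfl, -⟩, rfl⟩
        rcases Nat.eq_zero_or_pos b.length with h0 | h0
        · exact Submodule.subset_span ⟨b, ⟨Or.inr ⟨h0, hr⟩, Nat.zero_le _⟩, rfl⟩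
        · exact h1 0 zero_le_one _ (pathVec_mem_radPow hπ hadm y h0)
      | 1, hx => exact h1 1 le_rfl x hx
      | 2, hx => exact h2 2 le_rfl x hx
      | l + 3, hx =>
        rw [radPow_eq_bot hπ hadm hJ (by omega) hx]
        exact Submodule.zero_mem _
    refine isSkeletonRelative_of_radPow_le hπ hadm (finite_pathIn_of_length_le hlen) habs hy ?_ hrad
    have hUli : LinearIndepOn K (pathVec π y) U := by
      have h1 := LinearIndependent.comp hΛli (fun b : U => ⟨b.1.1, b.2.1⟩) (by
        rintro ⟨⟨r, p⟩, h, hp⟩ ⟨⟨r', p'⟩, h', hp'⟩ heq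
        obtain rfl : r = r' := congrArg Subtype.val heq
        obtain rfl : p = q r := hp
        obtain rfl : p' = q r := hp'
        rfl)
      have h2 : (fun b : U => pathVec π y b.1) =
          (fun x : Λ => pathElt π (q x.1).2 • y x.1) ∘ fun b : U => ⟨b.1.1, b.2.1⟩ := by
        funext b
        rw [pathVec, b.2.2]
        rfl
      rw [LinearIndepOn, h2]
      exact h1
    -- Independence is triangular: `U` dies modulo J^2 M, where `E` is independent, and both die
    -- modulo JM, where the tops are independent.
    refine (hUli.union_of_comp (g := (radPow A M 2).mkQ.restrictScalars K) ?_ hEli).union_of_comp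
      (g := (radPow A M 1).mkQ.restrictScalars K) ?_ ?_
    · intro b hb
      exact (Submodule.Quotient.mk_eq_zero _).2 (pathVec_mem_radPow hπ hadm y (hUlen b hb).ge)
    · rintro b (hb | hb)
      · exact (Submodule.Quotient.mk_eq_zero _).2 (pathVec_mem_radPow hπ hadm y
          (one_le_two.trans_eq (hUlen b hb).symm))
      · exact (Submodule.Quotient.mk_eq_zero _).2 (pathVec_mem_radPow hπ hadm y (hET hb).1.ge)
    · have h1 := LinearIndependent.comp hTli (fun b : Z => ⟨b.1.1, b.2.2⟩) (by
        rintro ⟨b, h, hb⟩ ⟨b', h', hb'⟩ heq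
        have h1 : b.1 = b'.1 := congrArg Subtype.val heq
        rw [Subtype.mk.injEq, PathIn.eq_top_of_length_eq_zero h,
          PathIn.eq_top_of_length_eq_zero h', h1])
      have h2 : (fun b : Z => ((radPow A M 1).mkQ.restrictScalars K ∘ pathVec π y) b.1) =
          (fun x : T => ((radPow A M 1).mkQ.restrictScalars K ∘ y) x.1) ∘
            fun b : Z => ⟨b.1.1, b.2.2⟩ := by
        funext b
        have h3 : pathVec π y b.1 = y b.1.1 := by
          conv_lhs => rw [PathIn.eq_top_of_length_eq_zero b.2.1, pathVec_top hy]
        simp only [Function.comp, h3]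
      rw [LinearIndepOn, h2]
      exact h1

end ExistenceOfSkeleta

/-! ### The projective module P, its homomorphisms and its standard basis. -/

section ProjectiveModules

open scoped Classical

variable {K : Type*} {Q : Type*} {A : Type*} [Field K] [Quiver Q] [Fintype Q] [Ring A] [Algebra K A]
variable {π : PathAlgebra K Q →ₐ[K] A} {ι : Type*} {e : ι → Q}

theorem topElt_eq_single (r : ι) : topElt π e r = Pi.single r (projTop π (e r)) := rfl

theorem vertexElt_smul_topElt (r : ι) : vertexElt π (e r) • topElt π e r = topElt π e r := by
  rw [topElt_eq_single, ← Pi.single_smul, vertexElt_smul_projTop]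

theorem vertexElt_smul_topElt_of_eq {v : Q} {r : ι} (h : v = e r) :
    vertexElt π v • topElt π e r = topElt π e r := by
  rw [h, vertexElt_smul_topElt]

variable {M : Type*} [AddCommGroup M] [Module A M] [Fintype ι]

/-- The homomorphism from `⨁ A z_r` to `M` which sends `z_r` to `e_(e r) y r`. -/
noncomputable def projHom (π : PathAlgebra K Q →ₐ[K] A) (e : ι → Q) (y : ι → M) :
    Proj π e →ₗ[A] M :=
  ∑ r, LinearMap.toSpanSingleton A M (y r) ∘ₗ Submodule.subtype _ ∘ₗ LinearMap.proj r

theorem projHom_apply (y : ι → M) (x : Proj π e) : projHom π e y x = ∑ r, (x r : A) • y r := by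
  simp [projHom]

theorem projHom_topElt {y : ι → M} {r : ι} (hy : vertexElt π (e r) • y r = y r) :
    projHom π e y (topElt π e r) = y r := by
  rw [projHom_apply, Finset.sum_eq_single r]
  · rw [topElt_eq_single, Pi.single_eq_same]
    exact hy
  · intro s _ hs
    rw [topElt_eq_single, Pi.single_eq_of_ne hs]
    exact zero_smul _ _
  · exact fun h => absurd (Finset.mem_univ _) h

theorem sum_smul_topElt (x : Proj π e) : ∑ r, (x r : A) • topElt π e r = x := by
  have h : ∀ r, (x r : A) • topElt π e r = Pi.single r (x r) := fun r => by
    rw [topElt_eq_single, ← Pi.single_smul, coe_smul_projTop]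
  rw [Finset.sum_congr rfl fun r _ => h r, Finset.univ_sum_single]

omit [Fintype ι] in
theorem map_pathVec {N : Type*} [AddCommGroup N] [Module A N] (f : M →ₗ[A] N) (y : ι → M)
    (b : PathIn e) : f (pathVec π y b) = pathVec π (fun r => f (y r)) b :=
  map_smul _ _ _

omit [Fintype ι] in
theorem linearIndepOn_stdSkeleton (hadm : PathAlgebra.IsAdmissible (RingHom.ker π))
    (q : ∀ r : ι, Σ j, Quiver.Path (e r) j) :
    LinearIndepOn K (pathVec π (topElt π e)) (stdSkeleton π q) := by
  let s : ∀ r : ι, Set (Σ j, Quiver.Path (e r) j) := fun r =>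
    {p | p.2.length < 2 ∨ p = q r ∧ IsSoclePath π p}
  let f : ∀ r : ι, s r → Ideal.span {vertexElt π (e r)} := fun r p =>
    ⟨pathElt π p.1.2, mem_span_vertexElt_iff.2 (pathElt_mul_vertexElt π _)⟩
  have hf : ∀ r, LinearIndependent K (f r) := fun r =>
    LinearIndependent.of_comp ((Ideal.span {vertexElt π (e r)}).subtype.restrictScalars K)
      (linearIndepOn_pathElt hadm (q r))
  have h := (Pi.linearIndependent_single f hf).comp
    (fun b : stdSkeleton π q => (⟨b.1.1, b.1.2, b.2⟩ : Σ r, s r)) (by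
      rintro ⟨⟨r, p⟩, h⟩ ⟨⟨r', p'⟩, h'⟩ heq
      obtain rfl : r = r' := congrArg Sigma.fst heq
      simpa [Subtype.ext_iff] using heq)
  have h1 : (fun b : stdSkeleton π q => pathVec π (topElt π e) b.1) =
      (fun ji : Σ r, s r => (Pi.single ji.1 (f ji.1 ji.2) : Proj π e)) ∘
        fun b : stdSkeleton π q => ⟨b.1.1, b.1.2, b.2⟩ := by
    funext b
    rw [pathVec, topElt_eq_single, ← Pi.single_smul]
    exact congrArg (Pi.single b.1.1) (coe_smul_projTop (f b.1.1 ⟨b.1.2, b.2⟩))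
  rw [LinearIndepOn, h1]
  exact h

theorem span_stdSkeleton (hπ : Function.Surjective π)
    (hadm : PathAlgebra.IsAdmissible (RingHom.ker π)) (hJ : Ring.jacobson A ^ 3 = ⊥)
    (hinj : Module.Injective A A) {q : ∀ r : ι, Σ j, Quiver.Path (e r) j}
    (hq : ∀ r, IsLongVertex π (e r) → IsSoclePath π (q r)) :
    Submodule.span K (pathVec π (topElt π e) '' stdSkeleton π q) = ⊤ := by
  rw [eq_top_iff]
  rintro x -
  rw [← sum_smul_topElt x]
  refine Submodule.sum_mem _ fun r _ => ?_
  exact Submodule.span_mono (Set.image_mono fun b hb => hb.1) (smul_mem_span_stdSkeleton hπ hadm hJ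
    hinj vertexElt_smul_topElt hq (pathSpan_zero hπ (x r : A)) r)

/-- The `K`-basis of `⨁ A z_r` given by a standard skeleton. -/
noncomputable def stdBasis (hπ : Function.Surjective π)
    (hadm : PathAlgebra.IsAdmissible (RingHom.ker π)) (hJ : Ring.jacobson A ^ 3 = ⊥)
    (hinj : Module.Injective A A) {q : ∀ r : ι, Σ j, Quiver.Path (e r) j}
    (hq : ∀ r, IsLongVertex π (e r) → IsSoclePath π (q r)) :
    Module.Basis (stdSkeleton π q) K (Proj π e) :=
  Module.Basis.mk (v := fun b : stdSkeleton π q => pathVec π (topElt π e) b.1)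
    (linearIndepOn_stdSkeleton hadm q) (by
      rw [← Set.image_eq_range, span_stdSkeleton hπ hadm hJ hinj hq])

theorem stdBasis_apply (hπ : Function.Surjective π)
    (hadm : PathAlgebra.IsAdmissible (RingHom.ker π)) (hJ : Ring.jacobson A ^ 3 = ⊥)
    (hinj : Module.Injective A A) {q : ∀ r : ι, Σ j, Quiver.Path (e r) j}
    (hq : ∀ r, IsLongVertex π (e r) → IsSoclePath π (q r)) (b : stdSkeleton π q) :
    stdBasis hπ hadm hJ hinj hq b = pathVec π (topElt π e) b.1 :=
  Module.Basis.mk_apply _ _ b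

end ProjectiveModules

/-! ### Closure properties of polynomial families of vectors and linear maps. -/

section PolynomialFamilies

variable {K τ V W : Type*} [Field K] [AddCommGroup V] [Module K V] [AddCommGroup W] [Module K W]

theorem IsPolyMap.const (v : V) : IsPolyMap fun _ : τ → K => v := fun _ => const_mem_polyFun _

theorem IsPolyMap.add {f g : (τ → K) → V} (hf : IsPolyMap f) (hg : IsPolyMap g) :
    IsPolyMap fun t => f t + g t := fun φ => by
  simp only [map_add]
  exact add_mem (hf φ) (hg φ)

theorem IsPolyMap.sum {κ : Type*} (s : Finset κ) {f : κ → (τ → K) → V}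
    (hf : ∀ i ∈ s, IsPolyMap (f i)) : IsPolyMap fun t => ∑ i ∈ s, f i t := fun φ => by
  simp only [map_sum]
  exact sum_mem_polyFun s fun i hi => hf i hi φ

theorem IsPolyMap.smul {c : (τ → K) → K} {f : (τ → K) → V} (hc : c ∈ polyFun K τ)
    (hf : IsPolyMap f) : IsPolyMap fun t => c t • f t := fun φ => by
  simp only [map_smul, smul_eq_mul]
  exact mul_mem_polyFun hc (hf φ)

theorem IsPolyMap.map (L : V →ₗ[K] W) {f : (τ → K) → V} (hf : IsPolyMap f) :
    IsPolyMap fun t => L (f t) := fun φ => hf (φ ∘ₗ L)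

theorem IsPolyMap.apply {β : Type*} [Fintype β] (B : Module.Basis β K V)
    {F : (τ → K) → V →ₗ[K] W} (hF : ∀ v, IsPolyMap fun t => F t v) {f : (τ → K) → V}
    (hf : IsPolyMap f) : IsPolyMap fun t => F t (f t) := by
  have h : (fun t => F t (f t)) = fun t => ∑ b, B.coord b (f t) • F t (B b) := by
    funext t
    conv_lhs => rw [← B.sum_repr (f t), map_sum]
    simp only [map_smul, Module.Basis.coord_apply]
  rw [h]
  exact IsPolyMap.sum _ fun b _ => IsPolyMap.smul (hf _) (hF _)

end PolynomialFamilies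

/-! ### Shears, substitution of missing tops, and the unconstrained projection on arrows. -/

section Projections

open scoped Classical

variable {K : Type*} {Q : Type*} {A : Type*} [Field K] [Quiver Q] [Fintype Q] [Ring A] [Algebra K A]
variable (π : PathAlgebra K Q →ₐ[K] A) {ι : Type*} {e : ι → Q}

/-- Skeleta contained in a standard skeleton of `⨁ A z_r` whose trees with a path of length `2`
are full. -/
structure IsStdSubskeleton (s : Finset (PathIn e)) (q : ∀ r : ι, Σ j, Quiver.Path (e r) j) :
    Prop where
  socle : ∀ r, IsLongVertex π (e r) → IsSoclePath π (q r)
  subset : ∀ b ∈ s, b ∈ stdSkeleton π q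
  full : ∀ b ∈ s, b.length = 2 → ∀ b' : PathIn e, b'.1 = b.1 → b'.length < 2 → b' ∈ s
  top_mem : ∀ b ∈ s, PathIn.top b.1 ∈ s
  isAbstractSkeleton : IsAbstractSkeleton A (s : Set (PathIn e))

/-- The trees of `s` which contain a path of length `2`. -/
def longTrees (s : Finset (PathIn e)) : Set ι := {r | ∃ b ∈ s, b.1 = r ∧ b.length = 2}

/-- The span in `⨁ A z_r` of the paths in `s` of length at least `l`. -/
noncomputable def levelSpan (s : Finset (PathIn e)) (l : ℕ) : Submodule K (Proj π e) :=
  Submodule.span K (pathVec π (topElt π e) '' {b | b ∈ s ∧ l ≤ b.length})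

/-- The matrix positions of the independent coordinates on the submodules `C` for which `s` is a
distinguished skeleton of the quotient by `C`. -/
def IsFreePosition (s : Finset (PathIn e)) (q : ∀ r : ι, Σ j, Quiver.Path (e r) j)
    (k b : PathIn e) : Prop :=
  k ∈ stdSkeleton π q ∧ k ∉ s ∧ b ∈ s ∧ k.endpoint = b.endpoint ∧
    (k.length = 0 ∨ PathIn.top k.1 ∈ s ∧ (k.length = 2 ∧ b.length = 2 ∨
      k.length = 1 ∧ (b.length = 2 ∨ b.length = 1 ∧ b.1 ∉ longTrees s)))

variable {π} {s : Finset (PathIn e)} {q : ∀ r : ι, Σ j, Quiver.Path (e r) j}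

omit [Fintype Q] in
theorem PathIn.eq_mk_of_snd_eq {b : PathIn e} (h : b.2 = q b.1) : b = ⟨b.1, q b.1⟩ := by
  rw [← h]

theorem length_le_two_of_mem_stdSkeleton {b : PathIn e} (h : b ∈ stdSkeleton π q) :
    b.length ≤ 2 := by
  rcases h with h | ⟨_, h⟩
  · exact Nat.le_of_lt h
  · exact h.1.le

theorem eq_of_mem_stdSkeleton {b : PathIn e} (h : b ∈ stdSkeleton π q) (h2 : 2 ≤ b.length) :
    b = ⟨b.1, q b.1⟩ ∧ IsSoclePath π (q b.1) := by
  rcases h with h | ⟨h, hs⟩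
  · omega
  · exact ⟨PathIn.eq_mk_of_snd_eq h, h ▸ hs⟩

/-- Fullness supplies the paths of length at most 1, and a standard skeleton has only one path of
length 2 in each tree. -/
theorem IsStdSubskeleton.mem_of_mem_longTrees (hs : IsStdSubskeleton π s q) {b : PathIn e}
    (hb : b ∈ stdSkeleton π q) (h : b.1 ∈ longTrees s) : b ∈ s := by
  obtain ⟨b₀, hb₀, h1, h2⟩ := h
  rcases Nat.lt_or_ge b.length 2 with h | h
  · exact hs.full b₀ hb₀ h2 b h1.symm h
  · have h3 := (eq_of_mem_stdSkeleton (hs.subset b₀ hb₀) h2.ge).1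
    rw [h1, ← (eq_of_mem_stdSkeleton hb h).1] at h3
    rwa [← h3]

theorem IsStdSubskeleton.top_mem_of_mem_longTrees (hs : IsStdSubskeleton π s q) {r : ι}
    (h : r ∈ longTrees s) : PathIn.top r ∈ s :=
  hs.mem_of_mem_longTrees (Or.inl two_pos) h

theorem IsStdSubskeleton.mem_longTrees (hs : IsStdSubskeleton π s q) {b : PathIn e} (hb : b ∈ s)
    (h : 2 ≤ b.length) : b.1 ∈ longTrees s :=
  ⟨b, hb, rfl, le_antisymm (length_le_two_of_mem_stdSkeleton (hs.subset b hb)) h⟩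

theorem pathVec_mem_levelSpan {b : PathIn e} (hb : b ∈ s) {l : ℕ} (h : l ≤ b.length) :
    pathVec π (topElt π e) b ∈ levelSpan π s l := Submodule.subset_span ⟨b, ⟨hb, h⟩, rfl⟩

variable [Fintype ι]

variable (π e) in
/-- The homomorphism `z_r ↦ z_r + ∑ t, W r t z_t`. -/
noncomputable def shear (W : ι → ι → K) : Proj π e →ₗ[A] Proj π e :=
  projHom π e fun r => topElt π e r + ∑ t, W r t • topElt π e t

/-- The condition on `W` for the shear to modify only the short trees of `s`, by combinations of
long trees. -/
def IsShearMatrix (s : Finset (PathIn e)) (W : ι → ι → K) : Prop :=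
  ∀ r t, W r t ≠ 0 → r ∉ longTrees s ∧ t ∈ longTrees s ∧ e r = e t

omit [Fintype Q] [Fintype ι] in
theorem IsShearMatrix.neg {W : ι → ι → K} (hW : IsShearMatrix s W) :
    IsShearMatrix s fun r t => -W r t :=
  fun r t h => hW r t (neg_ne_zero.1 h)

theorem shear_topElt {W : ι → ι → K} (hW : IsShearMatrix s W) (r : ι) :
    shear π e W (topElt π e r) = topElt π e r + ∑ t, W r t • topElt π e t := by
  refine projHom_topElt (y := fun r => topElt π e r + ∑ t, W r t • topElt π e t) ?_
  rw [smul_add, vertexElt_smul_topElt, Finset.smul_sum]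
  congr 1
  refine Finset.sum_congr rfl fun t _ => ?_
  rw [smul_comm_algebra]
  by_cases h : W r t = 0
  · rw [h, zero_smul, zero_smul]
  · rw [vertexElt_smul_topElt_of_eq (hW r t h).2.2]

theorem shear_smul_topElt {W : ι → ι → K} (hW : IsShearMatrix s W) (a : A) (r : ι) :
    shear π e W (a • topElt π e r) = a • topElt π e r + ∑ t, W r t • a • topElt π e t := by
  rw [map_smul, shear_topElt hW, smul_add, Finset.smul_sum]
  simp only [smul_comm_algebra]

theorem shear_smul_topElt_of_mem {W : ι → ι → K} (hW : IsShearMatrix s W) (a : A) {r : ι}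
    (hr : r ∈ longTrees s) : shear π e W (a • topElt π e r) = a • topElt π e r := by
  rw [shear_smul_topElt hW, Finset.sum_eq_zero, add_zero]
  intro t _
  by_cases h : W r t = 0
  · rw [h, zero_smul]
  · exact absurd hr (hW r t h).1

/-- The matrix sends short trees to long ones and vanishes on long trees, so its square is zero. -/
theorem shear_neg_shear {W : ι → ι → K} (hW : IsShearMatrix s W) (x : Proj π e) :
    shear π e (fun r t => -W r t) (shear π e W x) = x := by
  have h : ∀ r, shear π e (fun r t => -W r t) (shear π e W (topElt π e r)) = topElt π e r := by
    intro r
    rw [shear_topElt hW, map_add, shear_topElt hW.neg, map_sum, add_assoc, add_eq_left,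
      ← Finset.sum_add_distrib]
    refine Finset.sum_eq_zero fun t _ => ?_
    rw [LinearMap.map_smul_of_tower]
    by_cases h : W r t = 0
    · simp [h]
    · have := shear_smul_topElt_of_mem (π := π) hW.neg 1 (hW r t h).2.1
      rw [one_smul] at this
      rw [this, neg_smul, neg_add_cancel]
  conv_lhs => rw [← sum_smul_topElt x]
  simp only [map_sum, map_smul, h]
  exact sum_smul_topElt x

theorem shear_shear_neg {W : ι → ι → K} (hW : IsShearMatrix s W) (x : Proj π e) :
    shear π e W (shear π e (fun r t => -W r t) x) = x := by
  have := shear_neg_shear hW.neg x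
  simpa using this

variable (π) in
/-- The homomorphism which replaces the elements `z_r ∉ s` by combinations of the paths in `s`. -/
noncomputable def topMap (s : Finset (PathIn e)) (c : PathIn e → PathIn e → K) :
    Proj π e →ₗ[A] Proj π e :=
  projHom π e fun r => if PathIn.top r ∈ s then topElt π e r
    else ∑ b ∈ s, c (PathIn.top r) b • pathVec π (topElt π e) b

theorem topMap_topElt_of_mem (c : PathIn e → PathIn e → K) {r : ι}
    (hr : PathIn.top r ∈ s) : topMap π s c (topElt π e r) = topElt π e r := by
  rw [topMap, projHom_topElt]
  · rw [if_pos hr]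
  · rw [if_pos hr, vertexElt_smul_topElt]

theorem topMap_topElt_of_notMem {c : PathIn e → PathIn e → K}
    (hc : ∀ k b, c k b ≠ 0 → IsFreePosition π s q k b) {r : ι} (hr : PathIn.top r ∉ s) :
    topMap π s c (topElt π e r) =
      ∑ b ∈ s, c (PathIn.top r) b • pathVec π (topElt π e) b := by
  rw [topMap, projHom_topElt]
  · rw [if_neg hr]
  · rw [if_neg hr, Finset.smul_sum]
    refine Finset.sum_congr rfl fun b _ => ?_
    rw [smul_comm_algebra]
    by_cases h : c (PathIn.top r) b = 0
    · rw [h, zero_smul, zero_smul]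
    · have h1 : e r = b.endpoint := (hc _ _ h).2.2.2.1
      rw [h1, vertexElt_smul_pathVec]

variable (hπ : Function.Surjective π) (hadm : PathAlgebra.IsAdmissible (RingHom.ker π))
variable (hJ : Ring.jacobson A ^ 3 = ⊥) (hinj : Module.Injective A A)

/-- The linear map which is the identity on `s`, and sends the arrows which are not in `s` to
combinations of the paths in `s`. -/
noncomputable def arrowMap (B : Module.Basis (stdSkeleton π q) K (Proj π e))
    (s : Finset (PathIn e)) (c : PathIn e → PathIn e → K) : Proj π e →ₗ[K] Proj π e :=
  B.constr K fun k => if k.1 ∈ s then pathVec π (topElt π e) k.1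
    else if PathIn.top k.1.1 ∈ s ∧ k.1.length = 1 then
      ∑ b ∈ s, c k.1 b • pathVec π (topElt π e) b else 0

variable {B : Module.Basis (stdSkeleton π q) K (Proj π e)}
  (hB : ∀ b, B b = pathVec π (topElt π e) b.1) {c : PathIn e → PathIn e → K}

omit [Fintype ι] in
include hB in
theorem arrowMap_pathVec (c : PathIn e → PathIn e → K) {k : PathIn e} (hk : k ∈ stdSkeleton π q) :
    arrowMap B s c (pathVec π (topElt π e) k) = if k ∈ s then pathVec π (topElt π e) k
    else if PathIn.top k.1 ∈ s ∧ k.length = 1 then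
      ∑ b ∈ s, c k b • pathVec π (topElt π e) b else 0 := by
  have := B.constr_basis K (fun k => if k.1 ∈ s then pathVec π (topElt π e) k.1
    else if PathIn.top k.1.1 ∈ s ∧ k.1.length = 1 then
      ∑ b ∈ s, c k.1 b • pathVec π (topElt π e) b else 0) ⟨k, hk⟩
  rw [hB] at this
  exact this

variable (hs : IsStdSubskeleton π s q)
include hs

omit [Fintype ι] in
include hB in
theorem arrowMap_of_mem_levelSpan {x : Proj π e} (hx : x ∈ levelSpan π s 0) :
    arrowMap B s c x = x := by
  induction hx using Submodule.span_induction with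
  | zero => exact map_zero _
  | add u v _ _ hu hv => rw [map_add, hu, hv]
  | smul a u _ hu => rw [map_smul, hu]
  | mem x hx =>
    obtain ⟨b, ⟨hb, _⟩, rfl⟩ := hx
    rw [arrowMap_pathVec hB _ (hs.subset b hb), if_pos hb]

omit [Fintype ι] hs in
include hB in
theorem arrowMap_mem_levelSpan (x : Proj π e) : arrowMap B s c x ∈ levelSpan π s 0 := by
  rw [← B.linearCombination_repr x, Finsupp.linearCombination_apply, Finsupp.sum, map_sum]
  refine Submodule.sum_mem _ fun k _ => ?_
  rw [map_smul, hB, arrowMap_pathVec hB _ k.2]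
  refine Submodule.smul_mem _ _ ?_
  split_ifs with h1 h2
  · exact pathVec_mem_levelSpan h1 (Nat.zero_le _)
  · exact Submodule.sum_mem _ fun b hb => Submodule.smul_mem _ _
      (pathVec_mem_levelSpan hb (Nat.zero_le _))
  · exact Submodule.zero_mem _

include hπ hadm hJ hinj

omit [Fintype ι] in
theorem smul_topElt_mem_levelSpan {l : ℕ} {a : A} (ha : a ∈ pathSpan π l) {r : ι}
    (hr : r ∈ longTrees s) : a • topElt π e r ∈ levelSpan π s l := by
  refine Submodule.span_mono (Set.image_mono ?_) (smul_mem_span_stdSkeleton hπ hadm hJ hinj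
    vertexElt_smul_topElt hs.socle ha r)
  rintro b ⟨hb, rfl, hl⟩
  exact ⟨hs.mem_of_mem_longTrees hb hr, hl⟩

/-- The correction terms lie in long trees, and a long tree contains a spanning set of J^l z_t for
every `l`. -/
theorem shear_mem_levelSpan {W : ι → ι → K} (hW : IsShearMatrix s W) {l : ℕ} {x : Proj π e}
    (hx : x ∈ levelSpan π s l) : shear π e W x ∈ levelSpan π s l := by
  have hle : levelSpan π s l ≤ (levelSpan π s l).comap ((shear π e W).restrictScalars K) := by
    rw [levelSpan, Submodule.span_le]
    rintro _ ⟨b, ⟨hb, hl⟩, rfl⟩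
    change shear π e W (pathVec π (topElt π e) b) ∈ levelSpan π s l
    rw [pathVec, shear_smul_topElt hW]
    refine Submodule.add_mem _ (pathVec_mem_levelSpan hb hl) (Submodule.sum_mem _ fun t _ => ?_)
    by_cases h : W b.1 t = 0
    · rw [h, zero_smul]; exact Submodule.zero_mem _
    · exact Submodule.smul_mem _ _ (smul_topElt_mem_levelSpan hπ hadm hJ hinj hs
        (pathElt_mem_pathSpan hl) (hW _ _ h).2.1)
  exact hle hx

include hB

omit [Fintype ι] in
-- Here J^2 z_r is spanned by standard paths of length 2 outside `s`, on which `arrowMap` is zero by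
-- definition.
theorem arrowMap_smul_topElt_of_notMem_longTrees {a : A} (ha : a ∈ pathSpan π 2) {r : ι}
    (hr : r ∉ longTrees s) : arrowMap B s c (a • topElt π e r) = 0 := by
  have h := smul_mem_span_stdSkeleton hπ hadm hJ hinj vertexElt_smul_topElt hs.socle ha r
  refine (Submodule.span_le (p := LinearMap.ker (arrowMap B s c))).2 ?_ h
  rintro _ ⟨b, ⟨hb, rfl, hl⟩, rfl⟩
  rw [SetLike.mem_coe, LinearMap.mem_ker, arrowMap_pathVec hB _ hb,
    if_neg fun h => hr (hs.mem_longTrees h hl), if_neg fun h => by omega]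

omit [Fintype ι] in
theorem arrowMap_smul_topElt_of_notMem (a : A) {r : ι} (hr : PathIn.top r ∉ s) :
    arrowMap B s c (a • topElt π e r) = 0 := by
  have h := smul_mem_span_stdSkeleton hπ hadm hJ hinj vertexElt_smul_topElt hs.socle
    (pathSpan_zero hπ a) r
  refine (Submodule.span_le (p := LinearMap.ker (arrowMap B s c))).2 ?_ h
  rintro _ ⟨b, ⟨hb, rfl, -⟩, rfl⟩
  rw [SetLike.mem_coe, LinearMap.mem_ker, arrowMap_pathVec hB _ hb,
    if_neg fun h => hr (hs.top_mem b h), if_neg fun h => hr h.1]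

omit [Fintype ι] in
theorem arrowMap_smul_topElt_mem_levelSpan (hc : ∀ k b, c k b ≠ 0 → IsFreePosition π s q k b)
    {l : ℕ} {a : A} (ha : a ∈ pathSpan π l) (r : ι) :
    arrowMap B s c (a • topElt π e r) ∈ levelSpan π s l := by
  have h := smul_mem_span_stdSkeleton hπ hadm hJ hinj vertexElt_smul_topElt hs.socle ha r
  refine (Submodule.span_le (p := (levelSpan π s l).comap (arrowMap B s c))).2 ?_ h
  rintro _ ⟨k, ⟨hk, rfl, hl⟩, rfl⟩
  rw [SetLike.mem_coe, Submodule.mem_comap, arrowMap_pathVec hB _ hk]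
  split_ifs with h1 h2
  · exact pathVec_mem_levelSpan h1 hl
  · refine Submodule.sum_mem _ fun b hb => ?_
    by_cases h0 : c k b = 0
    · rw [h0, zero_smul]; exact Submodule.zero_mem _
    · refine Submodule.smul_mem _ _ (pathVec_mem_levelSpan hb ?_)
      obtain ⟨-, -, -, -, h | ⟨-, h | h⟩⟩ := hc k b h0 <;> omega
  · exact Submodule.zero_mem _

/-- The kernel of `arrowMap` is a submodule over `A`. -/
theorem arrowMap_smul_arrowMap (hc : ∀ k b, c k b ≠ 0 → IsFreePosition π s q k b) (a : A)
    (x : Proj π e) : arrowMap B s c (a • arrowMap B s c x) = arrowMap B s c (a • x) := by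
  have hpath : ∀ {i j : Q} (p : Quiver.Path i j) {k : PathIn e}, k ∈ stdSkeleton π q →
      arrowMap B s c (pathElt π p • arrowMap B s c (pathVec π (topElt π e) k)) =
        arrowMap B s c (pathElt π p • pathVec π (topElt π e) k) := by
    intro i j p k hk
    rw [arrowMap_pathVec hB _ hk]
    by_cases h1 : k ∈ s
    · rw [if_pos h1]
    have hlong : k.1 ∉ longTrees s := fun h => h1 (hs.mem_of_mem_longTrees hk h)
    rw [if_neg h1]
    by_cases h2 : PathIn.top k.1 ∈ s ∧ k.length = 1
    · rw [if_pos h2]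
      cases p with
      | nil =>
        change arrowMap B s c (vertexElt π i • _) = arrowMap B s c (vertexElt π i • _)
        by_cases hi : k.endpoint = i
        · subst hi
          rw [vertexElt_smul_pathVec, Finset.smul_sum, arrowMap_pathVec hB _ hk, if_neg h1,
            if_pos h2]
          have : ∀ b ∈ s, vertexElt π k.endpoint • c k b • pathVec π (topElt π e) b =
              c k b • pathVec π (topElt π e) b := by
            intro b _
            rw [smul_comm_algebra]
            by_cases h0 : c k b = 0
            · rw [h0, zero_smul, zero_smul]
            · rw [(hc k b h0).2.2.2.1, vertexElt_smul_pathVec]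
          rw [Finset.sum_congr rfl this]
          exact arrowMap_of_mem_levelSpan hB hs (Submodule.sum_mem _ fun b hb =>
            Submodule.smul_mem _ _ (pathVec_mem_levelSpan hb (Nat.zero_le _)))
        · rw [vertexElt_smul_pathVec_of_ne _ hi, Finset.smul_sum, Finset.sum_eq_zero]
          intro b _
          rw [smul_comm_algebra]
          by_cases h0 : c k b = 0
          · rw [h0, zero_smul]
          · rw [vertexElt_smul_pathVec_of_ne _ ((hc k b h0).2.2.2.1 ▸ hi), smul_zero]
      | cons p α =>
        have hp : pathElt π (p.cons α) ∈ pathSpan π 1 := pathElt_mem_pathSpan (by simp)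
        have hr : arrowMap B s c (pathElt π (p.cons α) • pathVec π (topElt π e) k) = 0 := by
          rw [pathVec, ← mul_smul]
          exact arrowMap_smul_topElt_of_notMem_longTrees hπ hadm hJ hinj hB hs
            (mul_mem_pathSpan (l := 1) (m := 1) hp (pathElt_mem_pathSpan h2.2.ge)) hlong
        rw [hr, Finset.smul_sum, map_sum]
        refine Finset.sum_eq_zero fun b hb => ?_
        rw [smul_comm_algebra, map_smul]
        by_cases h0 : c k b = 0
        · rw [h0, zero_smul]
        · rw [pathVec, ← mul_smul]
          -- A missing arrow may involve only paths of length 2, annihilated by J, and arrows of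
          -- short trees, whose multiples by J are sent to zero. This is why arrows of long trees
          -- are excluded from the free positions.
          obtain ⟨-, -, -, -, h | ⟨-, h | ⟨-, h | ⟨h, hb1⟩⟩⟩⟩ := hc k b h0
          · omega
          · omega
          · rw [pathSpan_mul_eq_zero hπ hadm hJ (l := 1) (m := 2) (by norm_num) hp
              (pathElt_mem_pathSpan (p := b.2.2) h.ge), zero_smul, map_zero, smul_zero]
          · rw [arrowMap_smul_topElt_of_notMem_longTrees hπ hadm hJ hinj hB hs
              (mul_mem_pathSpan (l := 1) (m := 1) hp (pathElt_mem_pathSpan (p := b.2.2) h.ge)) hb1,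
              smul_zero]
    · rw [if_neg h2, smul_zero, map_zero, pathVec, ← mul_smul]
      by_cases h3 : PathIn.top k.1 ∈ s
      · refine (arrowMap_smul_topElt_of_notMem_longTrees hπ hadm hJ hinj hB hs
          (mul_mem_pathSpan_right hπ _ (pathElt_mem_pathSpan (p := k.2.2) ?_)) hlong).symm
        have h4 : k.length ≠ 1 := fun h => h2 ⟨h3, h⟩
        have h5 : k.length ≠ 0 := fun h => h1 (PathIn.eq_top_of_length_eq_zero h ▸ h3)
        change 2 ≤ k.length
        omega
      · exact (arrowMap_smul_topElt_of_notMem hπ hadm hJ hinj hB hs _ h3).symm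
  have ha := pathSpan_zero hπ a
  induction ha using Submodule.span_induction with
  | zero => simp only [zero_smul]
  | add u v _ _ hu hv => simp only [add_smul, map_add, hu, hv]
  | smul d u _ hu => simp only [smul_assoc, map_smul, hu]
  | mem a ha =>
    obtain ⟨i, j, p, -, rfl⟩ := ha
    rw [← B.linearCombination_repr x, Finsupp.linearCombination_apply, Finsupp.sum]
    simp only [map_sum, map_smul, Finset.smul_sum, hB, smul_comm_algebra]
    exact Finset.sum_congr rfl fun k _ => by rw [hpath p k.2]

end Projections

/-! ### The projections with prescribed coordinates, and their kernels. -/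

section Charts

open scoped Classical

variable {K : Type*} {Q : Type*} {A : Type*} [Field K] [Quiver Q] [Fintype Q] [Ring A] [Algebra K A]
variable (π : PathAlgebra K Q →ₐ[K] A) {ι : Type*} {e : ι → Q}

/-- The scalar relating the chosen paths of length `2` in two trees with isomorphic roots. -/
noncomputable def socleRatio (q : ∀ r : ι, Σ j, Quiver.Path (e r) j) (r t : ι) : K :=
  if h : ∃ c : K, pathElt π (q t).2 = c • pathElt π (q r).2 then h.choose else 0

/-- The matrix of the shear which normalizes the paths of length `2` in the short trees of `s`. -/
noncomputable def shearMatrix (s : Finset (PathIn e)) (q : ∀ r : ι, Σ j, Quiver.Path (e r) j)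
    (c : PathIn e → PathIn e → K) (r t : ι) : K :=
  if (PathIn.top r ∈ s ∧ IsSoclePath π (q r)) ∧ r ∉ longTrees s ∧ t ∈ longTrees s ∧ e r = e t then
    c ⟨r, q r⟩ ⟨t, q t⟩ * socleRatio π q r t else 0

/-- The projection onto the span of `s` with coordinates `c`. -/
noncomputable def chartMap [Fintype ι] {q : ∀ r : ι, Σ j, Quiver.Path (e r) j}
    (B : Module.Basis (stdSkeleton π q) K (Proj π e)) (s : Finset (PathIn e))
    (c : PathIn e → PathIn e → K) : Proj π e →ₗ[K] Proj π e :=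
  (shear π e fun r t => -shearMatrix π s q c r t).restrictScalars K ∘ₗ arrowMap B s c ∘ₗ
    (shear π e (shearMatrix π s q c)).restrictScalars K ∘ₗ (topMap π s c).restrictScalars K

variable {π} {s : Finset (PathIn e)} {q : ∀ r : ι, Σ j, Quiver.Path (e r) j}

theorem isShearMatrix_shearMatrix (c : PathIn e → PathIn e → K) :
    IsShearMatrix s (shearMatrix π s q c) := by
  intro r t h
  by_contra h'
  exact h (if_neg fun h'' => h' h''.2)

/-- Paths with the same image in `A` starting in the equal vertices `e r` and `e t`. -/
theorem exists_pathIn_of_eq {r t : ι} (h : e r = e t) {j : Q} (p : Quiver.Path (e r) j) :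
    ∃ b : PathIn e, b.1 = t ∧ b.length = p.length ∧ b.endpoint = j ∧
      pathElt π b.2.2 = pathElt π p := by
  generalize hv : e r = v at p h
  subst h
  exact ⟨⟨t, j, p⟩, rfl, rfl, rfl, rfl⟩

variable [Fintype ι]

theorem chartMap_apply {B : Module.Basis (stdSkeleton π q) K (Proj π e)}
    (c : PathIn e → PathIn e → K) (x : Proj π e) :
    chartMap π B s c x = shear π e (fun r t => -shearMatrix π s q c r t)
      (arrowMap B s c (shear π e (shearMatrix π s q c) (topMap π s c x))) := rfl

theorem topMap_smul_topElt_of_mem (c : PathIn e → PathIn e → K) (a : A) {r : ι}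
    (hr : PathIn.top r ∈ s) : topMap π s c (a • topElt π e r) = a • topElt π e r := by
  rw [map_smul, topMap_topElt_of_mem c hr]

variable (hπ : Function.Surjective π) (hadm : PathAlgebra.IsAdmissible (RingHom.ker π))
variable (hJ : Ring.jacobson A ^ 3 = ⊥) (hinj : Module.Injective A A)
variable {B : Module.Basis (stdSkeleton π q) K (Proj π e)}
  (hB : ∀ b, B b = pathVec π (topElt π e) b.1) {c : PathIn e → PathIn e → K}
variable (hs : IsStdSubskeleton π s q)

omit [Fintype ι] in
include hπ hadm hJ hinj in
theorem socleRatio_smul {r t : ι} (hr : IsSoclePath π (q r)) (ht : IsSoclePath π (q t))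
    (h : e r = e t) : socleRatio π q r t • pathElt π (q r).2 = pathElt π (q t).2 := by
  have h1 : ∃ c : K, pathElt π (q t).2 = c • pathElt π (q r).2 := by
    refine exists_eq_smul_of_mem_pathSpan_two hπ hadm hJ hinj
      (pathElt_mem_pathSpan hr.1.ge) (pathElt_mul_vertexElt π _) (vertexElt_mul_pathElt π _)
      hr.2 (pathElt_mem_pathSpan ht.1.ge) ?_
    rw [h]
    exact pathElt_mul_vertexElt π _
  rw [socleRatio, dif_pos h1, ← h1.choose_spec]

include hs

theorem topMap_of_mem_levelSpan (c : PathIn e → PathIn e → K) {x : Proj π e}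
    (hx : x ∈ levelSpan π s 0) : topMap π s c x = x := by
  induction hx using Submodule.span_induction with
  | zero => exact map_zero _
  | add u v _ _ hu hv => rw [map_add, hu, hv]
  | smul a u _ hu => rw [LinearMap.map_smul_of_tower, hu]
  | mem x hx =>
    obtain ⟨b, ⟨hb, _⟩, rfl⟩ := hx
    exact topMap_smul_topElt_of_mem c _ (hs.top_mem b hb)

include hπ hadm hJ hinj hB

theorem shear_arrowMap_shear_of_mem_levelSpan {W : ι → ι → K} (hW : IsShearMatrix s W)
    {x : Proj π e} (hx : x ∈ levelSpan π s 0) :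
    shear π e (fun r t => -W r t) (arrowMap B s c (shear π e W x)) = x := by
  rw [arrowMap_of_mem_levelSpan hB hs (shear_mem_levelSpan hπ hadm hJ hinj hs hW hx),
    shear_neg_shear hW]

theorem chartMap_of_mem_levelSpan {x : Proj π e} (hx : x ∈ levelSpan π s 0) :
    chartMap π B s c x = x := by
  rw [chartMap_apply, topMap_of_mem_levelSpan hs c hx,
    shear_arrowMap_shear_of_mem_levelSpan hπ hadm hJ hinj hB hs (isShearMatrix_shearMatrix c) hx]

theorem chartMap_mem_levelSpan (x : Proj π e) : chartMap π B s c x ∈ levelSpan π s 0 :=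
  shear_mem_levelSpan hπ hadm hJ hinj hs (isShearMatrix_shearMatrix c).neg
    (arrowMap_mem_levelSpan hB _)

/-- Up to the invertible last shear, the map is `arrowMap` precomposed with A-linear maps, so
closure of the kernel under A is inherited from `arrowMap`. -/
theorem chartMap_smul_eq_zero (hc : ∀ k b, c k b ≠ 0 → IsFreePosition π s q k b) (a : A)
    {x : Proj π e} (hx : chartMap π B s c x = 0) : chartMap π B s c (a • x) = 0 := by
  rw [chartMap_apply] at hx
  have h := shear_shear_neg (isShearMatrix_shearMatrix (π := π) (q := q) (s := s) c)
    (arrowMap B s c (shear π e (shearMatrix π s q c) (topMap π s c x)))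
  rw [hx, map_zero] at h
  rw [chartMap_apply, map_smul, map_smul, ← arrowMap_smul_arrowMap hπ hadm hJ hinj hB hs hc, ← h,
    smul_zero, map_zero, map_zero]

/-- Free positions never lower the length of a path, and neither do shears. -/
theorem chartMap_smul_topElt_mem_levelSpan (hc : ∀ k b, c k b ≠ 0 → IsFreePosition π s q k b)
    {l : ℕ} {a : A} (ha : a ∈ pathSpan π l) {r : ι} (hr : PathIn.top r ∈ s) :
    chartMap π B s c (a • topElt π e r) ∈ levelSpan π s l := by
  have hW := isShearMatrix_shearMatrix (π := π) (q := q) (s := s) c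
  rw [chartMap_apply, topMap_smul_topElt_of_mem c a hr, shear_smul_topElt hW, map_add, map_sum]
  refine shear_mem_levelSpan hπ hadm hJ hinj hs hW.neg (Submodule.add_mem _
    (arrowMap_smul_topElt_mem_levelSpan hπ hadm hJ hinj hB hs hc ha r)
    (Submodule.sum_mem _ fun t _ => ?_))
  rw [map_smul]
  exact Submodule.smul_mem _ _ (arrowMap_smul_topElt_mem_levelSpan hπ hadm hJ hinj hB hs hc ha t)

/-- `s` is a distinguished skeleton of the quotient by the kernel of `chartMap`. -/
theorem exists_mem_grassSkeleton_chartMap (hc : ∀ k b, c k b ≠ 0 → IsFreePosition π s q k b) :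
    ∃ C ∈ GrassSkeleton π (s : Set (PathIn e)),
      LinearMap.ker (chartMap π B s c) = C.restrictScalars K := by
  let C : Submodule A (Proj π e) :=
    { carrier := {x | chartMap π B s c x = 0}
      add_mem' := fun {u v} hu hv => by
        rw [Set.mem_ofPred_eq] at hu hv ⊢
        rw [map_add, hu, hv, add_zero]
      zero_mem' := map_zero _
      smul_mem' := fun a x hx => chartMap_smul_eq_zero hπ hadm hJ hinj hB hs hc a hx }
  have hmk : ∀ x, C.mkQ (chartMap π B s c x) = C.mkQ x := by
    intro x
    refine (Submodule.Quotient.eq C).2 ?_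
    change chartMap π B s c _ = 0
    rw [map_sub, chartMap_of_mem_levelSpan hπ hadm hJ hinj hB hs
      (chartMap_mem_levelSpan hπ hadm hJ hinj hB hs x), sub_self]
  refine ⟨C, ?_, rfl⟩
  have hv : (pathVec π (fun r => C.mkQ (topElt π e r)) : PathIn e → _) =
      C.mkQ.restrictScalars K ∘ pathVec π (topElt π e) :=
    funext fun b => (map_pathVec C.mkQ (topElt π e) b).symm
  have hlevel : ∀ l, ∀ x ∈ levelSpan π s l, C.mkQ x ∈ Submodule.span K
      (pathVec π (fun r => C.mkQ (topElt π e r)) '' {b | b ∈ s ∧ l ≤ b.length}) := by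
    intro l x hx
    rw [hv, Set.image_comp, ← Submodule.map_span]
    exact ⟨x, hx, rfl⟩
  refine isSkeletonRelative_of_radPow_le hπ hadm s.finite_toSet hs.isAbstractSkeleton ?_ ?_ ?_
  · intro r
    rw [← map_smul, vertexElt_smul_topElt]
  · rw [hv]
    refine LinearIndependent.map (f := C.mkQ.restrictScalars K)
      ((linearIndepOn_stdSkeleton hadm q).mono hs.subset) ?_
    rw [Submodule.disjoint_def]
    intro x hx hx'
    have hx1 : x ∈ levelSpan π s 0 := by
      refine Submodule.span_mono ?_ hx
      rintro _ ⟨b, rfl⟩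
      exact ⟨b.1, ⟨b.2, Nat.zero_le _⟩, rfl⟩
    have hx2 : x ∈ C := (Submodule.Quotient.mk_eq_zero _).1 hx'
    rw [← chartMap_of_mem_levelSpan hπ hadm hJ hinj hB hs hx1 (c := c)]
    exact hx2
  · intro l x hx
    refine radPow_induction hπ hadm _ (fun a ha m => ?_) hx
    obtain ⟨v, rfl⟩ := C.mkQ_surjective m
    rw [← map_smul, ← sum_smul_topElt v, Finset.smul_sum, map_sum]
    have htop : ∀ a ∈ pathSpan π l, ∀ r, PathIn.top r ∈ s → C.mkQ (a • topElt π e r) ∈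
        Submodule.span K (pathVec π (fun r => C.mkQ (topElt π e r)) ''
          {b | b ∈ s ∧ l ≤ b.length}) := by
      intro a ha r hr
      rw [← hmk]
      exact hlevel l _ (chartMap_smul_topElt_mem_levelSpan hπ hadm hJ hinj hB hs hc ha hr)
    refine Submodule.sum_mem _ fun r _ => ?_
    rw [← mul_smul]
    have ha' := mul_mem_pathSpan_left hπ (v r : A) ha
    by_cases hr : PathIn.top r ∈ s
    · exact htop _ ha' r hr
    · rw [map_smul, ← hmk, ← map_smul]
      have h0 := chartMap_mem_levelSpan hπ hadm hJ hinj hB hs (c := c) (topElt π e r)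
      generalize chartMap π B s c (topElt π e r) = x at h0
      induction h0 using Submodule.span_induction with
      | zero => rw [smul_zero, map_zero]; exact Submodule.zero_mem _
      | add u v _ _ hu hv => rw [smul_add, map_add]; exact Submodule.add_mem _ hu hv
      | smul d u _ hu =>
        rw [smul_comm_algebra, LinearMap.map_smul_of_tower]
        exact Submodule.smul_mem _ _ hu
      | mem x hx =>
        obtain ⟨b, ⟨hb, _⟩, rfl⟩ := hx
        rw [pathVec, ← mul_smul]
        exact htop _ (mul_mem_pathSpan_left hπ _ ha') _ (hs.top_mem b hb)

theorem chartMap_topElt (hc : ∀ k b, c k b ≠ 0 → IsFreePosition π s q k b) {r : ι}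
    (hr : PathIn.top r ∉ s) :
    chartMap π B s c (topElt π e r) =
      ∑ b ∈ s, c (PathIn.top r) b • pathVec π (topElt π e) b := by
  rw [chartMap_apply, topMap_topElt_of_notMem hc hr]
  exact shear_arrowMap_shear_of_mem_levelSpan hπ hadm hJ hinj hB hs (isShearMatrix_shearMatrix c)
    (Submodule.sum_mem _ fun b hb => Submodule.smul_mem _ _
      (pathVec_mem_levelSpan hb (Nat.zero_le _)))

omit [Fintype ι] hB in
-- If the roots have the same vertex, the ratio converts `q r` into the path `b`. If they do not, a
-- nonzero coefficient would give the two paths a common endpoint, contradicting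
-- `start_eq_of_pathElt_ne_zero`.
theorem shearMatrix_smul_pathElt (hc : ∀ k b, c k b ≠ 0 → IsFreePosition π s q k b) {r : ι}
    (hr : PathIn.top r ∈ s) (hr' : r ∉ longTrees s) (hq : IsSoclePath π (q r)) {b : PathIn e}
    (hb : b ∈ s) (hb2 : b.length = 2) :
    shearMatrix π s q c r b.1 • pathElt π (q r).2 = c ⟨r, q r⟩ b • pathElt π b.2.2 := by
  obtain ⟨hbq, hbs⟩ := eq_of_mem_stdSkeleton (hs.subset b hb) hb2.ge
  have hb1 := hs.mem_longTrees hb hb2.ge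
  obtain ⟨t, p⟩ := b
  obtain rfl : p = q t := by simpa using hbq
  rw [shearMatrix]
  by_cases h : e r = e t
  · rw [if_pos ⟨⟨hr, hq⟩, hr', hb1, h⟩, mul_smul, socleRatio_smul hπ hadm hJ hinj hq hbs h]
  · rw [if_neg fun h' => h h'.2.2.2, zero_smul]
    by_cases h0 : c ⟨r, q r⟩ ⟨t, q t⟩ = 0
    · rw [h0, zero_smul]
    · exfalso
      have hend : (q r).1 = (q t).1 := (hc _ _ h0).2.2.2.1
      refine h ?_
      have key : ∀ {j : Q} (p : Quiver.Path (e r) j), j = (q t).1 → 2 ≤ p.length →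
          pathElt π p ≠ 0 → e r = e t := by
        rintro j p rfl hp hp0
        exact start_eq_of_pathElt_ne_zero hπ hadm hJ hinj hp hbs.1.ge hp0 hbs.2
      exact key (q r).2 hend hq.1.ge hq.2

end Charts

/-! ### Recovering the coordinates from the projection. -/

section ChartCoordinates

open scoped Classical

variable {K : Type*} {Q : Type*} {A : Type*} [Field K] [Quiver Q] [Fintype Q] [Ring A] [Algebra K A]
variable {π : PathAlgebra K Q →ₐ[K] A} {ι : Type*} {e : ι → Q}
variable {s : Finset (PathIn e)} {q : ∀ r : ι, Σ j, Quiver.Path (e r) j}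

variable [Fintype ι]
variable (hπ : Function.Surjective π) (hadm : PathAlgebra.IsAdmissible (RingHom.ker π))
variable (hJ : Ring.jacobson A ^ 3 = ⊥) (hinj : Module.Injective A A)
variable {B : Module.Basis (stdSkeleton π q) K (Proj π e)}
  (hB : ∀ b, B b = pathVec π (topElt π e) b.1) {c : PathIn e → PathIn e → K}
variable (hs : IsStdSubskeleton π s q)

include hπ hadm hJ hinj hs

/-- Free coefficients of a length-2 path occur only at length-2 paths, at most one per long tree, so
the sum over paths becomes a sum over trees. It is stated for any module because it serves both in P
and in P/C. -/
theorem sum_shearMatrix_smul {M : Type*} [AddCommGroup M] [Module A M] [Module K M]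
    [IsScalarTower K A M] (y : ι → M)
    (hc : ∀ k b, c k b ≠ 0 → IsFreePosition π s q k b) {r : ι}
    (hr : PathIn.top r ∈ s) (hr' : r ∉ longTrees s) (hq : IsSoclePath π (q r)) :
    ∑ t, shearMatrix π s q c r t • pathElt π (q r).2 • y t =
      ∑ b ∈ s, c ⟨r, q r⟩ b • pathVec π y b := by
  have hlen : PathIn.length (⟨r, q r⟩ : PathIn e) = 2 := hq.1
  rw [← Finset.sum_filter_add_sum_filter_not s (fun b => b.length = 2),
    Finset.sum_eq_zero (s := s.filter fun b => ¬ b.length = 2), add_zero]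
  · symm
    refine Finset.sum_of_injOn (fun b => b.1) ?_ (fun _ _ => Finset.mem_coe.2 (Finset.mem_univ _))
      ?_ ?_
    · intro b hb b' hb' h
      rw [Finset.mem_coe, Finset.mem_filter] at hb hb'
      have h1 := (eq_of_mem_stdSkeleton (hs.subset b hb.1) hb.2.ge).1
      have h2 := (eq_of_mem_stdSkeleton (hs.subset b' hb'.1) hb'.2.ge).1
      rw [h1, h2]
      simp only at h
      rw [h]
    · intro t _ ht
      by_cases h : shearMatrix π s q c r t = 0
      · rw [h, zero_smul]
      · obtain ⟨b, hb, hbt, hb2⟩ := (isShearMatrix_shearMatrix c r t h).2.1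
        exact absurd ⟨b, Finset.mem_coe.2 (Finset.mem_filter.2 ⟨hb, hb2⟩), hbt⟩ ht
    · intro b hb
      rw [Finset.mem_filter] at hb
      rw [pathVec, ← smul_assoc, ← smul_assoc,
        shearMatrix_smul_pathElt hπ hadm hJ hinj hs hc hr hr' hq hb.1 hb.2]
  · intro b hb
    rw [Finset.mem_filter] at hb
    by_cases h0 : c ⟨r, q r⟩ b = 0
    · rw [h0, zero_smul]
    · obtain ⟨-, -, -, -, h | ⟨-, h | h⟩⟩ := hc _ b h0
      · omega
      · exact absurd h.2 hb.2
      · omega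

include hB

/-- The terms added by the first shear lie in long trees, which `arrowMap` and the inverse shear
leave fixed. -/
theorem chartMap_smul_topElt (a : A) {r : ι} (hr : PathIn.top r ∈ s) :
    chartMap π B s c (a • topElt π e r) =
      shear π e (fun r t => -shearMatrix π s q c r t) (arrowMap B s c (a • topElt π e r)) +
        ∑ t, shearMatrix π s q c r t • a • topElt π e t := by
  have hW := isShearMatrix_shearMatrix (π := π) (q := q) (s := s) c
  rw [chartMap_apply, topMap_smul_topElt_of_mem c a hr, shear_smul_topElt hW, map_add, map_add,
    map_sum, map_sum]
  congr 1
  refine Finset.sum_congr rfl fun t _ => ?_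
  rw [map_smul, LinearMap.map_smul_of_tower]
  by_cases h : shearMatrix π s q c r t = 0
  · rw [h, zero_smul, zero_smul]
  · have ht := (hW r t h).2.1
    rw [arrowMap_of_mem_levelSpan hB hs
      (smul_topElt_mem_levelSpan hπ hadm hJ hinj hs (pathSpan_zero hπ a) ht),
      shear_smul_topElt_of_mem hW.neg a ht]

/-- Tops and paths of length 2 receive exactly their prescribed images. For an arrow the two shears
contribute additional arrows, but only in long trees. -/
theorem chartMap_pathVec_sub_mem (hc : ∀ k b, c k b ≠ 0 → IsFreePosition π s q k b)
    {k : PathIn e} (hk : k ∈ stdSkeleton π q) (hks : k ∉ s)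
    (hk' : k.length = 0 ∨ PathIn.top k.1 ∈ s) :
    chartMap π B s c (pathVec π (topElt π e) k) - ∑ b ∈ s, c k b • pathVec π (topElt π e) b ∈
      Submodule.span K
        (pathVec π (topElt π e) '' {b | b ∈ s ∧ b.length = 1 ∧ b.1 ∈ longTrees s}) := by
  by_cases h0 : k.length = 0
  · have hk0 := PathIn.eq_top_of_length_eq_zero h0
    rw [hk0] at hks ⊢
    rw [pathVec_top vertexElt_smul_topElt, chartMap_topElt hπ hadm hJ hinj hB hs hc hks, sub_self]
    exact Submodule.zero_mem _
  have htop := hk'.resolve_left h0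
  have hlong : k.1 ∉ longTrees s := fun h => hks (hs.mem_of_mem_longTrees hk h)
  rw [pathVec, chartMap_smul_topElt hπ hadm hJ hinj hB hs _ htop]
  rcases Nat.lt_or_ge k.length 2 with h2 | h2
  · have h1 : k.length = 1 := by omega
    have hmem : ∀ {r t : ι} {j : Q} (p : Quiver.Path (e r) j) {d : K}, p.length = 1 →
        (d ≠ 0 → t ∈ longTrees s ∧ e r = e t) → d • pathElt π p • topElt π e t ∈ Submodule.span K
          (pathVec π (topElt π e) '' {b | b ∈ s ∧ b.length = 1 ∧ b.1 ∈ longTrees s}) := by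
      intro r t j p d hp hd
      by_cases h : d = 0
      · rw [h, zero_smul]; exact Submodule.zero_mem _
      · obtain ⟨ht, het⟩ := hd h
        obtain ⟨b, rfl, hb1, -, hb⟩ := exists_pathIn_of_eq (π := π) het p
        rw [← hb]
        refine Submodule.smul_mem _ _ (Submodule.subset_span ⟨b, ⟨?_, hb1.trans hp, ht⟩, rfl⟩)
        exact hs.mem_of_mem_longTrees (Or.inl (by omega)) ht
    have hW := isShearMatrix_shearMatrix (π := π) (q := q) (s := s) c
    have harrow := arrowMap_pathVec (s := s) hB c hk
    rw [if_neg hks, if_pos ⟨htop, h1⟩, pathVec] at harrow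
    rw [harrow, add_sub_right_comm, map_sum, ← Finset.sum_sub_distrib]
    refine Submodule.add_mem _ (Submodule.sum_mem _ fun b hb => ?_) (Submodule.sum_mem _ fun t _ =>
      hmem k.2.2 h1 fun h => (hW _ _ h).2)
    rw [LinearMap.map_smul_of_tower, ← smul_sub]
    by_cases hcb : c k b = 0
    · rw [hcb, zero_smul]; exact Submodule.zero_mem _
    refine Submodule.smul_mem _ _ ?_
    obtain ⟨-, -, -, -, h | ⟨-, h | ⟨-, h | ⟨h, -⟩⟩⟩⟩ := hc k b hcb
    · omega
    · omega
    · rw [pathVec, shear_smul_topElt_of_mem hW.neg _ (hs.mem_longTrees hb h.ge), sub_self]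
      exact Submodule.zero_mem _
    · rw [pathVec, shear_smul_topElt hW.neg, add_sub_cancel_left]
      exact Submodule.sum_mem _ fun t _ => hmem b.2.2 h fun h => (hW.neg _ _ h).2
  · obtain ⟨hkq, hq⟩ := eq_of_mem_stdSkeleton hk h2
    rw [arrowMap_smul_topElt_of_notMem_longTrees hπ hadm hJ hinj hB hs
      (pathElt_mem_pathSpan (p := k.2.2) h2) hlong, map_zero, zero_add]
    obtain ⟨r, p⟩ := k
    obtain rfl : p = q r := by simpa using hkq
    rw [sum_shearMatrix_smul hπ hadm hJ hinj hs _ hc htop hlong hq, sub_self]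
    exact Submodule.zero_mem _

/-- The entries of `chartMap` in the free positions are the given coordinates. -/
theorem repr_chartMap (hc : ∀ k b, c k b ≠ 0 → IsFreePosition π s q k b)
    {k b : stdSkeleton π q} (h : IsFreePosition π s q k b) :
    B.repr (chartMap π B s c (B k)) b = c k b := by
  obtain ⟨hk, hks, hb, -, h⟩ := h
  have h1 := chartMap_pathVec_sub_mem hπ hadm hJ hinj hB hs hc hk hks (h.imp_right fun h => h.1)
  -- The error term misses every free position of an arrow or of a length-2 path. For a missing top,
  -- long-tree arrows are free positions as well, but there the error term is zero.
  have h2 : Submodule.span K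
        (pathVec π (topElt π e) '' {b | b ∈ s ∧ b.length = 1 ∧ b.1 ∈ longTrees s}) ≤
      LinearMap.ker (B.coord b) ∨ (k : PathIn e).length = 0 := by
    refine or_iff_not_imp_right.2 fun hk0 => ?_
    rw [Submodule.span_le]
    rintro _ ⟨b', ⟨hb', hb1, hbl⟩, rfl⟩
    have hne : (⟨b', hs.subset b' hb'⟩ : stdSkeleton π q) ≠ b := by
      rintro rfl
      simp only at h
      rcases h with h | ⟨-, h | ⟨-, h | h⟩⟩
      · exact hk0 h
      · omega
      · omega
      · exact h.2 hbl
    have := hB ⟨b', hs.subset b' hb'⟩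
    rw [SetLike.mem_coe, LinearMap.mem_ker, ← this, Module.Basis.coord_apply,
      Module.Basis.repr_self, Finsupp.single_eq_of_ne hne.symm]
  have hsum : B.repr (∑ b ∈ s, c k b • pathVec π (topElt π e) b) b = c k b := by
    have : ∑ b ∈ s, c k b • pathVec π (topElt π e) b =
        ∑ b ∈ s.attach, c k b.1 • B ⟨b.1, hs.subset _ b.2⟩ := by
      rw [← Finset.sum_attach]
      exact Finset.sum_congr rfl fun b _ => by rw [hB]
    rw [this, map_sum, Finsupp.finsetSum_apply, Finset.sum_eq_single ⟨b, hb⟩]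
    · rw [map_smul, Module.Basis.repr_self, Finsupp.smul_apply, Finsupp.single_eq_same,
        smul_eq_mul, mul_one]
    · intro b' _ hne
      rw [map_smul, Module.Basis.repr_self, Finsupp.smul_apply, Finsupp.single_eq_of_ne, smul_zero]
      rintro rfl
      exact hne rfl
    · exact fun h => absurd (Finset.mem_attach _ _) h
  rw [hB]
  rcases h2 with h2 | h2
  · have h3 := h2 h1
    rw [LinearMap.mem_ker, map_sub, sub_eq_zero, Module.Basis.coord_apply,
      Module.Basis.coord_apply, hsum] at h3
    exact h3
  · have hk0 := PathIn.eq_top_of_length_eq_zero h2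
    have h4 := chartMap_topElt hπ hadm hJ hinj hB hs hc (hk0 ▸ hks)
    rw [← pathVec_top (y := topElt π e) vertexElt_smul_topElt, ← hk0] at h4
    rw [h4, hsum]

end ChartCoordinates

/-! ### Polynomial dependence of the projections on the coordinates. -/

section ChartPolynomials

open scoped Classical

variable {K : Type*} {Q : Type*} {A : Type*} [Field K] [Quiver Q] [Fintype Q] [Ring A] [Algebra K A]
variable {π : PathAlgebra K Q →ₐ[K] A} {ι : Type*} {e : ι → Q} [Fintype ι]
variable {s : Finset (PathIn e)} {q : ∀ r : ι, Σ j, Quiver.Path (e r) j}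
variable {τ : Type*}

theorem IsPolyMap.projHom_apply {y : (τ → K) → ι → Proj π e}
    (hy : ∀ r, IsPolyMap fun t => y t r) (x : Proj π e) :
    IsPolyMap fun t => projHom π e (y t) x := by
  simp only [_root_.projHom_apply]
  exact IsPolyMap.sum _ fun r _ => IsPolyMap.map (Algebra.lsmul K K (Proj π e) (x r : A)) (hy r)

theorem isPolyMap_shear {W : (τ → K) → ι → ι → K}
    (hW : ∀ r u, (fun t => W t r u) ∈ polyFun K τ) (x : Proj π e) :
    IsPolyMap fun t => shear π e (W t) x :=
  IsPolyMap.projHom_apply (fun _ => IsPolyMap.add (IsPolyMap.const _)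
    (IsPolyMap.sum _ fun _ _ => IsPolyMap.smul (hW _ _) (IsPolyMap.const _))) x

variable {c : (τ → K) → PathIn e → PathIn e → K}
  (hc : ∀ k b, (fun t => c t k b) ∈ polyFun K τ)

include hc

omit [Fintype ι] in
theorem shearMatrix_mem_polyFun (r u : ι) :
    (fun t => shearMatrix π s q (c t) r u) ∈ polyFun K τ := by
  unfold shearMatrix
  split_ifs
  · exact mul_mem_polyFun (hc _ _) (const_mem_polyFun _)
  · exact const_mem_polyFun 0

theorem isPolyMap_chartMap [Fintype (stdSkeleton π q)]
    (B : Module.Basis (stdSkeleton π q) K (Proj π e)) (x : Proj π e) :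
    IsPolyMap fun t => chartMap π B s (c t) x := by
  have hW := shearMatrix_mem_polyFun (π := π) (s := s) (q := q) hc
  have hW' : ∀ r u, (fun t => -shearMatrix π s q (c t) r u) ∈ polyFun K τ := fun r u => by
    have := mul_mem_polyFun (const_mem_polyFun (-1)) (hW r u)
    simpa using this
  have h1 : IsPolyMap fun t => topMap π s (c t) x := by
    refine IsPolyMap.projHom_apply (fun r => ?_) x
    split_ifs
    · exact IsPolyMap.const _
    · exact IsPolyMap.sum _ fun _ _ => IsPolyMap.smul (hc _ _) (IsPolyMap.const _)
  have h2 := IsPolyMap.apply B (F := fun t => (shear π e (shearMatrix π s q (c t))).restrictScalars K)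
    (fun v => isPolyMap_shear hW v) h1
  have h3 := IsPolyMap.apply B (F := fun t => arrowMap B s (c t)) (fun v => by
    simp only [arrowMap, Module.Basis.constr_apply_fintype]
    refine IsPolyMap.sum _ fun k _ => IsPolyMap.smul (const_mem_polyFun _) ?_
    split_ifs
    · exact IsPolyMap.const _
    · exact IsPolyMap.sum _ fun _ _ => IsPolyMap.smul (hc _ _) (IsPolyMap.const _)
    · exact IsPolyMap.const _) h2
  exact IsPolyMap.apply B
    (F := fun t => (shear π e fun r u => -shearMatrix π s q (c t) r u).restrictScalars K)
    (fun v => isPolyMap_shear hW' v) h3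

end ChartPolynomials

/-! ### Every submodule with the given distinguished skeleton lies in the chart. -/

section ChartSurjectivity

open scoped Classical

theorem exists_coeff_of_mem_span {K M κ : Type*} [Field K] [AddCommGroup M] [Module K M]
    {v : κ → M} {s : Finset κ} {p : κ → Prop} {x : M}
    (hx : x ∈ Submodule.span K (v '' {b | b ∈ s ∧ p b})) :
    ∃ d : κ → K, (∀ b, d b ≠ 0 → p b) ∧ x = ∑ b ∈ s, d b • v b := by
  obtain ⟨l, hl, rfl⟩ := (Finsupp.mem_span_image_iff_linearCombination K).1 hx
  have hl' : ∀ b ∈ l.support, b ∈ s ∧ p b := fun b hb => hl hb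
  refine ⟨l, fun b hb => (hl' b (Finsupp.mem_support_iff.2 hb)).2, ?_⟩
  rw [Finsupp.linearCombination_apply, Finsupp.sum]
  refine Finset.sum_subset (fun b hb => (hl' b hb).1) fun b _ hb => ?_
  rw [Finsupp.notMem_support_iff.1 hb, zero_smul]

variable {K : Type*} {Q : Type*} {A : Type*} [Field K] [Quiver Q] [Fintype Q] [Ring A] [Algebra K A]
variable {π : PathAlgebra K Q →ₐ[K] A} {ι : Type*} {e : ι → Q}
variable {s : Finset (PathIn e)} {q : ∀ r : ι, Σ j, Quiver.Path (e r) j}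

variable [Fintype ι]
variable (hπ : Function.Surjective π) (hadm : PathAlgebra.IsAdmissible (RingHom.ker π))
variable (hJ : Ring.jacobson A ^ 3 = ⊥) (hinj : Module.Injective A A)
variable {B : Module.Basis (stdSkeleton π q) K (Proj π e)}
  (hB : ∀ b, B b = pathVec π (topElt π e) b.1)
variable (hs : IsStdSubskeleton π s q)

omit [Fintype ι] in
-- Allows the shear to be fixed before the coefficients of the arrows are known.
theorem shearMatrix_congr {c c' : PathIn e → PathIn e → K}
    (h : ∀ k b, k.length = 2 → c k b = c' k b) : shearMatrix π s q c = shearMatrix π s q c' := by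
  funext r t
  rw [shearMatrix, shearMatrix]
  split_ifs with h1
  · rw [h ⟨r, q r⟩ _ h1.1.2.1]
  · rfl

omit [Fintype ι] in
/-- Homogeneous elements of `J^l M` are combinations of paths of length at least `l`. -/
theorem exists_coeff_of_forall_radPow {M : Type*} [AddCommGroup M] [Module A M] [Module K M]
    [IsScalarTower K A M] {y : ι → M} {l : ℕ} {i : Q} {x : M}
    (h : x ∈ Submodule.span K (pathVec π y '' {b | b ∈ s ∧ l ≤ b.length}))
    (hxi : vertexElt π i • x = x) :
    ∃ d : PathIn e → K, (∀ b, d b ≠ 0 → l ≤ b.length ∧ b.endpoint = i) ∧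
      x = ∑ b ∈ s, d b • pathVec π y b := by
  have h1 := vertexElt_smul_mem_span h i
  rw [hxi] at h1
  refine exists_coeff_of_mem_span (Submodule.span_mono (Set.image_mono ?_) h1)
  exact fun b hb => ⟨hb.1.1, hb.1.2, hb.2⟩

include hπ hadm hJ hinj hB hs

/-- Every submodule with distinguished skeleton `s` for the quotient is the kernel of a
`chartMap`. -/
theorem exists_ker_chartMap_eq {C : Submodule A (Proj π e)}
    (hC : C ∈ GrassSkeleton π (s : Set (PathIn e))) :
    ∃ c : PathIn e → PathIn e → K, (∀ k b, c k b ≠ 0 → IsFreePosition π s q k b) ∧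
      C.restrictScalars K = LinearMap.ker (chartMap π B s c) := by
  have h : IsSkeletonRelative π (s : Set (PathIn e)) (Proj π e ⧸ C)
    fun r => C.mkQ (topElt π e r) := hC
  set y : ι → Proj π e ⧸ C := fun r => C.mkQ (topElt π e r) with hy
  have hmk : ∀ b : PathIn e, C.mkQ (pathVec π (topElt π e) b) = pathVec π y b := fun b =>
    map_pathVec C.mkQ (topElt π e) b
  have hrad : ∀ l, ∀ x ∈ radPow A (Proj π e ⧸ C) l,
      x ∈ Submodule.span K (pathVec π y '' {b | b ∈ s ∧ l ≤ b.length}) := fun l x hx =>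
    h.radPow_le hπ hadm hJ s.finite_toSet l hx
  choose d hd hdsum using fun k : PathIn e => exists_coeff_of_forall_radPow
    (hrad _ _ (pathVec_mem_radPow hπ hadm y (le_refl k.length))) (vertexElt_smul_pathVec y k)
  -- The coefficients for missing tops and missing paths of length 2 are read off in P/C at once;
  -- those of arrows make sense only after the shear.
  let c₀ : PathIn e → PathIn e → K := fun k b =>
    if (k ∈ stdSkeleton π q ∧ k ∉ s ∧ b ∈ s) ∧ (k.length = 0 ∨ k.length = 2 ∧ PathIn.top k.1 ∈ s)
    then d k b else 0
  have hc₀ : ∀ k b, c₀ k b ≠ 0 → IsFreePosition π s q k b := by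
    intro k b hkb
    have h1 : (k ∈ stdSkeleton π q ∧ k ∉ s ∧ b ∈ s) ∧
        (k.length = 0 ∨ k.length = 2 ∧ PathIn.top k.1 ∈ s) := by
      by_contra h'
      exact hkb (if_neg h')
    have h2 : c₀ k b = d k b := if_pos h1
    obtain ⟨h3, h4⟩ := hd k b (h2 ▸ hkb)
    refine ⟨h1.1.1, h1.1.2.1, h1.1.2.2, h4.symm, h1.2.imp_right fun h5 => ⟨h5.2, Or.inl ⟨h5.1, ?_⟩⟩⟩
    have := length_le_two_of_mem_stdSkeleton (hs.subset b h1.1.2.2)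
    omega
  have hc₀sum : ∀ k ∈ stdSkeleton π q, k ∉ s → (k.length = 0 ∨ k.length = 2 ∧ PathIn.top k.1 ∈ s) →
      pathVec π y k = ∑ b ∈ s, c₀ k b • pathVec π y b := by
    intro k hk hks hk'
    rw [hdsum k]
    exact Finset.sum_congr rfl fun b hb => by
      rw [show c₀ k b = d k b from if_pos ⟨⟨hk, hks, hb⟩, hk'⟩]
  set W := shearMatrix π s q c₀ with hWdef
  have hW : IsShearMatrix s W := isShearMatrix_shearMatrix c₀
  -- `ψ` describes P/C by the corrected generators `z_r - ∑ W r t z_t`.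
  let ψ : Proj π e →ₗ[A] Proj π e ⧸ C := C.mkQ ∘ₗ shear π e fun r t => -W r t
  have hψ : ∀ b : PathIn e, ψ (pathVec π (topElt π e) b) =
      pathVec π (fun r => ψ (topElt π e r)) b := fun b => map_pathVec ψ (topElt π e) b
  have hψW : ∀ x, ψ (shear π e W x) = C.mkQ x := fun x => congrArg C.mkQ (shear_neg_shear hW x)
  have hψlong : ∀ r ∈ longTrees s, ∀ a : A, ψ (a • topElt π e r) = a • y r := by
    intro r hr a
    change C.mkQ (shear π e _ _) = _
    rw [shear_smul_topElt_of_mem hW.neg a hr, map_smul]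
  -- The correction subtracts precisely the expansion of `q_r z_r` modulo C, so J^2 annihilates the
  -- corrected short generators.
  have hψzero : ∀ a ∈ pathSpan π 2, ∀ r, PathIn.top r ∈ s → r ∉ longTrees s →
      ψ (a • topElt π e r) = 0 := by
    intro a ha r hr hr'
    have h1 := smul_mem_span_stdSkeleton hπ hadm hJ hinj vertexElt_smul_topElt hs.socle ha r
    refine (Submodule.span_le (p := LinearMap.ker (ψ.restrictScalars K))).2 ?_ h1
    rintro _ ⟨b, ⟨hb, rfl, hl⟩, rfl⟩
    obtain ⟨hbq, hq⟩ := eq_of_mem_stdSkeleton hb hl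
    have hbs : b ∉ s := fun h => hr' (hs.mem_longTrees h hl)
    have hsum := hc₀sum b hb hbs (Or.inr
      ⟨le_antisymm (length_le_two_of_mem_stdSkeleton hb) hl, hr⟩)
    obtain ⟨r, p⟩ := b
    obtain rfl : p = q r := by simpa using hbq
    change C.mkQ (shear π e _ _) = 0
    rw [pathVec, shear_smul_topElt hW.neg, map_add, map_sum]
    have h2 := sum_shearMatrix_smul hπ hadm hJ hinj hs y hc₀ hr hr' hq
    rw [← hsum] at h2
    simp only [neg_smul, map_neg, Finset.sum_neg_distrib, LinearMap.map_smul_of_tower, map_smul]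
    rw [add_neg_eq_zero]
    exact h2.symm
  have hψrad : ∀ l, ∀ x ∈ radPow A (Proj π e ⧸ C) l, x ∈ Submodule.span K
      (pathVec π (fun r => ψ (topElt π e r)) '' {b | b ∈ s ∧ l ≤ b.length}) := by
    intro l x hx
    have h1 := hrad l x hx
    have h2 : (pathVec π y : PathIn e → _) =
        C.mkQ.restrictScalars K ∘ pathVec π (topElt π e) := funext fun b => (hmk b).symm
    have h3 : (pathVec π (fun r => ψ (topElt π e r)) : PathIn e → _) =
        ψ.restrictScalars K ∘ pathVec π (topElt π e) := funext fun b => (hψ b).symm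
    rw [h2, Set.image_comp, ← Submodule.map_span] at h1
    rw [h3, Set.image_comp, ← Submodule.map_span]
    obtain ⟨v, hv, rfl⟩ := h1
    exact ⟨shear π e W v, shear_mem_levelSpan hπ hadm hJ hinj hs hW hv, hψW v⟩
  choose d' hd' hdsum' using fun k : PathIn e => exists_coeff_of_forall_radPow
    (hψrad _ _ (pathVec_mem_radPow hπ hadm (fun r => ψ (topElt π e r)) (le_refl k.length)))
    (vertexElt_smul_pathVec (fun r => ψ (topElt π e r)) k)
  -- After multiplication by an element of J, the expansion of the missing arrow loses its left side
  -- and its short-tree arrows by `hψzero`, and its length-2 paths because J^3 = 0. The remaining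
  -- combination of long-tree arrows is therefore annihilated by J, and the independence lemma
  -- applies.
  have hd'zero : ∀ k ∈ stdSkeleton π q, k ∉ s → PathIn.top k.1 ∈ s → k.length = 1 →
      ∀ b ∈ s, b.length = 1 → b.1 ∈ longTrees s → d' k b = 0 := by
    intro k hk hks htop hk1 b hb hb1 hbl
    have hkl : k.1 ∉ longTrees s := fun h => hks (hs.mem_of_mem_longTrees hk h)
    have hlong : ∀ r ∈ longTrees s, (⟨r, q r⟩ : PathIn e) ∈ s ∧ IsSoclePath π (q r) := by
      rintro _ ⟨b, hb, rfl, hb2⟩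
      obtain ⟨h1, h2⟩ := eq_of_mem_stdSkeleton (hs.subset b hb) hb2.ge
      exact ⟨h1 ▸ hb, h2⟩
    refine eq_zero_of_pathSpan_one_smul_sum hπ hadm hJ hinj (y := fun r => ψ (topElt π e r))
      (q := q) (Λ := longTrees s) (fun r hr => (hlong r hr).2) ?_
      (s := s.filter fun b => b.length = 1 ∧ b.1 ∈ longTrees s)
      (fun b hb => (Finset.mem_filter.1 hb).2) (c := d' k) (fun a ha => ?_)
      (Finset.mem_filter.2 ⟨hb, hb1, hbl⟩)
    · have h1 := h.linearIndependent.comp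
        (fun r : longTrees s => (⟨⟨r, q r⟩, (hlong r r.2).1⟩ : (s : Set (PathIn e)))) (by
          intro r r' hrr
          exact Subtype.ext (congrArg (fun b => b.1.1) hrr))
      have h2 : (fun r : longTrees s => pathElt π (q r).2 • ψ (topElt π e r)) =
          (fun b : (s : Set (PathIn e)) => pathElt π b.1.2.2 • y b.1.1) ∘
            fun r : longTrees s => ⟨⟨r, q r⟩, (hlong r r.2).1⟩ := by
        funext r
        rw [← map_smul, hψlong r r.2]
        rfl
      rw [LinearIndepOn, h2]
      exact h1
    · have hkill : ∀ b : PathIn e, 1 ≤ b.length → PathIn.top b.1 ∈ s → b.1 ∉ longTrees s →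
          a • pathVec π (fun r => ψ (topElt π e r)) b = 0 := by
        intro b hb hbt hbl
        rw [pathVec, ← mul_smul, ← map_smul]
        exact hψzero _ (mul_mem_pathSpan (l := 1) (m := 1) ha (pathElt_mem_pathSpan hb)) _ hbt hbl
      have h1 := congrArg (a • ·) (hdsum' k)
      simp only [hkill k hk1.ge htop hkl] at h1
      rw [← Finset.sum_filter_add_sum_filter_not s (fun b => b.length = 1 ∧ b.1 ∈ longTrees s),
        smul_add] at h1
      rw [h1, left_eq_add, Finset.smul_sum]
      refine Finset.sum_eq_zero fun b hb => ?_
      rw [Finset.mem_filter] at hb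
      rw [smul_comm_algebra]
      by_cases h0 : d' k b = 0
      · rw [h0, zero_smul]
      have hbk := (hd' k b h0).1
      rcases hbk.eq_or_lt with h2 | h2
      · have h3 : b.length = 1 := h2.symm.trans hk1
        rw [hkill b h3.ge (hs.top_mem b hb.1) fun h => hb.2 ⟨h3, h⟩, smul_zero]
      · rw [pathVec, ← mul_smul, pathSpan_mul_eq_zero hπ hadm hJ (l := 1) (m := 2) (by norm_num) ha
          (pathElt_mem_pathSpan (p := b.2.2) (by change 2 ≤ b.length; omega)), zero_smul, smul_zero]
  -- The arrow coefficients come from the corrected generators, the others from `c₀`; the shear is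
  -- unaffected.
  let c : PathIn e → PathIn e → K := fun k b =>
    if k.length = 1 then
      if k ∈ stdSkeleton π q ∧ k ∉ s ∧ b ∈ s ∧ PathIn.top k.1 ∈ s then d' k b else 0
    else c₀ k b
  have hc1 : ∀ k, k.length ≠ 1 → c k = c₀ k := fun k hk => funext fun b => if_neg hk
  have hc2 : ∀ k ∈ stdSkeleton π q, k ∉ s → PathIn.top k.1 ∈ s → k.length = 1 → ∀ b ∈ s,
      c k b = d' k b := fun k hk hks ht h1 b hb => (if_pos h1).trans (if_pos ⟨hk, hks, hb, ht⟩)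
  have hc : ∀ k b, c k b ≠ 0 → IsFreePosition π s q k b := by
    intro k b hkb
    by_cases h1 : k.length = 1
    · have h2 : k ∈ stdSkeleton π q ∧ k ∉ s ∧ b ∈ s ∧ PathIn.top k.1 ∈ s := by
        by_contra h'
        exact hkb ((if_pos h1).trans (if_neg h'))
      obtain ⟨hk, hks, hb, ht⟩ := h2
      rw [hc2 k hk hks ht h1 b hb] at hkb
      obtain ⟨h3, h4⟩ := hd' k b hkb
      refine ⟨hk, hks, hb, h4.symm, Or.inr ⟨ht, Or.inr ⟨h1, ?_⟩⟩⟩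
      have h5 := length_le_two_of_mem_stdSkeleton (hs.subset b hb)
      by_cases h6 : b.length = 1
      · exact Or.inr ⟨h6, fun h7 => hkb (hd'zero k hk hks ht h1 b hb h6 h7)⟩
      · left; omega
    · rw [hc1 k h1] at hkb
      exact hc₀ k b hkb
  have hWc : shearMatrix π s q c = W :=
    shearMatrix_congr fun k b hk => congrFun (hc1 k (by omega)) b
  have harrow : ∀ (a : A) (r : ι), PathIn.top r ∈ s →
      ψ (arrowMap B s c (a • topElt π e r)) = ψ (a • topElt π e r) := by
    intro a r hr
    have h1 := smul_mem_span_stdSkeleton hπ hadm hJ hinj vertexElt_smul_topElt hs.socle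
      (pathSpan_zero hπ a) r
    refine (Submodule.span_le (p := LinearMap.eqLocus
      (ψ.restrictScalars K ∘ₗ arrowMap B s c) (ψ.restrictScalars K))).2 ?_ h1
    rintro _ ⟨k, ⟨hk, rfl, -⟩, rfl⟩
    change ψ (arrowMap B s c (pathVec π (topElt π e) k)) = ψ (pathVec π (topElt π e) k)
    rw [arrowMap_pathVec hB _ hk]
    split_ifs with h2 h3
    · rfl
    · rw [map_sum, hψ, hdsum' k]
      refine Finset.sum_congr rfl fun b hb => ?_
      rw [LinearMap.map_smul_of_tower, hψ, hc2 k hk h2 h3.1 h3.2 b hb]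
    · have h4 : k.length ≠ 1 := fun h => h3 ⟨hr, h⟩
      have h5 : k.length ≠ 0 := fun h => h2 (PathIn.eq_top_of_length_eq_zero h ▸ hr)
      rw [map_zero]
      exact (hψzero _ (pathElt_mem_pathSpan (p := k.2.2) (by change 2 ≤ k.length; omega)) _ hr
        fun h => h2 (hs.mem_of_mem_longTrees hk h)).symm
  have hfix : ∀ (a : A) (r : ι), PathIn.top r ∈ s →
      ψ (arrowMap B s c (shear π e W (a • topElt π e r))) = C.mkQ (a • topElt π e r) := by
    intro a r hr
    rw [← hψW, shear_smul_topElt hW, map_add, map_add, map_add, harrow a r hr]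
    congr 1
    simp only [map_sum, map_smul, LinearMap.map_smul_of_tower]
    refine Finset.sum_congr rfl fun t _ => ?_
    by_cases h0 : W r t = 0
    · rw [h0, zero_smul, zero_smul]
    · rw [harrow a t (hs.top_mem_of_mem_longTrees (hW r t h0).2.1), map_smul]
  -- The projection changes no class modulo C. Since `s` maps to a basis of P/C, its kernel must
  -- then be C.
  have hΦ : ∀ x, C.mkQ (chartMap π B s c x) = C.mkQ x := by
    intro x
    have h1 : C.mkQ (chartMap π B s c x) = ψ (arrowMap B s c (shear π e W (topMap π s c x))) := by
      rw [chartMap_apply, hWc]; rfl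
    rw [h1]
    conv_lhs => rw [← sum_smul_topElt x]
    conv_rhs => rw [← sum_smul_topElt x]
    simp only [map_sum]
    refine Finset.sum_congr rfl fun r _ => ?_
    by_cases hr : PathIn.top r ∈ s
    · rw [topMap_smul_topElt_of_mem c _ hr, hfix _ r hr]
    · have h2 : C.mkQ ((x r : A) • topElt π e r) = ∑ b ∈ s, c (PathIn.top r) b •
          C.mkQ ((x r : A) • pathVec π (topElt π e) b) := by
        have h3 := hc₀sum (PathIn.top r) (Or.inl two_pos) hr (Or.inl rfl)
        rw [pathVec_top h.normed] at h3
        rw [map_smul]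
        change (x r : A) • y r = _
        rw [h3, Finset.smul_sum]
        refine Finset.sum_congr rfl fun b _ => ?_
        rw [smul_comm_algebra, map_smul, hmk, hc1 _ (by rw [PathIn.length_top]; norm_num)]
      rw [h2, map_smul, topMap_topElt_of_notMem hc hr, Finset.smul_sum]
      simp only [map_sum]
      refine Finset.sum_congr rfl fun b hb => ?_
      rw [smul_comm_algebra, LinearMap.map_smul_of_tower, map_smul, LinearMap.map_smul_of_tower,
        pathVec, ← mul_smul, hfix _ _ (hs.top_mem b hb)]
  refine ⟨c, hc, ?_⟩
  ext x
  rw [Submodule.restrictScalars_mem, LinearMap.mem_ker, ← Submodule.Quotient.mk_eq_zero C]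
  change C.mkQ x = 0 ↔ _
  rw [← hΦ x]
  constructor
  · intro hx
    have h1 := chartMap_mem_levelSpan hπ hadm hJ hinj hB hs (c := c) x
    generalize chartMap π B s c x = z at hx h1
    obtain ⟨f, -, rfl⟩ := exists_coeff_of_mem_span h1
    simp only [map_sum, LinearMap.map_smul_of_tower, hmk] at hx
    have h2 := linearIndepOn_finset_iff.1 h.linearIndepOn f hx
    exact Finset.sum_eq_zero fun b hb => by rw [h2 b hb, zero_smul]
  · intro hx
    rw [hx, map_zero]

end ChartSurjectivity

/-! ### Assembly: the Plücker image of a chart is an affine space. -/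

section FullAffineSpaces

open scoped Classical

variable {K : Type*} {Q : Type*} {A : Type*} [Field K] [Quiver Q] [Fintype Q] [Ring A] [Algebra K A]
variable {π : PathAlgebra K Q →ₐ[K] A} {ι : Type*} {e : ι → Q}

theorem IsNormalizedSkeleton.finite [Finite ι] [∀ i j : Q, Finite (i ⟶ j)]
    (hJ : Ring.jacobson A ^ 3 = ⊥) {σ : Set (PathIn e)} (hσ : IsNormalizedSkeleton π σ) :
    σ.Finite :=
  finite_pathIn_of_length_le (n := 2) fun b hb =>
    Nat.le_of_lt_succ ((hσ.1.1 b hb).trans_le (loewyLength_le_three hJ A))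

theorem isFullAffineSpace_grassVariety [Finite ι] [∀ i j : Q, Finite (i ⟶ j)]
    (hπ : Function.Surjective π) (hadm : PathAlgebra.IsAdmissible (RingHom.ker π))
    (hJ : Ring.jacobson A ^ 3 = ⊥) (hinj : Module.Injective A A) {σ : Set (PathIn e)}
    (hσ : IsNormalizedSkeleton π σ) : IsFullAffineSpace (grassVariety π σ) := by
  have := Fintype.ofFinite ι
  obtain ⟨s, rfl⟩ : ∃ s : Finset (PathIn e), (s : Set (PathIn e)) = σ := (hσ.finite hJ).exists_finset_coe
  obtain ⟨q, hq, hsub, hfull⟩ := hσ.exists_stdSkeleton hπ hadm hJ hinj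
  have hs : IsStdSubskeleton π s q :=
    { socle := hq
      subset := hsub
      full := hfull
      top_mem := fun b hb => hσ.1.2 b.1 _ _ Quiver.Path.nil b.2.2 (by
        rw [Quiver.Path.nil_comp]; exact hb)
      isAbstractSkeleton := hσ.1 }
  have hfin : (stdSkeleton π q).Finite :=
    finite_pathIn_of_length_le (n := 2) fun b hb => length_le_two_of_mem_stdSkeleton hb
  have := hfin.fintype
  set B := stdBasis hπ hadm hJ hinj hq
  have hB : ∀ b, B b = pathVec π (topElt π e) b.1 := stdBasis_apply hπ hadm hJ hinj hq
  let F := {x : stdSkeleton π q × stdSkeleton π q // IsFreePosition π s q x.1 x.2}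
  let E : F ≃ Fin (Nat.card F) := Finite.equivFin F
  -- The affine coordinates are indexed by the free positions; all other coefficients are set to
  -- zero.
  let c : (Fin (Nat.card F) → K) → PathIn e → PathIn e → K := fun t k b =>
    if h : IsFreePosition π s q k b then t (E ⟨⟨⟨k, h.1⟩, ⟨b, hsub h.2.2.1⟩⟩, h⟩) else 0
  have hc : ∀ t k b, c t k b ≠ 0 → IsFreePosition π s q k b := by
    intro t k b h
    by_contra h'
    exact h (dif_neg h')
  have hset : {C : Submodule K (Proj π e) | ∃ C' ∈ GrassSkeleton π (s : Set (PathIn e)),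
      C = C'.restrictScalars K} = {C | ∃ t, C = LinearMap.ker (chartMap π B s (c t))} := by
    ext C
    constructor
    · rintro ⟨C', hC', rfl⟩
      obtain ⟨d, hd, hC⟩ := exists_ker_chartMap_eq hπ hadm hJ hinj hB hs hC'
      refine ⟨fun i => d (E.symm i).1.1 (E.symm i).1.2, ?_⟩
      rw [hC]
      congr 2
      funext k b
      by_cases h : IsFreePosition π s q k b
      · simp [c, h]
      · have h0 : d k b = 0 := not_not.1 fun h' => h (hd k b h')
        simp only [c, dif_neg h, h0]
    · rintro ⟨t, rfl⟩
      exact exists_mem_grassSkeleton_chartMap hπ hadm hJ hinj hB hs (hc t)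
  have hcard : ({b | b.1 ∈ s}ᶜ : Set (stdSkeleton π q)).ncard =
      Module.finrank K (Proj π e) - (s : Set (PathIn e)).ncard := by
    rw [Module.finrank_eq_card_basis B, Set.ncard_compl, Nat.card_eq_fintype_card]
    congr 1
    refine (Set.ncard_image_of_injective _ Subtype.val_injective).symm.trans (congrArg _ ?_)
    ext b
    exact ⟨fun ⟨b', hb', h⟩ => h ▸ hb', fun hb => ⟨⟨b, hsub hb⟩, hb, rfl⟩⟩
  rw [grassVariety, hset]
  have himage : Submodule.span K (B '' {b | b.1 ∈ s}) = levelSpan π s 0 := by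
    congr 1
    ext x
    constructor
    · rintro ⟨b, hb, rfl⟩
      exact ⟨b.1, ⟨hb, Nat.zero_le _⟩, (hB b).symm⟩
    · rintro ⟨b, ⟨hb, -⟩, rfl⟩
      exact ⟨⟨b, hsub hb⟩, hb, hB _⟩
  refine isFullAffineSpace_pluecker_ker B {b | b.1 ∈ s} hcard (fun t => chartMap π B s (c t))
    (fun t b hb => ?_) (fun t v => ?_) (fun v => isPolyMap_chartMap (fun k b => ?_) B v)
    (fun i => (E.symm i).1) (fun i => (E.symm i).2.2.1) (fun i => (E.symm i).2.2.2.1)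
    (fun t i => ?_)
  · rw [hB]
    exact chartMap_of_mem_levelSpan hπ hadm hJ hinj hB hs
      (pathVec_mem_levelSpan hb (Nat.zero_le _))
  · rw [himage]
    exact chartMap_mem_levelSpan hπ hadm hJ hinj hB hs v
  · by_cases h : IsFreePosition π s q k b
    · simp only [c, dif_pos h]
      exact coord_mem_polyFun _
    · simp only [c, dif_neg h]
      exact const_mem_polyFun 0
  · rw [repr_chartMap hπ hadm hJ hinj hB hs (hc t) (E.symm i).2]
    exact (dif_pos (E.symm i).2).trans (congrArg t (E.apply_symm_apply i))

end FullAffineSpaces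

theorem proposition5p2 {K : Type*} [Field K] [IsAlgClosed K]
    {Q : Type*} [Quiver Q] [Fintype Q] [∀ i j : Q, Finite (i ⟶ j)]
    {A : Type*} [Ring A] [Algebra K A]
    (π : PathAlgebra K Q →ₐ[K] A) (hπ : Function.Surjective π)
    (hadm : PathAlgebra.IsAdmissible (RingHom.ker π))
    (hinj : Module.Injective A A) (hJ : Ring.jacobson A ^ 3 = ⊥) :
    (∀ (t : ℕ) (e : Fin t → Q) (σ : Set (PathIn e)),
      IsNormalizedSkeleton π σ → (∀ r, PathIn.top r ∈ σ) →
        IsFullAffineSpace (grassVariety π σ)) ∧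
    ∀ d : Q → ℕ,
      (∀ σ : Set (PathIn (bigTop d)), IsNormalizedSkeleton π σ → skeletonDim σ = d →
        IsFullAffineSpace (grassVariety π σ)) ∧
      GRASS π d = ⋃ σ ∈ {σ : Set (PathIn (bigTop d)) |
        IsNormalizedSkeleton π σ ∧ skeletonDim σ = d}, GrassSkeleton π σ := by
  refine ⟨fun t e σ hσ _ => isFullAffineSpace_grassVariety hπ hadm hJ hinj hσ, fun d =>
    ⟨fun σ hσ _ => isFullAffineSpace_grassVariety hπ hadm hJ hinj hσ, ?_⟩⟩
  ext C
  simp only [Set.mem_iUnion, Set.mem_ofPred_eq, exists_prop]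
  constructor
  · intro hC
    -- The classes of the distinguished top elements generate the quotient, so a skeleton relative
    -- to the canonical map exists; its paths form a homogeneous basis, which yields the dimension
    -- vector.
    obtain ⟨σ, hσ, h⟩ := exists_isNormalizedSkeleton_isSkeletonRelative hπ hadm hJ hinj
      (M := Proj π (bigTop d) ⧸ C) (y := fun r => C.mkQ (topElt π (bigTop d) r))
      (fun r => by rw [← map_smul, vertexElt_smul_topElt]) (fun m => by
        obtain ⟨x, rfl⟩ := C.mkQ_surjective m
        refine ⟨fun r => (x r : A), ?_⟩
        conv_lhs => rw [← sum_smul_topElt x]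
        simp only [map_sum, map_smul])
    refine ⟨σ, ⟨hσ, funext fun i => ?_⟩, h⟩
    rw [← hC i, dimVec_eq_ncard (hσ.finite hJ) h.linearIndepOn h.span_eq_top]
  · rintro ⟨σ, ⟨hσ, hd⟩, h⟩ i
    rw [dimVec_eq_ncard (hσ.finite hJ) h.linearIndepOn h.span_eq_top, hd]
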